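/- Let $d\ge 1$, and let $\mathcal P$ be a partition of $\mathbb R^d$ into measurable sets such that almost every point of $\mathbb R^d$ lies in a set of $\mathcal P$ that has positive Lebesgue measure or is a single point (as is the case for every countable partition). For $\mu\in\mathbb R^d$, let the coarse Gaussian $\mathcal N_{\mathcal P}(\mu,I)$ be the law of the unique set $P\in\mathcal P$ that contains $x$, where $x\sim\mathcal N(\mu,I)$. Call $\mathcal P$ - *convex* if every $P\in\mathcal P$ is convex; - *$R$-local* if every $P\in\mathcal P$ that is not a singleton satisfies $P\subseteq B_\infty(0,R)=\{x:\|x\|_\infty\le R\}$; - *$\alpha$-information preserving with respect to $\mu^\star$* if $d_{\mathrm{TV}}(\mathcal N_{\mathcal P}(\mu^\star,I),\mathcal N_{\mathcal P}(\mu,I))\ge\alpha\, d_{\mathrm{TV}}(\mathcal N(\mu^\star,I),\mathcal N(\mu,I))$ for every $\mu\ne\mu^\star$. An algorithm is a program of a real random access machine (exact real numbers; arithmetic operations, square roots, comparisons and memory accesses at unit cost) that can draw i.i.d. samples $P\sim\mathcal N_{\mathcal P}(\mu^\star,I)$, and that accesses each drawn set $P$ only through a sampling oracle: for a query $\nu\in\mathbb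 R^d$ the oracle returns, in time $T_s$ and with fresh randomness, a sample of $\mathcal N(\nu,I)$ truncated to $P\cap B_\infty(0,R)$, or the point of $P$ if $P$ is a singleton. **Proposition.** There is a single algorithm, and there are an absolute constant $C$ and an absolute polynomial $p$, such that the following holds for all $d\ge1$, $R\ge1$, $D$, $\alpha\in(0,1]$ and $\varepsilon,\delta\in(0,1)$, which are the input of the algorithm. There is a natural number $$m\;\le\; C\cdot\frac{dR^2+D^2}{\alpha^4\varepsilon^2}\cdot\max\Big\{1,\log\frac{dRD}{\varepsilon\delta}\Big\}^3$$ such that, for every $\mu^\star\in\mathbb R^d$ with $\|\mu^\star\|_2\le D$ and every partition $\mathcal P$ as above that is convex, $R$-local and $\alpha$-information preserving with respect to $\mu^\star$, the algorithm always halts after drawing at most $m$ samples from $\mathcal N_{\mathcal P}(\mu^\star,I)$ and after time at most $p(m,T_s)$, and with probability at least $1-\delta$ its output $\tilde\mu$ satisfies $\|\tilde\mu-\mu^\star\|_2\le\varepsilon$. (For $D=0$, where the logarithm is undefined, the maximum is read as $1$.) -/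

import Mathlib

open MeasureTheory ProbabilityTheory

noncomputable section

namespace CoarseMean

/-! ## Partitions and coarse Gaussians -/

/-- The space `ℝ^d` with its Euclidean norm. -/
abbrev E (d : ℕ) : Type := EuclideanSpace ℝ (Fin d)

/-- The Gaussian distribution `N(μ, I)` on `ℝ^d`. -/
def gaussian {d : ℕ} (μ : E d) : Measure (E d) :=
  multivariateGaussian μ 1

/-- The closed `ℓ_∞`-ball `B_∞(0, R)`. -/
def box (d : ℕ) (R : ℝ) : Set (E d) := {x | ∀ i, |x i| ≤ R}

/-- The coarse observation of `x`: the unique set of the partition `𝒬` that contains `x`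
(written as the union of all sets of `𝒬` that contain `x`). -/
def cell {d : ℕ} (𝒬 : Set (Set (E d))) (x : E d) : Set (E d) :=
  ⋃₀ {P | P ∈ 𝒬 ∧ x ∈ P}

/-- A partition of `ℝ^d` into (nonempty) measurable sets whose sets are, up to a null set of `ℝ^d`,
sets of positive volume or single points. This always holds if the partition is countable; it is
what gives a meaning to the distribution truncated to an observed set. -/
structure IsObservablePartition {d : ℕ} (𝒬 : Set (Set (E d))) : Prop where
  isPartition : Setoid.IsPartition 𝒬
  measurableSet : ∀ P ∈ 𝒬, MeasurableSet P
  ae_cell : ∀ᵐ x : E d, 0 < volume (cell 𝒬 x) ∨ cell 𝒬 x = {x}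

/-- All sets of the partition are convex. -/
def IsConvexPartition {d : ℕ} (𝒬 : Set (Set (E d))) : Prop :=
  ∀ P ∈ 𝒬, Convex ℝ P

/-- All sets of the partition that are not singletons lie in `B_∞(0, R)`. -/
def IsLocalPartition {d : ℕ} (R : ℝ) (𝒬 : Set (Set (E d))) : Prop :=
  ∀ P ∈ 𝒬, (¬ ∃ x, P = {x}) → P ⊆ box d R

/-- The space of coarse observations of the partition `𝒬`. -/
def CoarseSpace {d : ℕ} (_𝒬 : Set (Set (E d))) : Type := Set (E d)

/-- The coarse observation, as a map to the space of coarse observations. -/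
def observe {d : ℕ} (𝒬 : Set (Set (E d))) : E d → CoarseSpace 𝒬 := cell 𝒬

/-- A family of sets of the partition is measurable if its union is. -/
instance {d : ℕ} (𝒬 : Set (Set (E d))) : MeasurableSpace (CoarseSpace 𝒬) :=
  MeasurableSpace.map (observe 𝒬) inferInstance

/-- The coarse Gaussian distribution: the law of the set of `𝒬` that contains `x`, for
`x ∼ N(μ, I)`. -/
def coarseGaussian {d : ℕ} (𝒬 : Set (Set (E d))) (μ : E d) : Measure (CoarseSpace 𝒬) :=
  (gaussian μ).map (observe 𝒬)

/-- The total variation distance of two (probability) measures. -/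
def tvDist {Ω : Type*} [MeasurableSpace Ω] (p q : Measure Ω) : ℝ :=
  ⨆ A : {A : Set Ω // MeasurableSet A}, |p.real A - q.real A|

/-- The partition `𝒬` is `α`-information preserving with respect to `μstar`. -/
def IsInformationPreserving {d : ℕ} (α : ℝ) (𝒬 : Set (Set (E d))) (μstar : E d) : Prop :=
  ∀ μ : E d, μ ≠ μstar →
    α * tvDist (gaussian μstar) (gaussian μ) ≤
      tvDist (coarseGaussian 𝒬 μstar) (coarseGaussian 𝒬 μ)

/-! ## The sampling oracle -/

/-- `S P ν s` is the answer of a randomized sampler to the query `(P, ν)` when its internal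
randomness is `s ∼ ρ`. It is a sampling oracle for `𝒬` if its answer lies in `P` (so on a singleton
it is the point of that singleton), and it has the law of `N(ν, I)` conditioned on `P ∩ B_∞(0, R)`
whenever that set has positive volume. -/
structure IsSamplingOracle {d : ℕ} (R : ℝ) (𝒬 : Set (Set (E d))) {Seed : Type}
    [MeasurableSpace Seed] (ρ : Measure Seed) (S : Set (E d) → E d → Seed → E d) : Prop where
  mem : ∀ P ∈ 𝒬, ∀ ν s, S P ν s ∈ P
  measurable : ∀ P ∈ 𝒬, Measurable (fun q : E d × Seed => S P q.1 q.2)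
  law : ∀ P ∈ 𝒬, 0 < volume (P ∩ box d R) →
    ∀ ν, ρ.map (S P ν) = ProbabilityTheory.cond (gaussian ν) (P ∩ box d R)

/-! ## The machine model

Algorithms are programs of a real random access machine. It has registers for natural numbers, and
a memory of exact real numbers that is addressed by natural numbers. Arithmetic operations, square
roots, comparisons and memory accesses have unit cost. (Division by zero and the square root of a
negative number return zero.) The machine can draw a fresh coarse sample, to which it has access
only by calls of the sampling oracle. One program serves all dimensions and all parameters. -/

/-- Natural-number expressions over the registers. -/
inductive NExp : Type
  | const (k : ℕ)
  | reg (i : ℕ)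
  | add (a b : NExp)
  | sub (a b : NExp)
  | mul (a b : NExp)

/-- Real expressions; `mem a` reads the real memory at the address `a`. -/
inductive RExp : Type
  | ofNat (a : NExp)
  | mem (a : NExp)
  | add (a b : RExp)
  | sub (a b : RExp)
  | mul (a b : RExp)
  | div (a b : RExp)
  | sqrt (a : RExp)

/-- Comparisons. -/
inductive Test : Type
  | natLt (a b : NExp)
  | realLt (a b : RExp)

/-- Programs. `setNat i e` assigns to a register, `setReal a e` writes the real memory at the
address `a`, `draw` obtains one more coarse sample, and `oracle h a b` calls the sampling oracle for
the coarse sample with number `h` and the mean stored at `a, …, a + d - 1`, and stores the answer at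
`b, …, b + d - 1`. `loop b c` repeats `c` while `b` holds. -/
inductive Cmd : Type
  | skip
  | setNat (i : ℕ) (e : NExp)
  | setReal (a : NExp) (e : RExp)
  | draw
  | oracle (h a b : NExp)
  | seq (c₁ c₂ : Cmd)
  | ite (b : Test) (c₁ c₂ : Cmd)
  | loop (b : Test) (c : Cmd)

/-- The state of the machine: registers, real memory, number of coarse samples drawn so far, number
of oracle calls so far. The last two are not visible to the program. -/
structure State : Type where
  nat : ℕ → ℕ
  mem : ℕ → ℝ
  drawn : ℕ
  calls : ℕ

/-- The value of a natural-number expression. -/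
def NExp.eval (s : State) : NExp → ℕ
  | .const k => k
  | .reg i => s.nat i
  | .add a b => a.eval s + b.eval s
  | .sub a b => a.eval s - b.eval s
  | .mul a b => a.eval s * b.eval s

/-- The number of operations in a natural-number expression. -/
def NExp.cost : NExp → ℕ
  | .const _ => 1
  | .reg _ => 1
  | .add a b => a.cost + b.cost + 1
  | .sub a b => a.cost + b.cost + 1
  | .mul a b => a.cost + b.cost + 1

/-- The value of a real expression. -/
def RExp.eval (s : State) : RExp → ℝ
  | .ofNat a => (a.eval s : ℝ)
  | .mem a => s.mem (a.eval s)
  | .add a b => a.eval s + b.eval s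
  | .sub a b => a.eval s - b.eval s
  | .mul a b => a.eval s * b.eval s
  | .div a b => a.eval s / b.eval s
  | .sqrt a => Real.sqrt (a.eval s)

/-- The number of operations in a real expression. -/
def RExp.cost : RExp → ℕ
  | .ofNat a => a.cost + 1
  | .mem a => a.cost + 1
  | .add a b => a.cost + b.cost + 1
  | .sub a b => a.cost + b.cost + 1
  | .mul a b => a.cost + b.cost + 1
  | .div a b => a.cost + b.cost + 1
  | .sqrt a => a.cost + 1

/-- The outcome of a comparison. -/
def Test.holds (s : State) : Test → Prop
  | .natLt a b => a.eval s < b.eval s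
  | .realLt a b => a.eval s < b.eval s

/-- The number of operations in a comparison. -/
def Test.cost : Test → ℕ
  | .natLt a b => a.cost + b.cost + 1
  | .realLt a b => a.cost + b.cost + 1

/-- The vector stored at the addresses `a, …, a + d - 1`. -/
def State.vec (d : ℕ) (s : State) (a : ℕ) : E d :=
  WithLp.toLp 2 fun i : Fin d => s.mem (a + i)

/-- The memory after storing the vector `y` at the addresses `b, …, b + d - 1`. -/
def State.store {d : ℕ} (s : State) (b : ℕ) (y : E d) : ℕ → ℝ :=
  fun j => if h : b ≤ j ∧ j < b + d then y ⟨j - b, by omega⟩ else s.mem j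

/-- What the machine interacts with: the coarse samples, the answers `answer k P ν` that the
sampling oracle gives if its `k`-th call is the query `(P, ν)`, and the time `Ts` of one such
call. -/
structure Env (d : ℕ) : Type where
  sample : ℕ → Set (E d)
  answer : ℕ → Set (E d) → E d → E d
  Ts : ℕ

/-- `Exec e c s s' t`: started in the state `s`, the program `c` halts in the state `s'` after time
`t`. An oracle call is possible only for a coarse sample that has been drawn; it takes time `Ts`,
and time `d` for the transfer of the vectors. -/
inductive Exec {d : ℕ} (e : Env d) : Cmd → State → State → ℕ → Prop
  | skip (s : State) : Exec e .skip s s 1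
  | setNat (s : State) (i : ℕ) (a : NExp) :
      Exec e (.setNat i a) s { s with nat := Function.update s.nat i (a.eval s) } (a.cost + 1)
  | setReal (s : State) (a : NExp) (r : RExp) :
      Exec e (.setReal a r) s { s with mem := Function.update s.mem (a.eval s) (r.eval s) }
        (a.cost + r.cost + 1)
  | draw (s : State) : Exec e .draw s { s with drawn := s.drawn + 1 } 1
  | oracle (s : State) (h a b : NExp) (hh : h.eval s < s.drawn) :
      Exec e (.oracle h a b) s
        { s with
          mem := s.store (b.eval s)
            (e.answer s.calls (e.sample (h.eval s)) (s.vec d (a.eval s)))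
          calls := s.calls + 1 }
        (h.cost + a.cost + b.cost + e.Ts + d + 1)
  | seq {c₁ c₂ : Cmd} {s s₁ s₂ : State} {t₁ t₂ : ℕ} (h₁ : Exec e c₁ s s₁ t₁)
      (h₂ : Exec e c₂ s₁ s₂ t₂) : Exec e (.seq c₁ c₂) s s₂ (t₁ + t₂)
  | iteTrue {b : Test} {c₁ c₂ : Cmd} {s s₁ : State} {t : ℕ} (hb : b.holds s)
      (h : Exec e c₁ s s₁ t) : Exec e (.ite b c₁ c₂) s s₁ (b.cost + t)
  | iteFalse {b : Test} {c₁ c₂ : Cmd} {s s₁ : State} {t : ℕ} (hb : ¬ b.holds s)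
      (h : Exec e c₂ s s₁ t) : Exec e (.ite b c₁ c₂) s s₁ (b.cost + t)
  | loopTrue {b : Test} {c : Cmd} {s s₁ s₂ : State} {t₁ t₂ : ℕ} (hb : b.holds s)
      (h₁ : Exec e c s s₁ t₁) (h₂ : Exec e (.loop b c) s₁ s₂ t₂) :
      Exec e (.loop b c) s s₂ (b.cost + t₁ + t₂)
  | loopFalse {b : Test} {c : Cmd} {s : State} (hb : ¬ b.holds s) :
      Exec e (.loop b c) s s b.cost

/-- Programs are deterministic: all randomness is in the samples and in the oracle answers. -/
theorem Exec.deterministic {d : ℕ} {e : Env d} {c : Cmd} {s s₁ : State} {t₁ : ℕ}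
    (h₁ : Exec e c s s₁ t₁) : ∀ {s₂ : State} {t₂ : ℕ}, Exec e c s s₂ t₂ → s₁ = s₂ ∧ t₁ = t₂ := by
  induction h₁ with
  | skip s => intro s₂ t₂ h; cases h; exact ⟨rfl, rfl⟩
  | setNat s i a => intro s₂ t₂ h; cases h; exact ⟨rfl, rfl⟩
  | setReal s a r => intro s₂ t₂ h; cases h; exact ⟨rfl, rfl⟩
  | draw s => intro s₂ t₂ h; cases h; exact ⟨rfl, rfl⟩
  | oracle s h a b hh => intro s₂ t₂ h; cases h; exact ⟨rfl, rfl⟩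
  | seq _ _ ih₁ ih₂ =>
    intro s₂ t₂ h
    cases h with
    | seq h₁ h₂ =>
      obtain ⟨rfl, rfl⟩ := ih₁ h₁
      obtain ⟨rfl, rfl⟩ := ih₂ h₂
      exact ⟨rfl, rfl⟩
  | iteTrue hb _ ih =>
    intro s₂ t₂ h
    cases h with
    | iteTrue _ h => obtain ⟨rfl, rfl⟩ := ih h; exact ⟨rfl, rfl⟩
    | iteFalse hb' _ => exact absurd hb hb'
  | iteFalse hb _ ih =>
    intro s₂ t₂ h
    cases h with
    | iteTrue hb' _ => exact absurd hb' hb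
    | iteFalse _ h => obtain ⟨rfl, rfl⟩ := ih h; exact ⟨rfl, rfl⟩
  | loopTrue hb _ _ ih₁ ih₂ =>
    intro s₂ t₂ h
    cases h with
    | loopTrue _ h₁ h₂ =>
      obtain ⟨rfl, rfl⟩ := ih₁ h₁
      obtain ⟨rfl, rfl⟩ := ih₂ h₂
      exact ⟨rfl, rfl⟩
    | loopFalse hb' => exact absurd hb hb'
  | loopFalse hb =>
    intro s₂ t₂ h
    cases h with
    | loopTrue hb' _ _ => exact absurd hb' hb
    | loopFalse _ => exact ⟨rfl, rfl⟩

/-- The initial state. The input is `d` in the register `0`, and `R, D, α, ε, δ` at the addresses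
`0, …, 4`. -/
def State.init (d : ℕ) (R D α ε δ : ℝ) : State where
  nat := fun i => if i = 0 then d else 0
  mem := fun j => if j = 0 then R else if j = 1 then D else if j = 2 then α else
    if j = 3 then ε else if j = 4 then δ else 0
  drawn := 0
  calls := 0

/-- The output: the vector stored at the addresses `0, …, d - 1`. -/
def State.output (d : ℕ) (s : State) : E d := s.vec d 0

/-- The interaction when nature draws the points `x 0, x 1, …` and the sampler `S` uses the
randomness `r k` in its `k`-th call: the program is given the sets of `𝒬` that contain the
points. -/
def env {d : ℕ} (𝒬 : Set (Set (E d))) {Seed : Type} (S : Set (E d) → E d → Seed → E d) (Ts : ℕ)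
    (x : ℕ → E d) (r : ℕ → Seed) : Env d where
  sample := fun i => cell 𝒬 (x i)
  answer := fun k P ν => S P ν (r k)
  Ts := Ts

/-- The law of all randomness: the points are i.i.d. from `N(μ, I)`, and the randomness of the
oracle calls is i.i.d. from `ρ` and independent of the points. -/
def randomness {d : ℕ} (μ : E d) {Seed : Type} [MeasurableSpace Seed] (ρ : Measure Seed)
    [IsProbabilityMeasure ρ] : Measure ((ℕ → E d) × (ℕ → Seed)) :=
  haveI : IsProbabilityMeasure (gaussian μ) := by unfold gaussian; infer_instance
  (Measure.infinitePi fun _ : ℕ => gaussian μ).prod (Measure.infinitePi fun _ : ℕ => ρ)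

end CoarseMean

end

noncomputable section

namespace CoarseMean

open scoped RealInnerProductSpace ENNReal

/-! The algorithm is stochastic gradient descent on the coarse negative log-likelihood, the mean of
`-log N(y, I)(P)` over samples `P` drawn under the true mean `μ`. Its gradient at `y` is `y` minus
the mean of `N(y, I)` conditioned on `P`. So `y` minus one oracle answer for a fresh sample is an
unbiased estimate, and locality bounds its second moment by a multiple of `X = d R² + D²`.

The heart is `min_le_integral_inner_response`: with `r = ‖y - μ‖`, the expected gradient has inner
product at least `α² / 200 * min r r²` with `y - μ`. For a convex cell `P`, Prékopa–Leindler makes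
`log N(y, I)(P)` concave in `y` (`gaussian_mul_le_sq`). A tangent inequality (`log_gaussian_sub_le`)
then bounds the inner product below by the log-likelihood ratio of `μ` against `y`. Concavity bounds
this in turn by `2 ^ k` times the log ratio of `μ` against `ν = μ + 2 ^ (-k) (y - μ)`, with `k`
chosen such that `‖ν - μ‖ ≤ 1`. The mean of that log ratio is at least a squared Hellinger distance,
hence at least a quarter of the squared total variation distance of the coarse laws
(`tvDist_sq_le_coarseHellinger`). Information preservation and the bound `‖ν - μ‖ / 5` for nearby
Gaussians (`le_tvDist_gaussian`) finish the estimate.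

On a ball of radius `r` a projected step therefore contracts the mean squared error up to a small
noise term. With a step size proportional to `r² / (1 + 2r)`, a number `T` of steps of order `X /
(α⁴ ε²)`, the same for all `r > ε`, gives error at most `r / 6` with probability 7/8. A point close
to more than half of the results of `J` independent runs has error at most `r / 2`, except with
probability `(11/16) ^ J` (`streamLaw_stage_bad_le`). The radius starts at `D` and is halved in each
of `K` stages. As `J` and `K` are logarithmic, `K * (J * T)` samples suffice.

The hidden points and the seeds of the oracle are paired into one i.i.d. stream of which each step
reads one new term. The program is handled separately: for every realization its output equals
`stages`, the mathematical description of the method (`runs_algorithm`). The probability estimate is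
then `randomness_stages_bad_le`. -/

instance {d : ℕ} (μ : E d) : IsProbabilityMeasure (gaussian μ) := by
  unfold gaussian; infer_instance

/-! ### Gaussian densities, likelihood ratios and moments. -/

/-- The density of `N(μ, I)`. -/
def gaussianDensity {d : ℕ} (μ x : E d) : ℝ :=
  (2 * Real.pi) ^ (-(d : ℝ) / 2) * Real.exp (-‖x - μ‖ ^ 2 / 2)

theorem gaussianDensity_pos {d : ℕ} (μ x : E d) : 0 < gaussianDensity μ x := by
  unfold gaussianDensity; positivity

theorem continuous_gaussianDensity {d : ℕ} (μ : E d) : Continuous (gaussianDensity μ) := by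
  unfold gaussianDensity; fun_prop

theorem gaussian_eq_map {d : ℕ} (μ : E d) :
    gaussian μ = (stdGaussian (E d)).map (fun x => μ + x) := by
  simp [gaussian, multivariateGaussian]

theorem integrable_gaussianDensity {d : ℕ} (μ : E d) : Integrable (gaussianDensity μ) := by
  have h := GaussianFourier.integrable_cexp_neg_mul_sq_norm_add (V := E d) (b := 1 / 2)
    (by norm_num) 0 0
  have h2 : Integrable (fun x : E d => Real.exp (-‖x‖ ^ 2 / 2)) := by
    have := h.re
    refine this.congr (Filter.Eventually.of_forall fun x => ?_)
    simp only [zero_mul, add_zero]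
    have e : (-(1 / 2 : ℂ) * (‖x‖ : ℂ) ^ 2) = ((-‖x‖ ^ 2 / 2 : ℝ) : ℂ) := by push_cast; ring
    rw [e, ← Complex.ofReal_exp]; exact Complex.ofReal_re _
  exact (h2.comp_sub_right μ).const_mul _

/-- Finite measures with equal characteristic functions agree, and the one of the density is a
Gaussian Fourier integral. -/
theorem stdGaussian_eq_withDensity (d : ℕ) : stdGaussian (E d) =
    volume.withDensity (fun x => ENNReal.ofReal (gaussianDensity 0 x)) := by
  have hfin : IsFiniteMeasure (volume.withDensity
      (fun x : E d => ENNReal.ofReal (gaussianDensity 0 x))) :=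
    isFiniteMeasure_withDensity_ofReal (integrable_gaussianDensity (0 : E d)).2
  apply Measure.ext_of_charFun
  ext t
  rw [charFun_stdGaussian, charFun_apply,
    integral_withDensity_eq_integral_toReal_smul
      (continuous_gaussianDensity 0).measurable.ennreal_ofReal (by simp)]
  have h := GaussianFourier.integral_cexp_neg_mul_sq_norm_add (V := E d) (b := 1 / 2)
    (by norm_num) Complex.I t
  have h2 : ∀ x : E d, (ENNReal.ofReal (gaussianDensity 0 x)).toReal •
      Complex.exp (⟪x, t⟫ * Complex.I) = ((2 * Real.pi) ^ (-(d : ℝ) / 2) : ℝ) *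
        Complex.exp (-(1 / 2 : ℂ) * (‖x‖ : ℂ) ^ 2 + Complex.I * ⟪t, x⟫) := by
    intro x
    rw [ENNReal.toReal_ofReal (gaussianDensity_pos _ _).le, gaussianDensity, sub_zero,
      Complex.real_smul, Complex.ofReal_mul, mul_assoc, Complex.ofReal_exp, ← Complex.exp_add,
      real_inner_comm]
    congr 2; push_cast; ring
  simp_rw [h2]
  rw [integral_const_mul, h]
  rw [finrank_euclideanSpace_fin, ← mul_assoc]
  have e1 : ((Real.pi : ℂ) / (1 / 2)) ^ ((d : ℂ) / 2) = (((2 * Real.pi) ^ ((d : ℝ) / 2) : ℝ) : ℂ) := by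
    rw [Complex.ofReal_cpow (by positivity)]; push_cast; congr 1; ring
  rw [e1, ← Complex.ofReal_mul, ← Real.rpow_add (by positivity)]
  rw [show -(d : ℝ) / 2 + d / 2 = 0 by ring, Real.rpow_zero]
  simp only [Complex.ofReal_one, one_mul, Complex.I_sq]
  congr 1; ring

theorem gaussian_eq_withDensity {d : ℕ} (μ : E d) : gaussian μ =
    volume.withDensity (fun x => ENNReal.ofReal (gaussianDensity μ x)) := by
  rw [gaussian_eq_map, stdGaussian_eq_withDensity]
  have hm : ∀ a : E d, Measurable fun x => ENNReal.ofReal (gaussianDensity a x) := fun a =>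
    (continuous_gaussianDensity a).measurable.ennreal_ofReal
  ext s hs
  have hadd : Measurable fun x : E d => μ + x := by fun_prop
  rw [Measure.map_apply hadd hs, withDensity_apply _ (hadd hs), withDensity_apply _ hs,
    ← lintegral_indicator (hadd hs), ← lintegral_indicator hs]
  refine Eq.trans ?_ (lintegral_add_left_eq_self (μ := volume) _ μ)
  congr 1; ext x
  by_cases hx : μ + x ∈ s
  · rw [Set.indicator_of_mem hx, Set.indicator_of_mem (by exact hx)]; simp [gaussianDensity]
  · rw [Set.indicator_of_notMem hx, Set.indicator_of_notMem (by exact hx)]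

theorem gaussian_absolutelyContinuous {d : ℕ} (μ : E d) : gaussian μ ≪ volume := by
  rw [gaussian_eq_withDensity]; exact withDensity_absolutelyContinuous _ _

theorem absolutelyContinuous_gaussian {d : ℕ} (μ : E d) : volume ≪ gaussian μ := by
  rw [gaussian_eq_withDensity]
  refine withDensity_absolutelyContinuous'
    (continuous_gaussianDensity μ).measurable.ennreal_ofReal.aemeasurable ?_
  exact Filter.Eventually.of_forall fun x => by simpa using gaussianDensity_pos μ x

/-- The likelihood ratio of `N(ν, I)` and `N(μ, I)`. -/
def likelihoodRatio {d : ℕ} (μ ν x : E d) : ℝ :=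
  Real.exp (⟪x - μ, ν - μ⟫ - ‖ν - μ‖ ^ 2 / 2)

theorem likelihoodRatio_pos {d : ℕ} (μ ν x : E d) : 0 < likelihoodRatio μ ν x := Real.exp_pos _

theorem continuous_likelihoodRatio {d : ℕ} (μ ν : E d) : Continuous (likelihoodRatio μ ν) := by
  unfold likelihoodRatio; fun_prop

theorem gaussianDensity_mul_likelihoodRatio {d : ℕ} (μ ν x : E d) :
    gaussianDensity μ x * likelihoodRatio μ ν x = gaussianDensity ν x := by
  unfold gaussianDensity likelihoodRatio
  rw [mul_assoc, ← Real.exp_add]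
  congr 2
  have : x - ν = (x - μ) - (ν - μ) := by abel
  rw [this, norm_sub_sq_real (x - μ)]; ring

theorem gaussian_withDensity_likelihoodRatio {d : ℕ} (μ ν : E d) : gaussian ν =
    (gaussian μ).withDensity (fun x => ENNReal.ofReal (likelihoodRatio μ ν x)) := by
  rw [gaussian_eq_withDensity μ, ← withDensity_mul _
    (continuous_gaussianDensity μ).measurable.ennreal_ofReal
    (continuous_likelihoodRatio μ ν).measurable.ennreal_ofReal, gaussian_eq_withDensity ν]
  congr 1; ext x
  simp only [Pi.mul_apply]
  rw [← ENNReal.ofReal_mul (gaussianDensity_pos _ _).le, gaussianDensity_mul_likelihoodRatio]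

theorem integrable_likelihoodRatio {d : ℕ} (μ ν : E d) :
    Integrable (likelihoodRatio μ ν) (gaussian μ) := by
  refine ⟨(continuous_likelihoodRatio μ ν).aestronglyMeasurable, ?_⟩
  rw [hasFiniteIntegral_iff_ofReal (Filter.Eventually.of_forall fun x =>
    (likelihoodRatio_pos μ ν x).le)]
  have := congrArg (fun m => m Set.univ) (gaussian_withDensity_likelihoodRatio μ ν)
  simp only [measure_univ, withDensity_apply _ MeasurableSet.univ, Measure.restrict_univ] at this
  rw [← this]; simp

theorem gaussian_real_eq_setIntegral {d : ℕ} (μ ν : E d) {s : Set (E d)} (hs : MeasurableSet s) :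
    (gaussian ν).real s = ∫ x in s, likelihoodRatio μ ν x ∂gaussian μ := by
  rw [gaussian_withDensity_likelihoodRatio μ ν, measureReal_def, withDensity_apply _ hs,
    ← ofReal_integral_eq_lintegral_ofReal (integrable_likelihoodRatio μ ν).restrict
      (Filter.Eventually.of_forall fun x => (likelihoodRatio_pos μ ν x).le),
    ENNReal.toReal_ofReal (integral_nonneg fun x => (likelihoodRatio_pos μ ν x).le)]

theorem integrable_sq_coord_gaussian {d : ℕ} (μ : E d) (i : Fin d) :
    Integrable (fun x : E d => x i ^ 2) (gaussian μ) := by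
  have h : MemLp (fun x : E d => x i) 2 (gaussian μ) :=
    (memLp_id_gaussianReal 2).comp_measurePreserving
      (measurePreserving_eval_multivariateGaussian Matrix.PosSemidef.one (μ := μ) (i := i))
  exact h.integrable_sq

theorem integrable_norm_sq_gaussian {d : ℕ} (μ : E d) :
    Integrable (fun x : E d => ‖x‖ ^ 2) (gaussian μ) := by
  simp_rw [EuclideanSpace.real_norm_sq_eq]
  exact integrable_finsetSum _ fun i _ => integrable_sq_coord_gaussian μ i

theorem integral_norm_sq_gaussian {d : ℕ} (μ : E d) :
    ∫ x, ‖x‖ ^ 2 ∂gaussian μ = ‖μ‖ ^ 2 + d := by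
  simp_rw [EuclideanSpace.real_norm_sq_eq]
  rw [integral_finsetSum _ fun i _ => integrable_sq_coord_gaussian μ i]
  have h : ∀ i : Fin d, ∫ x, x i ^ 2 ∂gaussian μ = μ i ^ 2 + 1 := by
    intro i
    have hp := measurePreserving_eval_multivariateGaussian
      (Matrix.PosSemidef.one (n := Fin d) (R := ℝ)) (μ := μ) (i := i)
    have hl : MemLp (fun x : E d => x i) 2 (gaussian μ) :=
      (memLp_id_gaussianReal 2).comp_measurePreserving hp
    have hv := variance_eval_multivariateGaussian
      (Matrix.PosSemidef.one (n := Fin d) (R := ℝ)) (μ := μ) i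
    have hmean : ∫ x, x i ∂gaussian μ = μ i := by
      have := integral_map (μ := gaussian μ) hp.measurable.aemeasurable (f := fun y : ℝ => y)
        (by fun_prop)
      rw [gaussian] at this ⊢
      rw [← this, hp.map_eq, integral_id_gaussianReal]
    change variance (fun x : E d => x i) (gaussian μ) = _ at hv
    rw [variance_eq_sub hl, hmean] at hv
    simp at hv
    linarith
  simp_rw [h]
  simp [Finset.sum_add_distrib]

/-- The law of a linear functional of a standard Gaussian vector. -/
theorem stdGaussian_map_inner {d : ℕ} (v : E d) :
    (stdGaussian (E d)).map (fun x => ⟪v, x⟫) = gaussianReal 0 (‖v‖ ^ 2).toNNReal := by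
  have := IsGaussian.map_eq_gaussianReal (μ := stdGaussian (E d)) (innerSL ℝ v)
  rw [variance_dual_stdGaussian, integral_strongDual_stdGaussian] at this
  simpa using this

/-! ### Total variation distance of two Gaussian distributions. -/

theorem tvDist_bddAbove {Ω : Type*} [MeasurableSpace Ω] (p q : Measure Ω) [IsProbabilityMeasure p]
    [IsProbabilityMeasure q] : BddAbove (Set.range fun A : {A : Set Ω // MeasurableSet A} =>
      |p.real A - q.real A|) := by
  refine ⟨1, ?_⟩
  rintro _ ⟨A, rfl⟩
  have h1 := measureReal_le_one (μ := p) (s := (A : Set Ω))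
  have h2 := measureReal_le_one (μ := q) (s := (A : Set Ω))
  have h3 := measureReal_nonneg (μ := p) (s := (A : Set Ω))
  have h4 := measureReal_nonneg (μ := q) (s := (A : Set Ω))
  simp only [abs_le]; constructor <;> linarith

theorem le_tvDist {Ω : Type*} [MeasurableSpace Ω] (p q : Measure Ω) [IsProbabilityMeasure p]
    [IsProbabilityMeasure q] {A : Set Ω} (hA : MeasurableSet A) :
    |p.real A - q.real A| ≤ tvDist p q :=
  le_ciSup (tvDist_bddAbove p q) ⟨A, hA⟩

/-- Nearby Gaussian distributions are at a total variation distance of the order of the distance of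
their means. -/
theorem le_tvDist_gaussian {d : ℕ} (μ ν : E d) (h : ‖ν - μ‖ ≤ 1) :
    ‖ν - μ‖ / 5 ≤ tvDist (gaussian μ) (gaussian ν) := by
  rcases eq_or_ne ν μ with rfl | hne
  · simpa using (abs_nonneg _).trans (le_tvDist (gaussian ν) (gaussian ν) MeasurableSet.univ)
  set ρ := ‖ν - μ‖ with hρ
  have hρ0 : 0 < ρ := norm_pos_iff.2 (sub_ne_zero.2 hne)
  set u : E d := ρ⁻¹ • (ν - μ) with hu
  have hun : ‖u‖ = 1 := by rw [hu, norm_smul, norm_inv, Real.norm_of_nonneg hρ0.le, ← hρ]; field_simp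
  have huv : ⟪u, ν - μ⟫ = ρ := by
    rw [hu, real_inner_smul_left, real_inner_self_eq_norm_sq, ← hρ]; field_simp
  have hmeas : Measurable fun x : E d => ⟪u, x⟫ := by fun_prop
  -- In the direction `u` of `ν - μ` both laws are shifts of the standard normal law on the line.
  have hlaw : ∀ (a : E d) (s : Set ℝ), MeasurableSet s → (gaussian a).real ((fun x => ⟪u, x⟫) ⁻¹' s) =
      (gaussianReal 0 1).real ((fun y => ⟪u, a⟫ + y) ⁻¹' s) := by
    intro a s hs
    have := stdGaussian_map_inner u
    rw [hun] at this
    simp only [one_pow, Real.toNNReal_one] at this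
    rw [← this, gaussian_eq_map, map_measureReal_apply (measurable_const_add a) (hmeas hs),
      map_measureReal_apply hmeas (measurable_const_add _ hs)]
    congr 1; ext x; simp [inner_add_right]
  -- The test event is the half-space bounded by the hyperplane through `μ` orthogonal to `u`. The
  -- two probabilities differ by the standard normal mass of `(-ρ, 0]`.
  have hA := le_tvDist (gaussian μ) (gaussian ν) (A := (fun x => ⟪u, x⟫) ⁻¹' Set.Iic ⟪u, μ⟫)
    (hmeas measurableSet_Iic)
  rw [hlaw _ _ measurableSet_Iic, hlaw _ _ measurableSet_Iic] at hA
  refine le_trans ?_ ((le_abs_self _).trans hA)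
  have hν : ⟪u, ν⟫ = ⟪u, μ⟫ + ρ := by rw [← huv, inner_sub_right]; ring
  have e1 : (fun y => ⟪u, μ⟫ + y) ⁻¹' Set.Iic ⟪u, μ⟫ = Set.Iic 0 := by ext; simp
  have e2 : (fun y => ⟪u, ν⟫ + y) ⁻¹' Set.Iic ⟪u, μ⟫ = Set.Iic (-ρ) := by
    ext y; simp only [hν, Set.mem_Iic, Set.mem_preimage]; constructor <;> intro h <;> linarith
  rw [e1, e2, ← measureReal_sdiff (Set.Iic_subset_Iic.2 (by linarith)) measurableSet_Iic]
  have e3 : Set.Iic (0 : ℝ) \ Set.Iic (-ρ) = Set.Ioc (-ρ) 0 := by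
    ext y; simp [and_comm]
  rw [e3, measureReal_def, gaussianReal_apply_eq_integral 0 one_ne_zero, ENNReal.toReal_ofReal
    (setIntegral_nonneg measurableSet_Ioc fun x _ => gaussianPDFReal_nonneg _ _ _)]
  -- As `ρ ≤ 1`, the density is at least `exp (-1/2) / √(2π)`, about 0.24. The bounds `√(2π) ≤ 2.51`
  -- and `√e ≤ 1.75` leave room for 1/5.
  have hb : ∀ x ∈ Set.Ioc (-ρ) 0, (1 / 5 : ℝ) ≤ gaussianPDFReal 0 1 x := by
    intro x hx
    have hx2 : x ^ 2 ≤ 1 := by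
      have h1 : -1 ≤ x := by linarith [hx.1]
      nlinarith [hx.2]
    simp only [gaussianPDFReal, NNReal.coe_one, mul_one, sub_zero]
    have hs : √(2 * Real.pi) ≤ 2.51 := by
      rw [Real.sqrt_le_left (by norm_num)]
      have := Real.pi_lt_d4; nlinarith
    have hs0 : 0 < √(2 * Real.pi) := by positivity
    have he : (1 : ℝ) / 1.75 ≤ Real.exp (-x ^ 2 / 2) := by
      have h1 : Real.exp (-(1 / 2)) ≤ Real.exp (-x ^ 2 / 2) := Real.exp_le_exp.2 (by linarith)
      have h3 : Real.exp (1 / 2) ^ 2 = Real.exp 1 := by rw [← Real.exp_nat_mul]; norm_num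
      have h2 : Real.exp (1 / 2) ≤ 1.75 := by
        have := Real.exp_one_lt_d9
        have h0 := Real.exp_pos (1 / 2)
        nlinarith
      rw [Real.exp_neg] at h1
      refine le_trans ?_ h1
      rw [one_div]
      exact inv_anti₀ (Real.exp_pos _) h2
    calc (1 / 5 : ℝ) ≤ (2.51)⁻¹ * (1 / 1.75) := by norm_num
      _ ≤ _ := by gcongr
  calc ρ / 5 = ∫ x in Set.Ioc (-ρ) 0, (1 / 5 : ℝ) := by simp [hρ0.le]; ring
    _ ≤ _ := setIntegral_mono_on (by simp) (integrable_gaussianPDFReal 0 1).integrableOn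
      measurableSet_Ioc hb

/-! ### The Prékopa–Leindler inequality and log-concavity in the mean. -/

open scoped Pointwise

theorem ENNReal_mul_le_sq_of_add_le {a b c : ℝ≥0∞} (h : a + b ≤ 2 * c) : a * b ≤ c ^ 2 := by
  rcases eq_or_ne c ∞ with rfl | hc
  · simp
  have hab : a + b ≠ ∞ := ne_top_of_le_ne_top (ENNReal.mul_ne_top (by simp) hc) h
  obtain ⟨ha, hb⟩ := ENNReal.add_ne_top.1 hab
  lift a to NNReal using ha
  lift b to NNReal using hb
  lift c to NNReal using hc
  norm_cast at h ⊢
  have h' : (a : ℝ) + b ≤ 2 * c := by exact_mod_cast h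
  have : (a : ℝ) * b ≤ c ^ 2 := by
    nlinarith [sq_nonneg ((a : ℝ) - b), a.2, b.2, c.2, mul_self_nonneg ((a : ℝ) + b)]
  exact_mod_cast this

/-- The Brunn–Minkowski inequality on the line for compact sets. -/
theorem volume_add_volume_le_of_isCompact {A B H : Set ℝ} (hA : IsCompact A) (hB : IsCompact B)
    (hA0 : A.Nonempty) (hB0 : B.Nonempty) (h : ∀ a ∈ A, ∀ b ∈ B, (1 / 2 : ℝ) * (a + b) ∈ H) :
    volume A + volume B ≤ 2 * volume H := by
  obtain ⟨a, haA, ha⟩ := hA.exists_isGreatest hA0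
  obtain ⟨b, hbB, hb⟩ := hB.exists_isLeast hB0
  have e : (2 : ℝ≥0∞) * volume H = volume ((2 : ℝ) • H) := by
    rw [Measure.addHaar_smul]; simp
  rw [e]
  -- Both `b + A` and `a + B` lie in `2 • H`. Since `a` is the maximum of `A` and `b` the minimum of
  -- `B`, they meet at most in the point `a + b`.
  have h1 : volume ((fun x => b + x) '' A) = volume A := by simp
  have h2 : volume ((fun x => a + x) '' B) = volume B := by simp
  have hm : MeasurableSet ((fun x => a + x) '' B) :=
    (hB.image (continuous_const.add continuous_id)).measurableSet
  rw [← h1, ← h2, ← measure_union₀ hm.nullMeasurableSet]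
  · refine measure_mono ?_
    rintro _ (⟨x, hx, rfl⟩ | ⟨x, hx, rfl⟩)
    · exact Set.mem_smul_set.2 ⟨_, h x hx b hbB, by simp only [smul_eq_mul]; ring⟩
    · exact Set.mem_smul_set.2 ⟨_, h a haA x hx, by simp only [smul_eq_mul]; ring⟩
  · refine measure_mono_null (t := {a + b}) ?_ (by simp)
    rintro _ ⟨⟨x, hx, rfl⟩, ⟨y, hy, hxy⟩⟩
    have h1 := ha hx
    have h2 := hb hy
    simp only at hxy
    simp only [Set.mem_singleton_iff]
    linarith

/-- The Brunn–Minkowski inequality on the line. -/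
theorem volume_add_volume_le {A B H : Set ℝ} (hA : MeasurableSet A) (hB : MeasurableSet B)
    (hA0 : A.Nonempty) (hB0 : B.Nonempty) (h : ∀ a ∈ A, ∀ b ∈ B, (1 / 2 : ℝ) * (a + b) ∈ H) :
    volume A + volume B ≤ 2 * volume H := by
  obtain ⟨a, ha⟩ := hA0
  obtain ⟨b, hb⟩ := hB0
  rw [hA.measure_eq_iSup_isCompact, hB.measure_eq_iSup_isCompact]
  simp_rw [iSup_and']
  refine ENNReal.biSup_add_biSup_le' ⟨∅, by simp⟩ ⟨∅, by simp⟩ ?_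
  rintro K ⟨hKA, hK⟩ L ⟨hLB, hL⟩
  -- The added points only serve to make the compact subsets nonempty.
  calc volume K + volume L ≤ volume (insert a K) + volume (insert b L) := by
        gcongr <;> exact Set.subset_insert _ _
    _ ≤ _ := volume_add_volume_le_of_isCompact (hK.insert a) (hL.insert b)
        (Set.insert_nonempty _ _) (Set.insert_nonempty _ _) fun x hx y hy =>
          h x (Set.insert_subset ha hKA hx) y (Set.insert_subset hb hLB hy)

/-- The Prékopa–Leindler inequality on the line for bounded functions. -/
theorem lintegral_mul_lintegral_le_sq_of_bounded {f g h : ℝ → ℝ} (hf : Measurable f)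
    (hg : Measurable g) (hh : Measurable h) (f0 : ∀ x, 0 ≤ f x) (g0 : ∀ x, 0 ≤ g x)
    (h0 : ∀ x, 0 ≤ h x) (fb : BddAbove (Set.range f)) (gb : BddAbove (Set.range g))
    (hfg : ∀ x y, f x * g y ≤ h ((1 / 2 : ℝ) * (x + y)) ^ 2) :
    (∫⁻ x, ENNReal.ofReal (f x)) * (∫⁻ x, ENNReal.ofReal (g x)) ≤
      (∫⁻ x, ENNReal.ofReal (h x)) ^ 2 := by
  set F := ⨆ x, f x with hF
  set G := ⨆ x, g x with hG
  have hfF : ∀ x, f x ≤ F := le_ciSup fb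
  have hgG : ∀ x, g x ≤ G := le_ciSup gb
  rcases le_or_gt F 0 with hF0 | hF0
  · have : ∀ x, f x = 0 := fun x => le_antisymm ((hfF x).trans hF0) (f0 x)
    simp [this]
  rcases le_or_gt G 0 with hG0 | hG0
  · have : ∀ x, g x = 0 := fun x => le_antisymm ((hgG x).trans hG0) (g0 x)
    simp [this]
  set s := √(F * G) with hs
  have hs0 : 0 < s := Real.sqrt_pos.2 (mul_pos hF0 hG0)
  have hs2 : s ^ 2 = F * G := Real.sq_sqrt (mul_pos hF0 hG0).le
  have scale : ∀ (u : ℝ → ℝ) (c : ℝ), 0 < c → Measurable u → ∫⁻ x, ENNReal.ofReal (u x) =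
      ENNReal.ofReal c * ∫⁻ x, ENNReal.ofReal (u x / c) := by
    intro u c hc hu
    rw [← lintegral_const_mul _ (by fun_prop)]
    congr 1; ext x
    rw [← ENNReal.ofReal_mul hc.le, mul_div_cancel₀ _ hc.ne']
  rw [scale f F hF0 hf, scale g G hG0 hg, scale h s hs0 hh]
  -- Division by the suprema makes the superlevel sets of both functions nonempty for every level
  -- below 1 and empty from 1 on. So Brunn–Minkowski applies level by level, and the layer cake
  -- formula integrates the result.
  have key : (∫⁻ x, ENNReal.ofReal (f x / F)) + ∫⁻ x, ENNReal.ofReal (g x / G) ≤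
      2 * ∫⁻ x, ENNReal.ofReal (h x / s) := by
    rw [lintegral_eq_lintegral_meas_lt _ (Filter.Eventually.of_forall fun x =>
        div_nonneg (f0 x) hF0.le) (by fun_prop),
      lintegral_eq_lintegral_meas_lt _ (Filter.Eventually.of_forall fun x =>
        div_nonneg (g0 x) hG0.le) (by fun_prop),
      lintegral_eq_lintegral_meas_lt _ (Filter.Eventually.of_forall fun x =>
        div_nonneg (h0 x) hs0.le) (by fun_prop),
      ← lintegral_const_mul' _ _ (by simp), ← lintegral_add_left']
    · refine setLIntegral_mono' measurableSet_Ioi fun t ht => ?_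
      rcases lt_or_ge t 1 with ht1 | ht1
      · refine volume_add_volume_le (measurableSet_lt measurable_const (by fun_prop))
          (measurableSet_lt measurable_const (by fun_prop)) ?_ ?_ ?_
        · obtain ⟨x, hx⟩ := exists_lt_of_lt_ciSup (show t * F < ⨆ x, f x by
            rw [← hF]; nlinarith)
          exact ⟨x, by simpa [lt_div_iff₀ hF0] using hx⟩
        · obtain ⟨x, hx⟩ := exists_lt_of_lt_ciSup (show t * G < ⨆ x, g x by
            rw [← hG]; nlinarith)
          exact ⟨x, by simpa [lt_div_iff₀ hG0] using hx⟩
        · intro x hx y hy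
          have hx' : t * F < f x := by simpa [lt_div_iff₀ hF0] using hx
          have hy' : t * G < g y := by simpa [lt_div_iff₀ hG0] using hy
          have ht0 : 0 < t := ht
          have h1 : (t * s) ^ 2 < h ((1 / 2 : ℝ) * (x + y)) ^ 2 := by
            refine lt_of_lt_of_le ?_ (hfg x y)
            calc (t * s) ^ 2 = (t * F) * (t * G) := by rw [mul_pow, hs2]; ring
              _ < f x * g y := mul_lt_mul'' hx' hy' (by positivity) (by positivity)
          have h2 := lt_of_pow_lt_pow_left₀ 2 (h0 _) h1
          change t < h _ / s
          rwa [lt_div_iff₀ hs0]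
      · have e1 : {a : ℝ | t < f a / F} = ∅ := by
          ext x
          have : f x / F ≤ 1 := (div_le_one hF0).2 (hfF x)
          simpa using this.trans ht1
        have e2 : {a : ℝ | t < g a / G} = ∅ := by
          ext x
          have : g x / G ≤ 1 := (div_le_one hG0).2 (hgG x)
          simpa using this.trans ht1
        rw [e1, e2]; simp
    · refine (Antitone.measurable fun a b hab => measure_mono fun x hx => ?_).aemeasurable
      exact lt_of_le_of_lt hab hx
  -- The arithmetic–geometric mean inequality turns the sum into a product, and `s ^ 2 = F * G`
  -- restores the scales.
  have := ENNReal_mul_le_sq_of_add_le key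
  calc _ = ENNReal.ofReal F * ENNReal.ofReal G * ((∫⁻ x, ENNReal.ofReal (f x / F)) *
        ∫⁻ x, ENNReal.ofReal (g x / G)) := by ring
    _ ≤ ENNReal.ofReal F * ENNReal.ofReal G * (∫⁻ x, ENNReal.ofReal (h x / s)) ^ 2 := by gcongr
    _ = _ := by rw [← ENNReal.ofReal_mul hF0.le, ← hs2, ENNReal.ofReal_pow hs0.le, mul_pow]

/-- The Prékopa–Leindler inequality on the line. -/
theorem lintegral_mul_lintegral_le_sq_real {f g h : ℝ → ℝ≥0∞} (hf : Measurable f)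
    (hg : Measurable g) (hh : Measurable h)
    (hfg : ∀ x y, f x * g y ≤ h ((1 / 2 : ℝ) * (x + y)) ^ 2) :
    (∫⁻ x, f x) * (∫⁻ x, g x) ≤ (∫⁻ x, h x) ^ 2 := by
  have trunc : ∀ u : ℝ → ℝ≥0∞, Measurable u →
      ∫⁻ x, u x = ⨆ n : ℕ, ∫⁻ x, min (u x) n := by
    intro u hu
    rw [← lintegral_iSup (fun n => hu.min measurable_const)
      fun a b hab x => min_le_min_left _ (by exact_mod_cast hab)]
    congr 1; ext x
    rw [← inf_iSup_eq, ENNReal.iSup_natCast]; simp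
  -- Truncating all three functions at the same level keeps the hypothesis: where `h` exceeds `n`,
  -- the right side is `n ^ 2`.
  have step : ∀ n : ℕ, (∫⁻ x, min (f x) n) * (∫⁻ x, min (g x) n) ≤ (∫⁻ x, h x) ^ 2 := by
    intro n
    have htop : ∀ (u : ℝ → ℝ≥0∞) x, min (u x) n ≠ ∞ := fun u x =>
      ne_top_of_le_ne_top (by simp) (min_le_right _ _)
    have hb : ∀ u : ℝ → ℝ≥0∞, BddAbove (Set.range fun x => (min (u x) n).toReal) := by
      refine fun u => ⟨n, ?_⟩
      rintro _ ⟨x, rfl⟩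
      have := ENNReal.toReal_mono (by simp) (min_le_right (u x) (n : ℝ≥0∞))
      simpa using this
    have := lintegral_mul_lintegral_le_sq_of_bounded (f := fun x => (min (f x) n).toReal)
      (g := fun x => (min (g x) n).toReal) (h := fun x => (min (h x) n).toReal)
      (hf.min measurable_const).ennreal_toReal (hg.min measurable_const).ennreal_toReal
      (hh.min measurable_const).ennreal_toReal (fun _ => ENNReal.toReal_nonneg)
      (fun _ => ENNReal.toReal_nonneg) (fun _ => ENNReal.toReal_nonneg) (hb f) (hb g) ?_
    · simp only [ENNReal.ofReal_toReal (htop _ _)] at this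
      refine this.trans ?_
      gcongr
      exact min_le_left _ _
    · intro x y
      rw [← ENNReal.toReal_mul, ← ENNReal.toReal_pow]
      refine ENNReal.toReal_mono (ENNReal.pow_ne_top (htop _ _)) ?_
      rcases le_total (h ((1 / 2 : ℝ) * (x + y))) n with hn | hn
      · rw [min_eq_left hn]
        refine le_trans ?_ (hfg x y)
        gcongr <;> exact min_le_left _ _
      · rw [min_eq_right hn, sq]
        gcongr <;> exact min_le_right _ _
  rw [trunc f hf, trunc g hg, ENNReal.iSup_mul]
  refine iSup_le fun n => ?_
  rw [ENNReal.mul_iSup]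
  refine iSup_le fun m => le_trans ?_ (step (max n m))
  gcongr <;> simp

/-- The Prékopa–Leindler inequality for midpoints. -/
theorem lintegral_mul_lintegral_le_sq_pi : ∀ (n : ℕ) {f g h : (Fin n → ℝ) → ℝ≥0∞},
    Measurable f → Measurable g → Measurable h →
    (∀ x y, f x * g y ≤ h ((1 / 2 : ℝ) • (x + y)) ^ 2) →
    (∫⁻ x, f x) * (∫⁻ x, g x) ≤ (∫⁻ x, h x) ^ 2 := by
  intro n
  induction n with
  | zero =>
    intro f g h _ _ _ hfg
    have hv : (volume : Measure (Fin 0 → ℝ)) Set.univ = 1 := by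
      rw [volume_pi, Measure.pi_univ]; simp
    rw [lintegral_unique, lintegral_unique, lintegral_unique, hv]
    simp only [mul_one]
    convert hfg default default
  | succ n ih =>
    intro f g h hf hg hh hfg
    have hp := (volume_preserving_piFinSuccAbove (fun _ : Fin (n + 1) => ℝ) 0).symm
    set e := (MeasurableEquiv.piFinSuccAbove (fun _ : Fin (n + 1) => ℝ) 0).symm with he
    have split : ∀ u : (Fin (n + 1) → ℝ) → ℝ≥0∞, Measurable u →
        ∫⁻ x, u x = ∫⁻ s, ∫⁻ z, u (e (s, z)) := by
      intro u hu
      rw [← hp.lintegral_comp hu, Measure.volume_eq_prod]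
      exact lintegral_prod (fun z => u (e z)) (hu.comp e.measurable).aemeasurable
    have hmeas : ∀ u : (Fin (n + 1) → ℝ) → ℝ≥0∞, Measurable u →
        Measurable fun s => ∫⁻ z, u (e (s, z)) := fun u hu =>
      (hu.comp e.measurable).lintegral_prod_right'
    rw [split f hf, split g hg, split h hh]
    -- The induction hypothesis, applied to slices, says that the slice integrals satisfy the
    -- hypothesis of the inequality on the line.
    refine lintegral_mul_lintegral_le_sq_real (hmeas f hf) (hmeas g hg) (hmeas h hh) ?_
    intro s s'
    have hm : ∀ (u : (Fin (n + 1) → ℝ) → ℝ≥0∞) (s : ℝ), Measurable u →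
        Measurable fun z => u (e (s, z)) := fun u s hu =>
      hu.comp (e.measurable.comp (measurable_const.prodMk measurable_id))
    refine ih (hm f s hf) (hm g s' hg) (hm h _ hh) fun z z' => ?_
    convert hfg (e (s, z)) (e (s', z')) using 3
    ext i
    refine Fin.cases ?_ (fun j => ?_) i <;> simp [he, mul_add]

/-- Gaussian measures of a convex set are midpoint log-concave in the mean. -/
theorem gaussian_mul_le_sq {d : ℕ} (μ ν : E d) {P : Set (E d)} (hP : Convex ℝ P)
    (hPm : MeasurableSet P) :
    gaussian μ P * gaussian ν P ≤ (gaussian ((1 / 2 : ℝ) • (μ + ν)) P) ^ 2 := by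
  let f : E d → E d → ℝ≥0∞ := fun a =>
    P.indicator fun x => ENNReal.ofReal (gaussianDensity a x)
  have hf : ∀ a, Measurable (f a) := fun a =>
    (continuous_gaussianDensity a).measurable.ennreal_ofReal.indicator hPm
  have hint : ∀ a, gaussian a P = ∫⁻ x : Fin d → ℝ, f a (WithLp.toLp 2 x) := by
    intro a
    rw [gaussian_eq_withDensity, withDensity_apply _ hPm, ← lintegral_indicator hPm]
    exact ((PiLp.volume_preserving_toLp (Fin d)).lintegral_comp (hf a)).symm
  rw [hint, hint, hint]
  have hmeas : ∀ a, Measurable fun x : Fin d → ℝ => f a (WithLp.toLp 2 x) := fun a =>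
    (hf a).comp (WithLp.measurable_toLp 2 _)
  refine lintegral_mul_lintegral_le_sq_pi d (hmeas _) (hmeas _) (hmeas _) fun x y => ?_
  rw [WithLp.toLp_smul, WithLp.toLp_add]
  generalize WithLp.toLp 2 x = x
  generalize WithLp.toLp 2 y = y
  by_cases hx : x ∈ P
  swap; · simp [f, hx]
  by_cases hy : y ∈ P
  swap; · simp [f, hy]
  have hxy : (1 / 2 : ℝ) • (x + y) ∈ P := by
    rw [smul_add]; exact hP hx hy (by norm_num) (by norm_num) (by norm_num)
  simp only [f, Set.indicator_of_mem hx, Set.indicator_of_mem hy, Set.indicator_of_mem hxy]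
  rw [← ENNReal.ofReal_mul (gaussianDensity_pos _ _).le,
    ← ENNReal.ofReal_pow (gaussianDensity_pos _ _).le]
  refine ENNReal.ofReal_le_ofReal ?_
  unfold gaussianDensity
  rw [mul_mul_mul_comm, mul_pow, ← Real.exp_add, ← Real.exp_nat_mul, ← sq]
  gcongr
  -- The density is log-concave jointly in the point and the mean, since the exponent is a squared
  -- norm of their difference: this is the parallelogram law for `x - μ` and `y - ν`.
  have e1 : (1 / 2 : ℝ) • (x + y) - (1 / 2 : ℝ) • (μ + ν) =
      (1 / 2 : ℝ) • ((x - μ) + (y - ν)) := by rw [← smul_sub]; congr 1; abel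
  rw [e1, norm_smul, mul_pow]
  have := parallelogram_law_with_norm ℝ (x - μ) (y - ν)
  have h3 := mul_self_nonneg ‖(x - μ) - (y - ν)‖
  norm_num
  nlinarith

/-! ### Tangent inequalities -/

/-- Slopes of a concave function decrease along a ray; at dyadic points midpoint concavity is
enough. Large `n` replaces the derivative in the tangent inequality, and a fixed `n` moves a far
mean to within distance one of the true one. -/
theorem sub_le_of_midpoint_concave {V : Type*} [AddCommGroup V] [Module ℝ V] {f : V → ℝ}
    (hf : ∀ x y, f x + f y ≤ 2 * f ((1 / 2 : ℝ) • (x + y))) (a v : V) (n : ℕ) :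
    f (a + v) - f a ≤ 2 ^ n * (f (a + (1 / 2 : ℝ) ^ n • v) - f a) := by
  induction n with
  | zero => simp
  | succ n ih =>
    refine ih.trans ?_
    have h := hf a (a + (1 / 2 : ℝ) ^ n • v)
    have e : (1 / 2 : ℝ) • (a + (a + (1 / 2 : ℝ) ^ n • v)) = a + (1 / 2 : ℝ) ^ (n + 1) • v := by
      rw [pow_succ']; module
    rw [e] at h
    have h2 : (0 : ℝ) < 2 ^ n := by positivity
    rw [pow_succ]
    nlinarith

theorem gaussian_real_pos {d : ℕ} (a : E d) {P : Set (E d)} (hP : 0 < volume P) :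
    0 < (gaussian a).real P := by
  refine ENNReal.toReal_pos (fun h => hP.ne' (absolutelyContinuous_gaussian a h))
    (measure_ne_top _ _)

theorem log_gaussian_midpoint_concave {d : ℕ} {P : Set (E d)} (hP : Convex ℝ P)
    (hPm : MeasurableSet P) (hP0 : 0 < volume P) (x y : E d) :
    Real.log ((gaussian x).real P) + Real.log ((gaussian y).real P) ≤
      2 * Real.log ((gaussian ((1 / 2 : ℝ) • (x + y))).real P) := by
  rw [← Real.log_mul (gaussian_real_pos x hP0).ne' (gaussian_real_pos y hP0).ne',
    show (2 : ℝ) = ((2 : ℕ) : ℝ) by norm_num, ← Real.log_pow]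
  refine Real.log_le_log (mul_pos (gaussian_real_pos x hP0) (gaussian_real_pos y hP0)) ?_
  have := gaussian_mul_le_sq x y hP hPm
  simp only [measureReal_def]
  rw [← ENNReal.toReal_mul, ← ENNReal.toReal_pow]
  refine ENNReal.toReal_mono (ENNReal.pow_ne_top (measure_ne_top _ _)) ?_
  simpa using this

/-- The logarithm of the Gaussian measure of a bounded convex set lies below its tangents. -/
theorem log_gaussian_sub_le {d : ℕ} {P : Set (E d)} (hP : Convex ℝ P) (hPm : MeasurableSet P)
    (hP0 : 0 < volume P) {B : ℝ} (hB : ∀ x ∈ P, ‖x‖ ≤ B) (a v : E d) :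
    Real.log ((gaussian (a + v)).real P) - Real.log ((gaussian a).real P) ≤
      ∫ x, ⟪x - a, v⟫ ∂(gaussian a)[|P] := by
  have hpos := gaussian_real_pos a hP0
  have hprob : IsProbabilityMeasure (gaussian a)[|P] :=
    cond_isProbabilityMeasure fun h => by simp [measureReal_def, h] at hpos
  have hae : ∀ᵐ x ∂(gaussian a)[|P], x ∈ P := ae_cond_mem hPm
  set C := (B + ‖a‖) * ‖v‖ with hC
  have hY : ∀ x ∈ P, |⟪x - a, v⟫| ≤ C := fun x hx =>
    (abs_real_inner_le_norm _ _).trans (by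
      have := norm_sub_le x a
      have := hB x hx
      rw [hC]; gcongr; linarith)
  have hC0 : 0 ≤ C := by
    obtain ⟨x, hx⟩ := nonempty_of_measure_ne_zero hP0.ne'
    exact (abs_nonneg _).trans (hY x hx)
  have hint : Integrable (fun x => ⟪x - a, v⟫) (gaussian a)[|P] := by
    refine Integrable.of_bound (by fun_prop) C ?_
    filter_upwards [hae] with x hx using hY x hx
  -- The slope at the dyadic step `τ` is estimated by `log t ≤ t - 1`. The ratio of the masses is
  -- the conditional mean of the likelihood ratio, which is at most `1 + τ⟪x - a, v⟫ + τ²C²` on the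
  -- bounded set `P`. The error vanishes as `n → ∞`.
  have hstep : ∀ n : ℕ, (1 / 2 : ℝ) ^ n * C ≤ 1 →
      Real.log ((gaussian (a + v)).real P) - Real.log ((gaussian a).real P) ≤
        ∫ x, ⟪x - a, v⟫ ∂(gaussian a)[|P] + (1 / 2 : ℝ) ^ n * C ^ 2 := by
    intro n hn
    refine (sub_le_of_midpoint_concave (log_gaussian_midpoint_concave hP hPm hP0) a v n).trans ?_
    set τ : ℝ := (1 / 2) ^ n with hτ
    have hτ0 : 0 < τ := by positivity
    have h2 : (2 : ℝ) ^ n * τ = 1 := by rw [hτ, ← mul_pow]; norm_num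
    have hratio : (gaussian (a + τ • v)).real P / (gaussian a).real P =
        ∫ x, likelihoodRatio a (a + τ • v) x ∂(gaussian a)[|P] := by
      rw [gaussian_real_eq_setIntegral a _ hPm, ProbabilityTheory.cond, integral_smul_measure,
        ENNReal.toReal_inv, smul_eq_mul, ← measureReal_def]
      ring
    have hle : ∀ x ∈ P, likelihoodRatio a (a + τ • v) x ≤
        1 + (τ * ⟪x - a, v⟫ + τ ^ 2 * C ^ 2) := by
      intro x hx
      have h1 : |τ * ⟪x - a, v⟫| ≤ 1 := by
        rw [abs_mul, abs_of_pos hτ0]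
        exact (mul_le_mul_of_nonneg_left (hY x hx) hτ0.le).trans hn
      have h3 := (abs_le.1 (Real.abs_exp_sub_one_sub_id_le h1)).2
      have h4 : ⟪x - a, v⟫ ^ 2 ≤ C ^ 2 := sq_le_sq' (by linarith [(abs_le.1 (hY x hx)).1])
        (abs_le.1 (hY x hx)).2
      have h5 : likelihoodRatio a (a + τ • v) x ≤ Real.exp (τ * ⟪x - a, v⟫) := by
        unfold likelihoodRatio
        rw [add_sub_cancel_left, real_inner_smul_right]
        refine Real.exp_le_exp.2 ?_
        have := sq_nonneg ‖τ • v‖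
        linarith
      have h6 : (τ * ⟪x - a, v⟫) ^ 2 ≤ τ ^ 2 * C ^ 2 := by rw [mul_pow]; gcongr
      linarith
    have hint1 : Integrable (fun x => τ * ⟪x - a, v⟫ + τ ^ 2 * C ^ 2) (gaussian a)[|P] :=
      (hint.const_mul _).add (integrable_const _)
    have hint2 : Integrable (fun x => 1 + (τ * ⟪x - a, v⟫ + τ ^ 2 * C ^ 2)) (gaussian a)[|P] :=
      (integrable_const _).add hint1
    have hle2 : (gaussian (a + τ • v)).real P / (gaussian a).real P ≤
        1 + (τ * ∫ x, ⟪x - a, v⟫ ∂(gaussian a)[|P] + τ ^ 2 * C ^ 2) := by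
      rw [hratio]
      refine (integral_mono_of_nonneg (Filter.Eventually.of_forall fun x =>
        (likelihoodRatio_pos _ _ x).le) hint2 (hae.mono hle)).trans (le_of_eq ?_)
      rw [integral_add (integrable_const _) hint1,
        integral_add (hint.const_mul _) (integrable_const _), integral_const_mul]
      simp
    have hlog : Real.log ((gaussian (a + τ • v)).real P) - Real.log ((gaussian a).real P) ≤
        τ * ∫ x, ⟪x - a, v⟫ ∂(gaussian a)[|P] + τ ^ 2 * C ^ 2 := by
      rw [← Real.log_div (gaussian_real_pos _ hP0).ne' hpos.ne']
      have := Real.log_le_sub_one_of_pos (div_pos (gaussian_real_pos (a + τ • v) hP0) hpos)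
      linarith
    calc _ ≤ 2 ^ n * (τ * ∫ x, ⟪x - a, v⟫ ∂(gaussian a)[|P] + τ ^ 2 * C ^ 2) := by gcongr
      _ = (2 ^ n * τ) * (∫ x, ⟪x - a, v⟫ ∂(gaussian a)[|P] + τ * C ^ 2) := by ring
      _ = _ := by rw [h2, one_mul]
  have ht : Filter.Tendsto (fun n : ℕ => (1 / 2 : ℝ) ^ n) Filter.atTop (nhds 0) :=
    tendsto_pow_atTop_nhds_zero_of_lt_one (by norm_num) (by norm_num)
  have hlim : Filter.Tendsto (fun n : ℕ => ∫ x, ⟪x - a, v⟫ ∂(gaussian a)[|P] +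
      (1 / 2 : ℝ) ^ n * C ^ 2) Filter.atTop (nhds (∫ x, ⟪x - a, v⟫ ∂(gaussian a)[|P])) := by
    simpa using (ht.mul_const (C ^ 2)).const_add (∫ x, ⟪x - a, v⟫ ∂(gaussian a)[|P])
  refine ge_of_tendsto hlim ?_
  have := (ht.mul_const C).eventually_le_const (u := 1) (by simp)
  filter_upwards [this] with n hn using hstep n hn

/-! ### Cells of an observable partition -/

section Cells

variable {d : ℕ} {𝒬 : Set (Set (E d))}

theorem cell_eq (h𝒬 : Setoid.IsPartition 𝒬) {P : Set (E d)} (hP : P ∈ 𝒬) {x : E d} (hx : x ∈ P) :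
    cell 𝒬 x = P := by
  obtain ⟨b, -, hb⟩ := h𝒬.2 x
  have h1 : ∀ Q, Q ∈ 𝒬 → x ∈ Q → Q = P := fun Q hQ hxQ =>
    (hb Q ⟨hQ, hxQ⟩).trans (hb P ⟨hP, hx⟩).symm
  ext y
  constructor
  · rintro ⟨Q, ⟨hQ, hxQ⟩, hy⟩
    exact h1 Q hQ hxQ ▸ hy
  · exact fun hy => ⟨P, ⟨hP, hx⟩, hy⟩

theorem cell_mem (h𝒬 : Setoid.IsPartition 𝒬) (x : E d) : cell 𝒬 x ∈ 𝒬 := by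
  obtain ⟨b, ⟨hb, hx⟩, -⟩ := h𝒬.2 x
  rwa [cell_eq h𝒬 hb hx]

theorem mem_cell (h𝒬 : Setoid.IsPartition 𝒬) (x : E d) : x ∈ cell 𝒬 x := by
  obtain ⟨b, ⟨hb, hx⟩, -⟩ := h𝒬.2 x
  rwa [cell_eq h𝒬 hb hx]

/-- The sets of the partition that have positive volume. -/
def positiveCells (𝒬 : Set (Set (E d))) : Set (Set (E d)) := {P | P ∈ 𝒬 ∧ 0 < volume P}

theorem pairwiseDisjoint_positiveCells (h𝒬 : Setoid.IsPartition 𝒬) :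
    (positiveCells 𝒬).PairwiseDisjoint id := by
  intro P hP Q hQ hPQ
  refine Set.disjoint_left.2 fun x hx hx' => hPQ ?_
  rw [← cell_eq h𝒬 hP.1 hx, ← cell_eq h𝒬 hQ.1 hx']

/-- Disjoint sets of positive measure in a σ-finite space are countable. This allows work cell by
cell although the partition may be uncountable. -/
theorem countable_positiveCells (h𝒬 : IsObservablePartition 𝒬) :
    (positiveCells 𝒬).Countable := by
  have := Measure.countable_meas_pos_of_disjoint_iUnion (μ := (volume : Measure (E d)))
    (As := fun P : positiveCells 𝒬 => (P : Set (E d)))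
    (fun P => h𝒬.measurableSet P P.2.1) (fun P Q hPQ =>
      pairwiseDisjoint_positiveCells h𝒬.isPartition P.2 Q.2 (Subtype.coe_injective.ne hPQ))
  have hall : {P : positiveCells 𝒬 | 0 < volume (P : Set (E d))} = Set.univ :=
    Set.eq_univ_of_forall fun P => P.2.2
  rw [hall] at this
  exact Set.countable_coe_iff.1 (Set.countable_univ_iff.1 this)

theorem measurableSet_sUnion_positiveCells (h𝒬 : IsObservablePartition 𝒬) :
    MeasurableSet (⋃₀ positiveCells 𝒬) :=
  MeasurableSet.sUnion (countable_positiveCells h𝒬) fun P hP => h𝒬.measurableSet P hP.1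

theorem mem_sUnion_positiveCells_iff (h𝒬 : Setoid.IsPartition 𝒬) {x : E d} :
    x ∈ ⋃₀ positiveCells 𝒬 ↔ 0 < volume (cell 𝒬 x) := by
  constructor
  · rintro ⟨P, hP, hx⟩
    rw [cell_eq h𝒬 hP.1 hx]; exact hP.2
  · exact fun h => ⟨_, ⟨cell_mem h𝒬 x, h⟩, mem_cell h𝒬 x⟩

theorem subset_box_of_mem_positiveCells (hd : 1 ≤ d) {R : ℝ} (hR : IsLocalPartition R 𝒬)
    {P : Set (E d)} (hP : P ∈ positiveCells 𝒬) : P ⊆ box d R := by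
  have : Nonempty (Fin d) := ⟨⟨0, hd⟩⟩
  refine hR P hP.1 ?_
  rintro ⟨x, rfl⟩
  exact absurd hP.2 (by simp)

theorem norm_sq_le_of_mem_box {R : ℝ} {x : E d} (hx : x ∈ box d R) : ‖x‖ ^ 2 ≤ d * R ^ 2 := by
  rw [EuclideanSpace.real_norm_sq_eq]
  calc ∑ i, x i ^ 2 ≤ ∑ _i : Fin d, R ^ 2 :=
        Finset.sum_le_sum fun i _ => sq_le_sq' (by linarith [(abs_le.1 (hx i)).1])
          (abs_le.1 (hx i)).2
    _ = _ := by simp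

/-- A function is measurable if it is so on every cell of positive volume and outside of them. -/
theorem measurable_of_cells (h𝒬 : IsObservablePartition 𝒬) {Z β : Type*} [MeasurableSpace Z]
    [MeasurableSpace β] {φ : Z → E d} (hφ : Measurable φ) {f : Z → β}
    (hpos : ∀ P ∈ positiveCells 𝒬, ∃ g : Z → β, Measurable g ∧ ∀ z, φ z ∈ P → f z = g z)
    (hout : ∃ g : Z → β, Measurable g ∧ ∀ z, φ z ∉ ⋃₀ positiveCells 𝒬 → f z = g z) :
    Measurable f := by
  obtain ⟨g₀, hg₀, hfg₀⟩ := hout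
  have hc : Countable (positiveCells 𝒬) := countable_positiveCells h𝒬
  choose g hg hfg using hpos
  intro B hB
  have e : f ⁻¹' B = (⋃ P : positiveCells 𝒬, φ ⁻¹' P ∩ g P P.2 ⁻¹' B) ∪
      ((φ ⁻¹' (⋃₀ positiveCells 𝒬))ᶜ ∩ g₀ ⁻¹' B) := by
    ext z
    by_cases hz : φ z ∈ ⋃₀ positiveCells 𝒬
    · constructor
      · intro h
        obtain ⟨P, hP, hzP⟩ := hz
        left
        refine Set.mem_iUnion.2 ⟨⟨P, hP⟩, hzP, ?_⟩
        rw [Set.mem_preimage, ← hfg P hP z hzP]; exact h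
      · rintro (h | h)
        · obtain ⟨⟨P, hP⟩, hzP, h⟩ := Set.mem_iUnion.1 h
          rw [Set.mem_preimage, hfg P hP z hzP]; exact h
        · exact absurd hz h.1
    · constructor
      · intro h
        right
        refine ⟨hz, ?_⟩
        rw [Set.mem_preimage, ← hfg₀ z hz]; exact h
      · rintro (h | h)
        · obtain ⟨⟨P, hP⟩, hzP, -⟩ := Set.mem_iUnion.1 h
          exact absurd ⟨P, hP, hzP⟩ hz
        · rw [Set.mem_preimage, hfg₀ z hz]; exact h.2
  rw [e]
  refine (MeasurableSet.iUnion fun P : positiveCells 𝒬 =>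
    (hφ (h𝒬.measurableSet P P.2.1)).inter (hg P P.2 hB)).union
    ((hφ (measurableSet_sUnion_positiveCells h𝒬)).compl.inter (hg₀ hB))

/-! ### The likelihood ratio of coarse observations -/

open Classical in
/-- The likelihood ratio of the coarse Gaussian distributions with means `ν` and `μ`, as a function
of the hidden point. -/
def coarseRatio (𝒬 : Set (Set (E d))) (μ ν x : E d) : ℝ :=
  if 0 < volume (cell 𝒬 x) then (gaussian ν).real (cell 𝒬 x) / (gaussian μ).real (cell 𝒬 x)
  else likelihoodRatio μ ν x

theorem coarseRatio_pos (μ ν x : E d) : 0 < coarseRatio 𝒬 μ ν x := by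
  unfold coarseRatio
  split_ifs with h
  · exact div_pos (gaussian_real_pos _ h) (gaussian_real_pos _ h)
  · exact likelihoodRatio_pos _ _ _

theorem coarseRatio_of_mem (h𝒬 : IsObservablePartition 𝒬) (μ ν : E d) {P : Set (E d)}
    (hP : P ∈ positiveCells 𝒬) {x : E d} (hx : x ∈ P) :
    coarseRatio 𝒬 μ ν x = (gaussian ν).real P / (gaussian μ).real P := by
  rw [coarseRatio, cell_eq h𝒬.isPartition hP.1 hx, if_pos hP.2]

theorem coarseRatio_of_notMem (h𝒬 : IsObservablePartition 𝒬) (μ ν : E d) {x : E d}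
    (hx : x ∉ ⋃₀ positiveCells 𝒬) : coarseRatio 𝒬 μ ν x = likelihoodRatio μ ν x := by
  rw [mem_sUnion_positiveCells_iff h𝒬.isPartition] at hx
  rw [coarseRatio, if_neg hx]

theorem measurable_coarseRatio (h𝒬 : IsObservablePartition 𝒬) (μ ν : E d) :
    Measurable (coarseRatio 𝒬 μ ν) :=
  measurable_of_cells h𝒬 measurable_id
    (fun _ hP => ⟨_, measurable_const, fun _ hx => coarseRatio_of_mem h𝒬 μ ν hP hx⟩)
    ⟨_, (continuous_likelihoodRatio μ ν).measurable, fun _ hx => coarseRatio_of_notMem h𝒬 μ ν hx⟩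

/-- The condition on `B` holds for preimages of coarse events. A cell of positive volume is then
inside `B` or disjoint from it, and the ratio, constant on it, integrates to its mass under `ν`.
Outside these cells the ratio is the ordinary density. -/
theorem setLIntegral_coarseRatio (h𝒬 : IsObservablePartition 𝒬) (μ ν : E d) {B : Set (E d)}
    (hB : MeasurableSet B) (hsat : ∀ x ∈ B, cell 𝒬 x ⊆ B) :
    ∫⁻ x in B, ENNReal.ofReal (coarseRatio 𝒬 μ ν x) ∂gaussian μ = gaussian ν B := by
  set U := ⋃₀ positiveCells 𝒬 with hU
  have hUm : MeasurableSet U := measurableSet_sUnion_positiveCells h𝒬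
  have hBU : B ∩ U = ⋃ P ∈ positiveCells 𝒬, B ∩ P := by
    rw [hU, Set.sUnion_eq_biUnion, Set.inter_iUnion₂]
  have hm : ∀ P ∈ positiveCells 𝒬, MeasurableSet (B ∩ P) := fun P hP =>
    hB.inter (h𝒬.measurableSet P hP.1)
  have hdisj : (positiveCells 𝒬).PairwiseDisjoint fun P => B ∩ P := fun P hP Q hQ hPQ =>
    ((pairwiseDisjoint_positiveCells h𝒬.isPartition) hP hQ hPQ).mono
      Set.inter_subset_right Set.inter_subset_right
  rw [← lintegral_inter_add_sdiff _ B hUm, ← measure_inter_add_sdiff B hUm, hBU,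
    lintegral_biUnion (countable_positiveCells h𝒬) hm hdisj,
    measure_biUnion (countable_positiveCells h𝒬) hdisj hm]
  congr 1
  · congr 1; ext ⟨P, hP⟩
    by_cases hne : (B ∩ P).Nonempty
    · obtain ⟨x, hxB, hxP⟩ := hne
      have hPB : P ⊆ B := by
        have := hsat x hxB
        rwa [cell_eq h𝒬.isPartition hP.1 hxP] at this
      simp only [Set.inter_eq_right.2 hPB]
      rw [setLIntegral_congr_fun (h𝒬.measurableSet P hP.1) fun x hx => by
        rw [coarseRatio_of_mem h𝒬 μ ν hP hx], setLIntegral_const, ENNReal.ofReal_div_of_pos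
          (gaussian_real_pos μ hP.2), ofReal_measureReal, ofReal_measureReal]
      exact ENNReal.div_mul_cancel
        (fun h => hP.2.ne' (absolutelyContinuous_gaussian μ h)) (measure_ne_top _ _)
    · simp [Set.not_nonempty_iff_eq_empty.1 hne]
  · rw [gaussian_withDensity_likelihoodRatio μ ν, withDensity_apply _ (hB.diff hUm)]
    refine setLIntegral_congr_fun (hB.diff hUm) fun x hx => ?_
    rw [coarseRatio_of_notMem h𝒬 μ ν hx.2]

theorem lintegral_coarseRatio (h𝒬 : IsObservablePartition 𝒬) (μ ν : E d) :
    ∫⁻ x, ENNReal.ofReal (coarseRatio 𝒬 μ ν x) ∂gaussian μ = 1 := by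
  have := setLIntegral_coarseRatio h𝒬 μ ν MeasurableSet.univ fun _ _ => Set.subset_univ _
  simpa using this

theorem integrable_coarseRatio (h𝒬 : IsObservablePartition 𝒬) (μ ν : E d) :
    Integrable (coarseRatio 𝒬 μ ν) (gaussian μ) := by
  refine ⟨(measurable_coarseRatio h𝒬 μ ν).aestronglyMeasurable, ?_⟩
  rw [hasFiniteIntegral_iff_ofReal (Filter.Eventually.of_forall fun x =>
    (coarseRatio_pos μ ν x).le), lintegral_coarseRatio h𝒬]
  simp

theorem integral_coarseRatio (h𝒬 : IsObservablePartition 𝒬) (μ ν : E d) :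
    ∫ x, coarseRatio 𝒬 μ ν x ∂gaussian μ = 1 := by
  rw [integral_eq_lintegral_of_nonneg_ae (Filter.Eventually.of_forall fun x =>
    (coarseRatio_pos μ ν x).le) (measurable_coarseRatio h𝒬 μ ν).aestronglyMeasurable,
    lintegral_coarseRatio h𝒬]
  simp

theorem setIntegral_coarseRatio (h𝒬 : IsObservablePartition 𝒬) (μ ν : E d) {B : Set (E d)}
    (hB : MeasurableSet B) (hsat : ∀ x ∈ B, cell 𝒬 x ⊆ B) :
    ∫ x in B, coarseRatio 𝒬 μ ν x ∂gaussian μ = (gaussian ν).real B := by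
  rw [integral_eq_lintegral_of_nonneg_ae (Filter.Eventually.of_forall fun x =>
    (coarseRatio_pos μ ν x).le) (measurable_coarseRatio h𝒬 μ ν).aestronglyMeasurable,
    setLIntegral_coarseRatio h𝒬 μ ν hB hsat, measureReal_def]

/-! ### Hellinger and total variation distance of coarse Gaussians. -/

theorem measurable_observe (𝒬 : Set (Set (E d))) : Measurable (observe 𝒬) := fun _ hA => hA

instance (𝒬 : Set (Set (E d))) (μ : E d) : IsProbabilityMeasure (coarseGaussian 𝒬 μ) :=
  Measure.isProbabilityMeasure_map (measurable_observe 𝒬).aemeasurable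

/-- The squared Hellinger distance of two coarse Gaussian distributions. -/
def coarseHellinger (𝒬 : Set (Set (E d))) (μ ν : E d) : ℝ :=
  ∫ x, (1 - √(coarseRatio 𝒬 μ ν x)) ^ 2 ∂gaussian μ

theorem integrable_coarseHellinger (h𝒬 : IsObservablePartition 𝒬) (μ ν : E d) :
    Integrable (fun x => (1 - √(coarseRatio 𝒬 μ ν x)) ^ 2) (gaussian μ) := by
  refine Integrable.mono' (g := fun x => 2 + 2 * coarseRatio 𝒬 μ ν x)
    ((integrable_const _).add ((integrable_coarseRatio h𝒬 μ ν).const_mul 2))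
    (by have := measurable_coarseRatio h𝒬 μ ν; fun_prop) ?_
  refine Filter.Eventually.of_forall fun x => ?_
  have h1 := Real.sq_sqrt (coarseRatio_pos (𝒬 := 𝒬) μ ν x).le
  have h2 := Real.sqrt_nonneg (coarseRatio 𝒬 μ ν x)
  rw [Real.norm_of_nonneg (sq_nonneg _)]
  nlinarith [sq_nonneg (1 + √(coarseRatio 𝒬 μ ν x))]

/-- With `w` the ratio, `|1 - w| = |1 - √w| (1 + √w)`. The weight `l` splits this product by the
arithmetic–geometric mean inequality, which stands in for Cauchy–Schwarz. For a distance `T > 0` the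
choice `l = T / 4` then gives `T² / 4` as a lower bound of the Hellinger term. -/
theorem tvDist_coarseGaussian_le (h𝒬 : IsObservablePartition 𝒬) (μ ν : E d) {l : ℝ} (hl : 0 < l) :
    tvDist (coarseGaussian 𝒬 μ) (coarseGaussian 𝒬 ν) ≤
      coarseHellinger 𝒬 μ ν / (2 * l) + 2 * l := by
  have : Nonempty {A : Set (CoarseSpace 𝒬) // MeasurableSet A} := ⟨⟨∅, MeasurableSet.empty⟩⟩
  refine ciSup_le ?_
  rintro ⟨A, hA⟩
  have hw := integrable_coarseRatio h𝒬 μ ν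
  have hmap : ∀ a : E d, (coarseGaussian 𝒬 a).real A = (gaussian a).real (observe 𝒬 ⁻¹' A) :=
    fun a => map_measureReal_apply (measurable_observe 𝒬) hA
  set B := observe 𝒬 ⁻¹' A with hB
  have hBm : MeasurableSet B := measurable_observe 𝒬 hA
  have hsat : ∀ x ∈ B, cell 𝒬 x ⊆ B := by
    intro x hx y hy
    have : cell 𝒬 y = cell 𝒬 x := cell_eq h𝒬.isPartition (cell_mem h𝒬.isPartition x) hy
    rw [hB, Set.mem_preimage, observe, this]
    exact hx
  simp only [hmap]
  have e : (gaussian μ).real B - (gaussian ν).real B =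
      ∫ x in B, (1 - coarseRatio 𝒬 μ ν x) ∂gaussian μ := by
    rw [integral_sub (integrable_const _) hw.restrict, setIntegral_coarseRatio h𝒬 μ ν hBm hsat]
    simp [measureReal_def]
  rw [e]
  have hi0 : Integrable (fun x => l * (1 + coarseRatio 𝒬 μ ν x)) (gaussian μ) :=
    ((integrable_const _).add hw).const_mul _
  have hi : Integrable (fun x => (1 - √(coarseRatio 𝒬 μ ν x)) ^ 2 / (2 * l) +
      l * (1 + coarseRatio 𝒬 μ ν x)) (gaussian μ) :=
    ((integrable_coarseHellinger h𝒬 μ ν).div_const _).add hi0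
  have hi1 : Integrable (fun x => |1 - coarseRatio 𝒬 μ ν x|) (gaussian μ) :=
    ((integrable_const (1 : ℝ)).sub hw).abs
  calc |∫ x in B, (1 - coarseRatio 𝒬 μ ν x) ∂gaussian μ|
      ≤ ∫ x in B, |1 - coarseRatio 𝒬 μ ν x| ∂gaussian μ := abs_integral_le_integral_abs
    _ ≤ ∫ x, |1 - coarseRatio 𝒬 μ ν x| ∂gaussian μ :=
        setIntegral_le_integral hi1 (Filter.Eventually.of_forall fun x => abs_nonneg _)
    _ ≤ ∫ x, ((1 - √(coarseRatio 𝒬 μ ν x)) ^ 2 / (2 * l) + l * (1 + coarseRatio 𝒬 μ ν x))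
          ∂gaussian μ := by
        refine integral_mono hi1 hi fun x => ?_
        have h1 := Real.sq_sqrt (coarseRatio_pos (𝒬 := 𝒬) μ ν x).le
        have h2 := Real.sqrt_nonneg (coarseRatio 𝒬 μ ν x)
        set s := √(coarseRatio 𝒬 μ ν x)
        simp only
        rw [← h1]
        have e1 : |1 - s ^ 2| = |1 - s| * (1 + s) := by
          rw [show 1 - s ^ 2 = (1 - s) * (1 + s) by ring, abs_mul, abs_of_nonneg (a := 1 + s)
            (by positivity)]
        have e2 : (1 - s) ^ 2 / (2 * l) + l * (1 + s ^ 2) - |1 - s| * (1 + s) =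
            (|1 - s| - l * (1 + s)) ^ 2 / (2 * l) + l * (1 - s) ^ 2 / 2 := by
          field_simp
          linear_combination -sq_abs (1 - s)
        have e3 : 0 ≤ (|1 - s| - l * (1 + s)) ^ 2 / (2 * l) + l * (1 - s) ^ 2 / 2 := by positivity
        linarith
    _ = _ := by
        rw [integral_add ((integrable_coarseHellinger h𝒬 μ ν).div_const _) hi0, integral_div, integral_const_mul,
          integral_add (integrable_const _) hw, integral_coarseRatio h𝒬, coarseHellinger]
        simp; ring

theorem coarseHellinger_nonneg (μ ν : E d) : 0 ≤ coarseHellinger 𝒬 μ ν :=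
  integral_nonneg fun _ => sq_nonneg _

theorem tvDist_sq_le_coarseHellinger (h𝒬 : IsObservablePartition 𝒬) (μ ν : E d) :
    tvDist (coarseGaussian 𝒬 μ) (coarseGaussian 𝒬 ν) ^ 2 / 4 ≤ coarseHellinger 𝒬 μ ν := by
  set T := tvDist (coarseGaussian 𝒬 μ) (coarseGaussian 𝒬 ν) with hT
  have hT0 : 0 ≤ T := (abs_nonneg _).trans (le_tvDist _ _ MeasurableSet.univ)
  rcases hT0.eq_or_lt with h | h
  · rw [← h]; simpa using coarseHellinger_nonneg μ ν
  have := tvDist_coarseGaussian_le h𝒬 μ ν (l := T / 4) (by positivity)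
  rw [← hT] at this
  have h2 : T / 2 ≤ coarseHellinger 𝒬 μ ν / (2 * (T / 4)) := by linarith
  rw [le_div_iff₀ (by positivity)] at h2
  linarith

end Cells

/-! ### The stochastic gradient -/

section Response

variable {d : ℕ} {𝒬 : Set (Set (E d))} {Seed : Type} {S : Set (E d) → E d → Seed → E d}

open Classical in
/-- A jointly measurable version of the answer of the sampling oracle to the query `y` for the
coarse observation of the point `z.1`, when its randomness is `z.2`. -/
def response (𝒬 : Set (Set (E d))) (S : Set (E d) → E d → Seed → E d) (z : E d × Seed) (y : E d) :
    E d :=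
  if 0 < volume (cell 𝒬 z.1) then S (cell 𝒬 z.1) y z.2 else z.1

theorem response_of_mem (h𝒬 : IsObservablePartition 𝒬) {P : Set (E d)}
    (hP : P ∈ positiveCells 𝒬) {z : E d × Seed} (hz : z.1 ∈ P) (y : E d) :
    response 𝒬 S z y = S P y z.2 := by
  rw [response, cell_eq h𝒬.isPartition hP.1 hz, if_pos hP.2]

theorem response_of_notMem (h𝒬 : IsObservablePartition 𝒬) {z : E d × Seed}
    (hz : z.1 ∉ ⋃₀ positiveCells 𝒬) (y : E d) : response 𝒬 S z y = z.1 := by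
  rw [mem_sUnion_positiveCells_iff h𝒬.isPartition] at hz
  rw [response, if_neg hz]

variable [MeasurableSpace Seed] {ρ : Measure Seed} {R : ℝ}

theorem measurable_response (h𝒬 : IsObservablePartition 𝒬) (hS : IsSamplingOracle R 𝒬 ρ S) :
    Measurable fun p : (E d × Seed) × E d => response 𝒬 S p.1 p.2 := by
  refine measurable_of_cells h𝒬 (φ := fun p : (E d × Seed) × E d => p.1.1) (by fun_prop)
    (fun P hP => ⟨fun p => S P p.2 p.1.2, ?_, fun p hp => response_of_mem h𝒬 hP hp _⟩)
    ⟨fun p => p.1.1, by fun_prop, fun p hp => response_of_notMem h𝒬 hp _⟩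
  exact (hS.measurable P hP.1).comp (f := fun p : (E d × Seed) × E d => (p.2, p.1.2))
    (by fun_prop)

/-- On a singleton the oracle can only return the point, and other cells of volume zero contain
almost no point. So the jointly measurable `response` may replace `S`, whose measurability is known
only cell by cell. -/
theorem ae_response_eq (h𝒬 : IsObservablePartition 𝒬) (hS : IsSamplingOracle R 𝒬 ρ S) :
    ∀ᵐ x : E d, ∀ s y, S (cell 𝒬 x) y s = response 𝒬 S (x, s) y := by
  filter_upwards [h𝒬.ae_cell] with x hx s y
  unfold response
  by_cases hv : 0 < volume (cell 𝒬 x)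
  · simp only [if_pos hv]
  · simp only [if_neg hv]
    exact (hx.resolve_left hv).subset (hS.mem _ (cell_mem h𝒬.isPartition x) y s)

/-- The answer lies in the box or is the hidden point itself. -/
theorem norm_sq_response_le (hd : 1 ≤ d) (h𝒬 : IsObservablePartition 𝒬)
    (hR : IsLocalPartition R 𝒬) (hS : IsSamplingOracle R 𝒬 ρ S) (z : E d × Seed) (y : E d) :
    ‖response 𝒬 S z y‖ ^ 2 ≤ d * R ^ 2 + ‖z.1‖ ^ 2 := by
  by_cases hz : z.1 ∈ ⋃₀ positiveCells 𝒬
  · obtain ⟨P, hP, hz⟩ := hz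
    rw [response_of_mem h𝒬 hP hz]
    have := norm_sq_le_of_mem_box (subset_box_of_mem_positiveCells hd hR hP (hS.mem P hP.1 y z.2))
    have := sq_nonneg ‖z.1‖
    linarith
  · rw [response_of_notMem h𝒬 hz]
    have : 0 ≤ d * R ^ 2 := by positivity
    linarith

theorem measurable_response_left (h𝒬 : IsObservablePartition 𝒬) (hS : IsSamplingOracle R 𝒬 ρ S)
    (y : E d) : Measurable fun z => response 𝒬 S z y :=
  (measurable_response h𝒬 hS).comp (f := fun z : E d × Seed => (z, y)) (by fun_prop)

variable [IsProbabilityMeasure ρ]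

theorem integrable_norm_sq_fst (μ : E d) :
    Integrable (fun z : E d × Seed => ‖z.1‖ ^ 2) ((gaussian μ).prod ρ) :=
  (integrable_norm_sq_gaussian μ).comp_fst ρ

theorem memLp_response (hd : 1 ≤ d) (h𝒬 : IsObservablePartition 𝒬)
    (hR : IsLocalPartition R 𝒬) (hS : IsSamplingOracle R 𝒬 ρ S) (μ y : E d) :
    MemLp (fun z => response 𝒬 S z y) 2 ((gaussian μ).prod ρ) := by
  rw [memLp_two_iff_integrable_sq_norm (measurable_response_left h𝒬 hS y).aestronglyMeasurable]
  refine Integrable.mono' ((integrable_const (d * R ^ 2)).add (integrable_norm_sq_fst μ))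
    (by have := measurable_response_left h𝒬 hS y; fun_prop) ?_
  refine Filter.Eventually.of_forall fun z => ?_
  rw [Real.norm_of_nonneg (sq_nonneg _)]
  exact norm_sq_response_le hd h𝒬 hR hS z y

theorem integral_norm_sq_response_le (hd : 1 ≤ d) (hR1 : 1 ≤ R) (h𝒬 : IsObservablePartition 𝒬)
    (hR : IsLocalPartition R 𝒬) (hS : IsSamplingOracle R 𝒬 ρ S) (μ y : E d) :
    ∫ z, ‖response 𝒬 S z y‖ ^ 2 ∂(gaussian μ).prod ρ ≤ 2 * (d * R ^ 2) + ‖μ‖ ^ 2 := by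
  calc _ ≤ ∫ z : E d × Seed, (d * R ^ 2 + ‖z.1‖ ^ 2) ∂(gaussian μ).prod ρ :=
        integral_mono ((memLp_response hd h𝒬 hR hS μ y).integrable_norm_pow two_ne_zero)
          ((integrable_const _).add (integrable_norm_sq_fst μ))
          fun z => norm_sq_response_le hd h𝒬 hR hS z y
    _ = d * R ^ 2 + (‖μ‖ ^ 2 + d) := by
        rw [integral_add (integrable_const _) (integrable_norm_sq_fst μ),
          integral_fun_fst (fun x : E d => ‖x‖ ^ 2), integral_norm_sq_gaussian]
        simp
    _ ≤ _ := by
        have : (d : ℝ) * 1 ≤ d * R ^ 2 := by gcongr; nlinarith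
        linarith

/-- This is the choice of the dyadic scale `t = 2 ^ (-k) r`. The later estimate has size `2 ^ k t² =
r t`; for `r ≤ 1` one takes `t = r`, and for `r > 1` a `t` between 1/2 and 1. -/
theorem exists_half_pow_mul_le_one {r : ℝ} (hr : 0 ≤ r) :
    ∃ k : ℕ, (1 / 2 : ℝ) ^ k * r ≤ 1 ∧ min r (r ^ 2) / 2 ≤ r * ((1 / 2 : ℝ) ^ k * r) := by
  rcases le_or_gt r 1 with h | h
  · refine ⟨0, by simpa using h, ?_⟩
    have := min_le_right r (r ^ 2)
    have := sq_nonneg r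
    simp only [pow_zero, one_mul]
    nlinarith
  · obtain ⟨n, h1, h2⟩ := exists_nat_pow_near h.le (one_lt_two (α := ℝ))
    have hp : (0 : ℝ) < 2 ^ (n + 1) := by positivity
    refine ⟨n + 1, ?_, ?_⟩
    · rw [one_div, inv_pow, inv_mul_le_iff₀ hp]; linarith
    · have h3 : (1 / 2 : ℝ) ≤ (1 / 2) ^ (n + 1) * r := by
        rw [one_div, inv_pow, le_inv_mul_iff₀ hp, pow_succ]; linarith
      have := min_le_left r (r ^ 2)
      nlinarith

/-- The expected gradient has the inner product at least that of the logarithmic likelihood ratio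
with the direction to the true mean. -/
theorem le_integral_inner_response (hd : 1 ≤ d) (h𝒬 : IsObservablePartition 𝒬)
    (hconv : IsConvexPartition 𝒬) (hR : IsLocalPartition R 𝒬) (hS : IsSamplingOracle R 𝒬 ρ S)
    (μ v : E d) (k : ℕ) (x : E d) :
    2 ^ k * ((1 - √(coarseRatio 𝒬 μ (μ + (1 / 2 : ℝ) ^ k • v) x)) ^ 2 +
      (1 - coarseRatio 𝒬 μ (μ + (1 / 2 : ℝ) ^ k • v) x)) ≤
      ∫ s, ⟪(μ + v) - response 𝒬 S (x, s) (μ + v), v⟫ ∂ρ := by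
  set w := coarseRatio 𝒬 μ (μ + (1 / 2 : ℝ) ^ k • v) x with hw
  have hw0 : 0 < w := coarseRatio_pos _ _ _
  have h2k : (0 : ℝ) < 2 ^ k := by positivity
  -- The left side is `2 - 2√w`, so this is `log √w ≤ √w - 1`. In the given form the first term is
  -- the Hellinger integrand and the second has mean zero under the true law.
  have hlog : (1 - √w) ^ 2 + (1 - w) ≤ - Real.log w := by
    have h1 := Real.sq_sqrt hw0.le
    have h2 := Real.log_le_sub_one_of_pos (Real.sqrt_pos.2 hw0)
    rw [Real.log_sqrt hw0.le] at h2
    nlinarith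
  suffices h : 2 ^ k * (-Real.log w) ≤ ∫ s, ⟪(μ + v) - response 𝒬 S (x, s) (μ + v), v⟫ ∂ρ from
    (mul_le_mul_of_nonneg_left hlog h2k.le).trans h
  by_cases hx : x ∈ ⋃₀ positiveCells 𝒬
  · obtain ⟨P, hP, hx⟩ := hx
    have hPm := h𝒬.measurableSet P hP.1
    have hPc := hconv P hP.1
    have hPR := subset_box_of_mem_positiveCells hd hR hP
    have hbound : ∀ z ∈ P, ‖z‖ ≤ √(d * R ^ 2) := fun z hz =>
      Real.le_sqrt_of_sq_le (norm_sq_le_of_mem_box (hPR hz))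
    have hlaw := hS.law P hP.1 (by rw [Set.inter_eq_left.2 hPR]; exact hP.2) (μ + v)
    rw [Set.inter_eq_left.2 hPR] at hlaw
    have hSm : Measurable (S P (μ + v)) :=
      (hS.measurable P hP.1).comp (f := fun s => (μ + v, s)) (by fun_prop)
    have e1 : ∫ s, ⟪(μ + v) - response 𝒬 S (x, s) (μ + v), v⟫ ∂ρ =
        ∫ z, ⟪z - (μ + v), -v⟫ ∂(gaussian (μ + v))[|P] := by
      rw [← hlaw, integral_map hSm.aemeasurable (by fun_prop)]
      refine integral_congr_ae (Filter.Eventually.of_forall fun s => ?_)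
      simp only [response_of_mem (S := S) h𝒬 hP (z := (x, s)) hx, inner_neg_right, ← inner_neg_left, neg_sub]
    -- The tangent at `μ + v` in the direction of `μ` gives the difference of the log masses at `μ`
    -- and `μ + v`. Concavity along the segment trades `μ + v` for the dyadic point, with factor `2
    -- ^ k`.
    have h1 := log_gaussian_sub_le hPc hPm hP.2 hbound (μ + v) (-v)
    rw [add_neg_cancel_right] at h1
    have h2 := sub_le_of_midpoint_concave (log_gaussian_midpoint_concave hPc hPm hP.2) μ v k
    rw [hw, coarseRatio_of_mem h𝒬 _ _ hP hx, Real.log_div (gaussian_real_pos _ hP.2).ne'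
      (gaussian_real_pos _ hP.2).ne', e1]
    linarith
  -- Here the answer is `x` and the log ratio is explicit. What remains is `2 ^ (-k) ‖v‖² / 2 ≤
  -- ‖v‖²`.
  · rw [hw, coarseRatio_of_notMem h𝒬 _ _ hx, likelihoodRatio, Real.log_exp]
    simp only [response_of_notMem (S := S) h𝒬 (z := (x, _)) hx, integral_const, probReal_univ,
      one_smul, add_sub_cancel_left, real_inner_smul_right, norm_smul, mul_pow]
    have e : (2 : ℝ) ^ k * (1 / 2) ^ k = 1 := by rw [← mul_pow]; norm_num
    have e2 : ⟪μ + v - x, v⟫ = ‖v‖ ^ 2 - ⟪x - μ, v⟫ := by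
      rw [← real_inner_self_eq_norm_sq, ← inner_sub_left]; congr 1; abel
    have e3 : ‖(1 / 2 : ℝ) ^ k‖ = (1 / 2) ^ k := Real.norm_of_nonneg (by positivity)
    have e4 : (1 / 2 : ℝ) ^ k ≤ 1 := pow_le_one₀ (by norm_num) (by norm_num)
    rw [e2, e3]
    have e5 : (2 : ℝ) ^ k * -((1 / 2) ^ k * ⟪x - μ, v⟫ - ((1 / 2) ^ k) ^ 2 * ‖v‖ ^ 2 / 2) =
        (2 ^ k * (1 / 2) ^ k) * (-⟪x - μ, v⟫ + (1 / 2) ^ k * ‖v‖ ^ 2 / 2) := by ring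
    rw [e5, e]
    nlinarith [sq_nonneg ‖v‖]

/-- The expected gradient points away from the true mean. -/
theorem min_le_integral_inner_response {α : ℝ} (hα : 0 < α) (hd : 1 ≤ d)
    (h𝒬 : IsObservablePartition 𝒬) (hconv : IsConvexPartition 𝒬) (hR : IsLocalPartition R 𝒬)
    (hS : IsSamplingOracle R 𝒬 ρ S) {μ : E d} (hinf : IsInformationPreserving α 𝒬 μ) (y : E d) :
    α ^ 2 / 200 * min ‖y - μ‖ (‖y - μ‖ ^ 2) ≤
      ∫ z, ⟪y - response 𝒬 S z y, y - μ⟫ ∂(gaussian μ).prod ρ := by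
  obtain ⟨v, rfl⟩ : ∃ v, y = μ + v := ⟨y - μ, by abel⟩
  rw [add_sub_cancel_left]
  obtain ⟨k, hk1, hk2⟩ := exists_half_pow_mul_le_one (norm_nonneg v)
  set ν := μ + (1 / 2 : ℝ) ^ k • v with hν
  have hint : Integrable (fun z => ⟪(μ + v) - response 𝒬 S z (μ + v), v⟫)
      ((gaussian μ).prod ρ) :=
    (((integrable_const _).sub ((memLp_response hd h𝒬 hR hS μ (μ + v)).integrable
      one_le_two))).inner_const v
  rw [integral_prod _ hint]
  have hi1 := integrable_coarseHellinger h𝒬 μ ν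
  have hi2 : Integrable (fun x => 1 - coarseRatio 𝒬 μ ν x) (gaussian μ) :=
    (integrable_const _).sub (integrable_coarseRatio h𝒬 μ ν)
  have h1 : 2 ^ k * coarseHellinger 𝒬 μ ν ≤
      ∫ x, ∫ s, ⟪(μ + v) - response 𝒬 S (x, s) (μ + v), v⟫ ∂ρ ∂gaussian μ := by
    have := integral_mono (μ := gaussian μ) ((hi1.add hi2).const_mul (2 ^ k)) hint.integral_prod_left
      (fun x => le_integral_inner_response hd h𝒬 hconv hR hS μ v k x)
    refine le_trans (le_of_eq ?_) this
    simp only [Pi.add_apply]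
    rw [integral_const_mul, integral_add hi1 hi2, integral_sub (integrable_const _)
      (integrable_coarseRatio h𝒬 μ ν), integral_coarseRatio h𝒬, coarseHellinger]
    simp
  refine le_trans ?_ h1
  have hνμ : ‖ν - μ‖ = (1 / 2) ^ k * ‖v‖ := by
    rw [hν, add_sub_cancel_left, norm_smul, Real.norm_of_nonneg (by positivity)]
  have h2 : α * (‖ν - μ‖ / 5) ≤ tvDist (coarseGaussian 𝒬 μ) (coarseGaussian 𝒬 ν) := by
    rcases eq_or_ne ν μ with h | h
    · rw [h]; simpa using (abs_nonneg _).trans (le_tvDist (coarseGaussian 𝒬 μ)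
        (coarseGaussian 𝒬 μ) MeasurableSet.univ)
    · refine le_trans ?_ (hinf ν h)
      gcongr
      exact le_tvDist_gaussian μ ν (by rw [hνμ]; exact hk1)
  have h3 := tvDist_sq_le_coarseHellinger h𝒬 μ ν
  have h4 : (α * (‖ν - μ‖ / 5)) ^ 2 ≤ tvDist (coarseGaussian 𝒬 μ) (coarseGaussian 𝒬 ν) ^ 2 := by
    gcongr
  have h5 : (α * (((1 / 2) ^ k * ‖v‖) / 5)) ^ 2 / 4 ≤ coarseHellinger 𝒬 μ ν := by
    rw [hνμ] at h4; linarith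
  have e : (2 : ℝ) ^ k * (1 / 2) ^ k = 1 := by rw [← mul_pow]; norm_num
  -- The square of 1/5 and the factor 1/4 of the Hellinger bound give 1/100; the choice of `k` costs
  -- another factor 2.
  calc α ^ 2 / 200 * min ‖v‖ (‖v‖ ^ 2) = α ^ 2 / 100 * (min ‖v‖ (‖v‖ ^ 2) / 2) := by ring
    _ ≤ α ^ 2 / 100 * (‖v‖ * ((1 / 2) ^ k * ‖v‖)) := by gcongr
    _ = α ^ 2 / 100 * ((2 ^ k * (1 / 2) ^ k) * ‖v‖ * ((1 / 2) ^ k * ‖v‖)) := by rw [e, one_mul]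
    _ = 2 ^ k * ((α * (((1 / 2) ^ k * ‖v‖) / 5)) ^ 2 / 4) := by ring
    _ ≤ _ := by gcongr

/-- One step of stochastic gradient descent, before the projection. -/
theorem integral_norm_sq_step_le {α : ℝ} (hα : 0 < α) (hd : 1 ≤ d) (hR1 : 1 ≤ R)
    (h𝒬 : IsObservablePartition 𝒬) (hconv : IsConvexPartition 𝒬) (hR : IsLocalPartition R 𝒬)
    (hS : IsSamplingOracle R 𝒬 ρ S) {μ : E d} (hinf : IsInformationPreserving α 𝒬 μ) (y : E d)
    {η : ℝ} (hη : 0 ≤ η) :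
    ∫ z, ‖y + η • (response 𝒬 S z y - y) - μ‖ ^ 2 ∂(gaussian μ).prod ρ ≤
      ‖y - μ‖ ^ 2 - 2 * η * (α ^ 2 / 200 * min ‖y - μ‖ (‖y - μ‖ ^ 2)) +
        η ^ 2 * (2 * ‖y‖ ^ 2 + 2 * (2 * (d * R ^ 2) + ‖μ‖ ^ 2)) := by
  have hL := memLp_response hd h𝒬 hR hS (ρ := ρ) μ y
  have hi1 : Integrable (fun z => ⟪y - response 𝒬 S z y, y - μ⟫) ((gaussian μ).prod ρ) :=
    ((integrable_const _).sub (hL.integrable one_le_two)).inner_const _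
  have hi2 : Integrable (fun z => ‖response 𝒬 S z y‖ ^ 2) ((gaussian μ).prod ρ) :=
    hL.integrable_norm_pow two_ne_zero
  have hi3 : Integrable (fun z => η ^ 2 * (2 * ‖y‖ ^ 2 + 2 * ‖response 𝒬 S z y‖ ^ 2))
      ((gaussian μ).prod ρ) := ((integrable_const _).add (hi2.const_mul 2)).const_mul _
  have hi4 : Integrable (fun z => ‖y - μ‖ ^ 2 - 2 * η * ⟪y - response 𝒬 S z y, y - μ⟫)
      ((gaussian μ).prod ρ) := (integrable_const _).sub (hi1.const_mul _)
  have hb : ∀ z, ‖y + η • (response 𝒬 S z y - y) - μ‖ ^ 2 ≤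
      (‖y - μ‖ ^ 2 - 2 * η * ⟪y - response 𝒬 S z y, y - μ⟫) +
        η ^ 2 * (2 * ‖y‖ ^ 2 + 2 * ‖response 𝒬 S z y‖ ^ 2) := by
    intro z
    have e : y + η • (response 𝒬 S z y - y) - μ = (y - μ) - η • (y - response 𝒬 S z y) := by
      module
    rw [e, norm_sub_sq_real, real_inner_smul_right, real_inner_comm, norm_smul, mul_pow,
      Real.norm_eq_abs, sq_abs]
    have h1 : ‖y - response 𝒬 S z y‖ ^ 2 ≤ 2 * ‖y‖ ^ 2 + 2 * ‖response 𝒬 S z y‖ ^ 2 := by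
      have := norm_sub_le y (response 𝒬 S z y)
      nlinarith [sq_nonneg (‖y‖ - ‖response 𝒬 S z y‖), norm_nonneg (y - response 𝒬 S z y)]
    nlinarith [mul_le_mul_of_nonneg_left h1 (sq_nonneg η)]
  refine (integral_mono_of_nonneg (Filter.Eventually.of_forall fun _ => sq_nonneg _)
    (hi4.add hi3) (Filter.Eventually.of_forall hb)).trans ?_
  simp only [Pi.add_apply]
  rw [integral_add hi4 hi3, integral_sub (integrable_const _) (hi1.const_mul _),
    integral_const_mul, integral_const_mul, integral_add (integrable_const _) (hi2.const_mul 2),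
    integral_const_mul, integral_const_mul, integral_const, integral_const, probReal_univ, one_smul, one_smul]
  have h1 := min_le_integral_inner_response hα hd h𝒬 hconv hR hS hinf y
  have h2 := integral_norm_sq_response_le hd hR1 h𝒬 hR hS μ y
  gcongr

end Response

/-! ### Streams of independent random variables -/

section Streams

open Classical in
theorem pi_eq_pi_piecewise {Ω : Type*} (s u : Finset ℕ) (h : s ⊆ u) (t : ℕ → Set Ω) :
    (s : Set ℕ).pi t = (u : Set ℕ).pi fun i => if i ∈ s then t i else Set.univ := by
  ext ω
  simp only [Set.mem_pi, Finset.mem_coe]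
  constructor
  · intro hω i _
    split_ifs with hi
    · exact hω i hi
    · trivial
  · intro hω i hi
    have := hω i (h hi)
    rwa [if_pos hi] at this

variable {Ω Ω' : Type*} [MeasurableSpace Ω] [MeasurableSpace Ω']

/-- The law of a stream of independent random variables with law `κ`. -/
def streamLaw (κ : Measure Ω) [IsProbabilityMeasure κ] : Measure (ℕ → Ω) :=
  Measure.infinitePi fun _ : ℕ => κ

instance (κ : Measure Ω) [IsProbabilityMeasure κ] : IsProbabilityMeasure (streamLaw κ) := by
  unfold streamLaw; infer_instance

/-- The stream that consists of the first `n` terms of `ω` followed by `v`. -/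
def glue (n : ℕ) (p : (ℕ → Ω) × (ℕ → Ω)) (i : ℕ) : Ω := if i < n then p.1 i else p.2 (i - n)

theorem measurable_glue (n : ℕ) : Measurable (glue (Ω := Ω) n) := by
  refine measurable_pi_lambda _ fun i => ?_
  unfold glue
  split_ifs <;> fun_prop

variable (κ : Measure Ω) [IsProbabilityMeasure κ]

open Classical in
theorem streamLaw_pi_eq_prod (s u : Finset ℕ) (h : s ⊆ u) {t : ℕ → Set Ω}
    (ht : ∀ i, MeasurableSet (t i)) :
    streamLaw κ ((s : Set ℕ).pi t) = ∏ i ∈ u, κ (if i ∈ s then t i else Set.univ) := by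
  rw [pi_eq_pi_piecewise s u h, streamLaw, Measure.infinitePi_pi]
  intro i _
  split_ifs
  · exact ht i
  · exact MeasurableSet.univ

/-- On a cylinder the product of the masses factors at the index `n`. Consequently the tail of a
stream may be exchanged for an independent stream. -/
theorem map_glue (n : ℕ) : ((streamLaw κ).prod (streamLaw κ)).map (glue n) = streamLaw κ := by
  classical
  refine Measure.eq_infinitePi _ fun s t ht => ?_
  set u := Finset.range (n + (s.sup id + 1)) with hu
  have hsu : s ⊆ u := fun i hi => by
    have : id i ≤ s.sup id := Finset.le_sup hi
    simp only [id] at this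
    simp only [hu, Finset.mem_range]; omega
  set t' : ℕ → Set Ω := fun i => if i ∈ s then t i else Set.univ with ht'
  have ht'm : ∀ i, MeasurableSet (t' i) := fun i => by
    simp only [ht']; split_ifs
    · exact ht i
    · exact MeasurableSet.univ
  have e : ∏ i ∈ s, κ (t i) = ∏ i ∈ u, κ (t' i) := by
    have := streamLaw_pi_eq_prod κ s u hsu ht
    rw [← this, streamLaw, Measure.infinitePi_pi _ fun i _ => ht i]
  rw [e, pi_eq_pi_piecewise s u hsu, Measure.map_apply (measurable_glue n)
    (MeasurableSet.pi (Finset.countable_toSet _) fun i _ => ht'm i)]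
  have e2 : glue n ⁻¹' ((u : Set ℕ).pi t') =
      ((Finset.range n : Finset ℕ) : Set ℕ).pi t' ×ˢ
        ((Finset.range (s.sup id + 1) : Finset ℕ) : Set ℕ).pi fun i => t' (n + i) := by
    ext ⟨ω, v⟩
    simp only [Set.mem_preimage, Set.mem_pi, Set.mem_prod, hu, Finset.mem_coe, Finset.mem_range,
      glue]
    constructor
    · intro h
      refine ⟨fun i hi => ?_, fun i hi => ?_⟩
      · simpa [hi] using h i (by omega)
      · simpa using h (n + i) (by omega)
    · rintro ⟨h1, h2⟩ i hi
      split_ifs with hin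
      · exact h1 i hin
      · have := h2 (i - n) (by omega)
        rwa [show n + (i - n) = i by omega] at this
  rw [e2, Measure.prod_prod, streamLaw, Measure.infinitePi_pi _ fun i _ => ht'm i,
    Measure.infinitePi_pi _ fun i _ => ht'm _, hu, Finset.prod_range_add _ n (s.sup id + 1)]

/-- The first terms of a stream are independent from the others. -/
theorem lintegral_stream_split (n : ℕ) {h : (ℕ → Ω) → (ℕ → Ω) → ℝ≥0∞}
    (hm : Measurable (Function.uncurry h))
    (hdep : ∀ ω ω' v, (∀ i < n, ω i = ω' i) → h ω v = h ω' v) :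
    ∫⁻ ω, h ω (fun i => ω (n + i)) ∂streamLaw κ = ∫⁻ ω, ∫⁻ v, h ω v ∂streamLaw κ ∂streamLaw κ := by
  have hm2 : Measurable fun ω : ℕ → Ω => h ω (fun i => ω (n + i)) :=
    hm.comp (f := fun ω : ℕ → Ω => (ω, fun i => ω (n + i))) (by fun_prop)
  have e := lintegral_map (μ := (streamLaw κ).prod (streamLaw κ)) hm2 (measurable_glue n)
  rw [map_glue] at e
  rw [e]
  refine Eq.trans ?_ (lintegral_prod _ hm.aemeasurable)
  refine lintegral_congr fun ⟨ω, v⟩ => ?_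
  have e1 : (fun i => glue n (ω, v) (n + i)) = v := by ext i; simp [glue]
  rw [e1]
  exact hdep _ _ _ fun i hi => by simp [glue, hi]

theorem lintegral_stream_head {f : Ω → ℝ≥0∞} (hf : Measurable f) (n : ℕ) :
    ∫⁻ ω, f (ω n) ∂streamLaw κ = ∫⁻ z, f z ∂κ :=
  (measurePreserving_eval_infinitePi (fun _ : ℕ => κ) n).lintegral_comp hf

theorem nonempty_finiteSpanningSetsIn_streamLaw : Nonempty ((streamLaw κ).FiniteSpanningSetsIn
    (squareCylinders fun _ : ℕ => {s : Set Ω | MeasurableSet s})) :=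
  ⟨⟨fun _ => Set.univ, fun _ => ⟨∅, fun _ => Set.univ, by simp, by simp⟩, by simp,
    Set.iUnion_const _⟩⟩

/-- The interaction uses a pair of streams, points and seeds, whereas the analysis uses a stream of
pairs. The laws agree on products of cylinders once both are padded to a common index set. -/
theorem map_unzip_streamLaw (κ' : Measure Ω') [IsProbabilityMeasure κ'] :
    (streamLaw (κ.prod κ')).map (fun ω => (fun i => (ω i).1, fun i => (ω i).2)) =
      (streamLaw κ).prod (streamLaw κ') := by
  classical
  have hm : Measurable fun ω : ℕ → Ω × Ω' => ((fun i => (ω i).1, fun i => (ω i).2) :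
    (ℕ → Ω) × (ℕ → Ω')) := by fun_prop
  obtain ⟨sp1⟩ := nonempty_finiteSpanningSetsIn_streamLaw κ
  obtain ⟨sp2⟩ := nonempty_finiteSpanningSetsIn_streamLaw κ'
  refine (Measure.prod_eq_generateFrom generateFrom_squareCylinders generateFrom_squareCylinders
    (isPiSystem_squareCylinders (fun _ => MeasurableSpace.isPiSystem_measurableSet) (by simp))
    (isPiSystem_squareCylinders (fun _ => MeasurableSpace.isPiSystem_measurableSet) (by simp))
    sp1 sp2 ?_).symm
  rintro _ ⟨s, t, ht, rfl⟩ _ ⟨s', t', ht', rfl⟩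
  replace ht : ∀ i, MeasurableSet (t i) := fun i => ht i trivial
  replace ht' : ∀ i, MeasurableSet (t' i) := fun i => ht' i trivial
  rw [Measure.map_apply hm ((MeasurableSet.pi (Finset.countable_toSet _) fun i _ => ht i).prod
    (MeasurableSet.pi (Finset.countable_toSet _) fun i _ => ht' i))]
  rw [streamLaw_pi_eq_prod κ s (s ∪ s') Finset.subset_union_left ht,
    streamLaw_pi_eq_prod κ' s' (s ∪ s') Finset.subset_union_right ht', ← Finset.prod_mul_distrib]
  simp_rw [← Measure.prod_prod]
  rw [pi_eq_pi_piecewise s (s ∪ s') Finset.subset_union_left,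
    pi_eq_pi_piecewise s' (s ∪ s') Finset.subset_union_right]
  rw [← Measure.infinitePi_pi (fun _ : ℕ => κ.prod κ') (s := s ∪ s')
    (t := fun i => (if i ∈ s then t i else Set.univ) ×ˢ (if i ∈ s' then t' i else Set.univ))]
  · rw [streamLaw]
    congr 1
    ext ω
    simp only [Set.mem_preimage, Set.mem_prod, Set.mem_pi]
    exact forall₂_and.symm
  · intro i _
    refine MeasurableSet.prod ?_ ?_ <;> split_ifs
    · exact ht i
    · exact MeasurableSet.univ
    · exact ht' i
    · exact MeasurableSet.univ

end Streams

/-! ### Projected stochastic gradient descent with boosting -/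

section Algorithm

variable {d : ℕ}

/-- The projection to the ball with center `c` and radius `r`. -/
def pull (c : E d) (r : ℝ) (z : E d) : E d :=
  c + (if r ^ 2 < ‖z - c‖ ^ 2 then r / √(‖z - c‖ ^ 2) else 1) • (z - c)

/-- Projected stochastic gradient descent with step size `η`, where `a t y` is the answer to the
query `y` in step `t`. -/
def descent (a : ℕ → E d → E d) (c : E d) (r η : ℝ) : ℕ → E d
  | 0 => c
  | t + 1 => pull c r (descent a c r η t + η • (a t (descent a c r η t) - descent a c r η t))

/-- The number of points among `y 0, …, y (J - 1)` at distance at most `r / 3` from `y j`. -/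
def closeCount (y : ℕ → E d) (r : ℝ) (j J : ℕ) : ℕ :=
  ∑ i ∈ Finset.range J, if r ^ 2 / 9 < ‖y i - y j‖ ^ 2 then 0 else 1

/-- The last of the points `y 0, …, y (n - 1)` that is close to more than half of the points
`y 0, …, y (J - 1)`, and `c` if there is none. -/
def select (y : ℕ → E d) (r : ℝ) (J : ℕ) (c : E d) : ℕ → E d
  | 0 => c
  | n + 1 => if J < 2 * closeCount y r n J then y n else select y r J c n

/-- The `j`-th run of gradient descent of a stage. -/
def run (a : ℕ → E d → E d) (c : E d) (r η : ℝ) (T j : ℕ) : E d :=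
  descent (fun t => a (j * T + t)) c r η T

/-- One stage: `J` runs of gradient descent, and the selection of one of the results. -/
def stage (a : ℕ → E d → E d) (c : E d) (r η : ℝ) (T J : ℕ) : E d :=
  select (run a c r η T) r J c J

/-- The result of the first `k` stages, with halving radius. -/
def stages (a : ℕ → E d → E d) (D : ℝ) (η : ℝ → ℝ) (T J : ℕ) : ℕ → E d
  | 0 => 0
  | k + 1 => stage (fun t => a (k * (J * T) + t)) (stages a D η T J k) (D * (1 / 2) ^ k)
      (η (D * (1 / 2) ^ k)) T J

theorem norm_pull_sub_center_le {c : E d} {r : ℝ} (hr : 0 ≤ r) (z : E d) :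
    ‖pull c r z - c‖ ≤ r := by
  unfold pull
  rw [add_sub_cancel_left, Real.sqrt_sq (norm_nonneg _)]
  split_ifs with h
  · have h1 : r < ‖z - c‖ := lt_of_pow_lt_pow_left₀ 2 (norm_nonneg _) h
    have h2 : 0 < ‖z - c‖ := hr.trans_lt h1
    rw [norm_smul, Real.norm_of_nonneg (by positivity), div_mul_cancel₀ _ h2.ne']
  · rw [one_smul]
    exact le_of_sq_le_sq (not_lt.1 h) hr

/-- The projection to a ball that contains `μ` does not move away from `μ`. With `w = z - c`, `u = μ
- c` and `s = r / ‖w‖ ≤ 1`, the bound `⟪w, u⟫ ≤ s ‖w‖²` makes the squared distance drop by at least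
`(1 - s)² ‖w‖²`. -/
theorem norm_pull_sub_le {c μ : E d} {r : ℝ} (hμ : ‖c - μ‖ ≤ r) (z : E d) :
    ‖pull c r z - μ‖ ≤ ‖z - μ‖ := by
  have hr : 0 ≤ r := (norm_nonneg _).trans hμ
  unfold pull
  rw [Real.sqrt_sq (norm_nonneg _)]
  split_ifs with h
  · have h1 : r < ‖z - c‖ := lt_of_pow_lt_pow_left₀ 2 (norm_nonneg _) h
    set w := z - c with hw
    set u := μ - c with hu
    have hu' : ‖u‖ ≤ r := by rw [hu, norm_sub_rev]; exact hμ
    have h2 : 0 < ‖w‖ := hr.trans_lt h1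
    set s := r / ‖w‖ with hs
    have hs0 : 0 ≤ s := by positivity
    have hs1 : s ≤ 1 := (div_le_one h2).2 h1.le
    have hsw : s * ‖w‖ = r := div_mul_cancel₀ _ h2.ne'
    have e1 : c + s • w - μ = s • w - u := by rw [hu]; abel
    have e2 : z - μ = w - u := by rw [hu, hw]; abel
    rw [e1, e2]
    refine le_of_sq_le_sq ?_ (norm_nonneg _)
    rw [norm_sub_sq_real (s • w) u, norm_sub_sq_real w u, real_inner_smul_left, norm_smul,
      Real.norm_of_nonneg hs0]
    have h3 : ⟪w, u⟫ ≤ ‖w‖ * r := (real_inner_le_norm _ _).trans (by gcongr)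
    have h4 : (1 - s) * ⟪w, u⟫ ≤ (1 - s) * (‖w‖ * r) :=
      mul_le_mul_of_nonneg_left h3 (by linarith)
    have h5 : (1 - s) * (‖w‖ * r) = s * (1 - s) * ‖w‖ ^ 2 := by rw [← hsw]; ring
    nlinarith [mul_nonneg (sq_nonneg (1 - s)) (sq_nonneg ‖w‖)]
  · rw [one_smul, add_sub_cancel]

theorem norm_descent_sub_center_le (a : ℕ → E d → E d) (c : E d) {r : ℝ} (hr : 0 ≤ r) (η : ℝ)
    (t : ℕ) : ‖descent a c r η t - c‖ ≤ r := by
  cases t with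
  | zero => simpa [descent] using hr
  | succ t => exact norm_pull_sub_center_le hr _

/-- A result depends only on the answers read so far. This lemma and its analogues for runs and
stages provide the locality required by `lintegral_stream_split`. -/
theorem descent_congr {a a' : ℕ → E d → E d} (c : E d) (r η : ℝ) (t : ℕ)
    (h : ∀ i < t, a i = a' i) : descent a c r η t = descent a' c r η t := by
  induction t with
  | zero => rfl
  | succ t ih =>
    simp only [descent]
    rw [ih fun i hi => h i (by omega), h t (by omega)]

theorem select_congr {y y' : ℕ → E d} (r : ℝ) {J : ℕ} (c : E d) (h : ∀ i < J, y i = y' i) (n : ℕ)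
    (hn : n ≤ J) : select y r J c n = select y' r J c n := by
  induction n with
  | zero => rfl
  | succ n ih =>
    have e : closeCount y r n J = closeCount y' r n J := by
      unfold closeCount
      refine Finset.sum_congr rfl fun i hi => ?_
      rw [h i (Finset.mem_range.1 hi), h n (by omega)]
    simp only [select]
    rw [e, h n (by omega), ih (by omega)]

theorem run_congr {a a' : ℕ → E d → E d} (c : E d) (r η : ℝ) (T j : ℕ)
    (h : ∀ i < (j + 1) * T, a i = a' i) : run a c r η T j = run a' c r η T j :=
  descent_congr c r η T fun i hi => h _ (by rw [add_mul]; omega)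

theorem stage_congr {a a' : ℕ → E d → E d} (c : E d) (r η : ℝ) (T J : ℕ)
    (h : ∀ i < J * T, a i = a' i) : stage a c r η T J = stage a' c r η T J := by
  refine select_congr r c (fun j hj => run_congr c r η T j fun i hi => h i (hi.trans_le ?_)) J le_rfl
  exact Nat.mul_le_mul_right T hj

theorem stages_congr {a a' : ℕ → E d → E d} (D : ℝ) (η : ℝ → ℝ) (T J k : ℕ)
    (h : ∀ i < k * (J * T), a i = a' i) : stages a D η T J k = stages a' D η T J k := by
  induction k with
  | zero => rfl
  | succ k ih =>
    simp only [stages]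
    rw [ih fun i hi => h i (hi.trans_le (Nat.mul_le_mul_right _ (by omega)))]
    exact stage_congr _ _ _ _ _ fun i hi => h _ (by rw [add_mul]; omega)

/-- If most points are close to `μ`, then so is the selected one. -/
theorem norm_select_sub_le {y : ℕ → E d} {r : ℝ} (hr : 0 ≤ r) {J : ℕ} {c μ : E d}
    (h : 2 * (∑ i ∈ Finset.range J, if r / 6 < ‖y i - μ‖ then 1 else 0) < J) :
    ‖select y r J c J - μ‖ ≤ r / 2 := by
  set bad := (Finset.range J).filter fun i => r / 6 < ‖y i - μ‖ with hbad
  replace h : 2 * bad.card < J := by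
    rw [hbad, Finset.card_filter]; convert! h
  have hclose : ∀ j, closeCount y r j J =
      ((Finset.range J).filter fun i => ¬ r ^ 2 / 9 < ‖y i - y j‖ ^ 2).card := by
    intro j
    rw [Finset.card_filter, closeCount]
    refine Finset.sum_congr rfl fun i _ => ?_
    split_ifs <;> simp_all
  have hdist : ∀ i j, ¬ r ^ 2 / 9 < ‖y i - y j‖ ^ 2 ↔ ‖y i - y j‖ ≤ r / 3 := by
    intro i j
    rw [not_lt, show r ^ 2 / 9 = (r / 3) ^ 2 by ring]
    exact pow_le_pow_iff_left₀ (norm_nonneg _) (by positivity) two_ne_zero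
  have hgood : ((Finset.range J).filter fun i => ¬ r / 6 < ‖y i - μ‖).card + bad.card = J := by
    have := Finset.card_filter_add_card_filter_not (s := Finset.range J)
      (fun i => r / 6 < ‖y i - μ‖)
    rw [Finset.card_range] at this
    rw [add_comm]; convert! this
  -- Two points within `r / 6` of `μ` are within `r / 3` of each other, so every good point passes
  -- the majority test.
  have hqual : ∀ j < J, ¬ r / 6 < ‖y j - μ‖ → J < 2 * closeCount y r j J := by
    intro j _ hj
    have : ((Finset.range J).filter fun i => ¬ r / 6 < ‖y i - μ‖).card ≤ closeCount y r j J := by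
      rw [hclose]
      refine Finset.card_le_card fun i hi => ?_
      rw [Finset.mem_filter] at hi ⊢
      refine ⟨hi.1, (hdist i j).2 ?_⟩
      have e : y i - y j = (y i - μ) - (y j - μ) := by abel
      rw [e]
      refine (norm_sub_le _ _).trans ?_
      linarith [not_lt.1 hi.2, not_lt.1 hj]
    omega
  -- Two majorities intersect: a point that passes is within `r / 3` of some good point, hence
  -- within `r / 3 + r / 6` of `μ`.
  have hnear : ∀ j, J < 2 * closeCount y r j J → ‖y j - μ‖ ≤ r / 2 := by
    intro j hj
    rw [hclose] at hj
    have : ¬ Disjoint ((Finset.range J).filter fun i => ¬ r ^ 2 / 9 < ‖y i - y j‖ ^ 2)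
        ((Finset.range J).filter fun i => ¬ r / 6 < ‖y i - μ‖) := by
      intro hd
      have h1 := Finset.card_union_of_disjoint hd
      have h2 := Finset.card_le_card (Finset.union_subset
        (Finset.filter_subset (fun i => ¬ r ^ 2 / 9 < ‖y i - y j‖ ^ 2) (Finset.range J))
        (Finset.filter_subset (fun i => ¬ r / 6 < ‖y i - μ‖) (Finset.range J)))
      rw [Finset.card_range] at h2
      omega
    obtain ⟨i, hi1, hi2⟩ := Finset.not_disjoint_iff.1 this
    rw [Finset.mem_filter] at hi1 hi2
    have h1 := (hdist i j).1 hi1.2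
    have e : y j - μ = (y i - μ) - (y i - y j) := by abel
    rw [e]
    refine (norm_sub_le _ _).trans ?_
    linarith [not_lt.1 hi2.2]
  have hsel : ∀ n, (∃ j < n, J < 2 * closeCount y r j J) → ‖select y r J c n - μ‖ ≤ r / 2 := by
    intro n
    induction n with
    | zero => rintro ⟨j, hj, -⟩; omega
    | succ n ih =>
      rintro ⟨j, hj, hq⟩
      simp only [select]
      split_ifs with hn
      · exact hnear n hn
      · refine ih ⟨j, ?_, hq⟩
        rcases Nat.lt_succ_iff_lt_or_eq.1 hj with h | rfl
        · exact h
        · exact absurd hq hn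
  have : ((Finset.range J).filter fun i => ¬ r / 6 < ‖y i - μ‖).Nonempty := by
    rw [← Finset.card_pos]; omega
  obtain ⟨j, hj⟩ := this
  rw [Finset.mem_filter, Finset.mem_range] at hj
  exact hsel J ⟨j, hj.1, hqual j hj.1 hj.2⟩

/-! ### Measurability -/

variable {Ω : Type*} [MeasurableSpace Ω] {F : Ω → E d → E d}

theorem measurable_pull (r : ℝ) : Measurable fun p : E d × E d => pull p.1 r p.2 := by
  unfold pull
  have h1 : Measurable fun p : E d × E d => ‖p.2 - p.1‖ ^ 2 := by fun_prop
  have h2 : Measurable fun p : E d × E d => r / √(‖p.2 - p.1‖ ^ 2) :=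
    measurable_const.div h1.sqrt
  have h3 : Measurable fun p : E d × E d => p.2 - p.1 := by fun_prop
  exact measurable_fst.add ((Measurable.ite (measurableSet_lt measurable_const h1) h2
    measurable_const).smul h3)

theorem measurable_descent (hF : Measurable fun p : Ω × E d => F p.1 p.2) {Z : Type*}
    [MeasurableSpace Z] {ψ : Z → ℕ → Ω} (hψ : Measurable ψ) {c : Z → E d} (hc : Measurable c)
    (r η : ℝ) (t : ℕ) : Measurable fun z => descent (fun i => F (ψ z i)) (c z) r η t := by
  induction t with
  | zero => exact hc
  | succ t ih =>
    have h1 : Measurable fun z => F (ψ z t) (descent (fun i => F (ψ z i)) (c z) r η t) :=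
      hF.comp (((measurable_pi_apply t).comp hψ).prodMk ih)
    exact (measurable_pull r).comp (hc.prodMk (ih.add ((h1.sub ih).const_smul η)))

theorem measurable_run (hF : Measurable fun p : Ω × E d => F p.1 p.2) {Z : Type*}
    [MeasurableSpace Z] {ψ : Z → ℕ → Ω} (hψ : Measurable ψ) {c : Z → E d} (hc : Measurable c)
    (r η : ℝ) (T j : ℕ) : Measurable fun z => run (fun i => F (ψ z i)) (c z) r η T j :=
  measurable_descent hF (ψ := fun z t => ψ z (j * T + t)) (by fun_prop) hc r η T

theorem measurable_select {Z : Type*} [MeasurableSpace Z] {y : Z → ℕ → E d}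
    (hy : ∀ j, Measurable fun z => y z j) {c : Z → E d} (hc : Measurable c) (r : ℝ) (J n : ℕ) :
    Measurable fun z => select (y z) r J (c z) n := by
  induction n with
  | zero => exact hc
  | succ n ih =>
    refine Measurable.ite ?_ (hy n) ih
    have : Measurable fun z => closeCount (y z) r n J := by
      unfold closeCount
      refine Finset.measurable_sum _ fun i _ => Measurable.ite ?_ measurable_const measurable_const
      have h1 := hy i
      have h2 := hy n
      exact measurableSet_lt (by fun_prop) (by fun_prop)
    exact measurableSet_lt measurable_const (this.const_mul 2)

theorem measurable_stage (hF : Measurable fun p : Ω × E d => F p.1 p.2) {Z : Type*}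
    [MeasurableSpace Z] {ψ : Z → ℕ → Ω} (hψ : Measurable ψ) {c : Z → E d} (hc : Measurable c)
    (r η : ℝ) (T J : ℕ) : Measurable fun z => stage (fun i => F (ψ z i)) (c z) r η T J :=
  measurable_select (fun j => measurable_run hF hψ hc r η T j) hc r J J

theorem measurable_stages (hF : Measurable fun p : Ω × E d => F p.1 p.2) (D : ℝ) (η : ℝ → ℝ)
    (T J k : ℕ) : Measurable fun ω : ℕ → Ω => stages (fun i => F (ω i)) D η T J k := by
  induction k with
  | zero => exact measurable_const
  | succ k ih =>
    exact measurable_stage hF (ψ := fun ω t => ω (k * (J * T) + t)) (by fun_prop) ih _ _ T J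

/-! ### Analysis -/

variable {κ : Measure Ω} [IsProbabilityMeasure κ]

/-- The mean squared error of stochastic gradient descent. -/
theorem lintegral_descent_le (hF : Measurable fun p : Ω × E d => F p.1 p.2) {c μ : E d} {r η l b : ℝ}
    (hc : ‖c - μ‖ ≤ r) (hl0 : 0 < l) (hl1 : l ≤ 1) (hb : 0 ≤ b)
    (H : ∀ y, ‖y - μ‖ ≤ 2 * r → ∫⁻ z, ENNReal.ofReal (‖y + η • (F z y - y) - μ‖ ^ 2) ∂κ ≤
      ENNReal.ofReal ((1 - l) * ‖y - μ‖ ^ 2 + b)) (t : ℕ) :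
    ∫⁻ ω, ENNReal.ofReal (‖descent (fun i => F (ω i)) c r η t - μ‖ ^ 2) ∂streamLaw κ ≤
      ENNReal.ofReal ((1 - l) ^ t * r ^ 2 + b / l) := by
  have hr : 0 ≤ r := (norm_nonneg _).trans hc
  have hl' : 0 ≤ 1 - l := by linarith
  induction t with
  | zero =>
    simp only [descent, lintegral_const, measure_univ, mul_one, pow_zero, one_mul]
    refine ENNReal.ofReal_le_ofReal ?_
    have : 0 ≤ b / l := by positivity
    have : ‖c - μ‖ ^ 2 ≤ r ^ 2 := by gcongr
    linarith
  | succ t ih =>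
    set Y : (ℕ → Ω) → E d := fun ω => descent (fun i => F (ω i)) c r η t with hY
    have hYm : Measurable Y := measurable_descent hF measurable_id measurable_const r η t
    have hYr : ∀ ω, ‖Y ω - μ‖ ≤ 2 * r := by
      intro ω
      have h1 := norm_descent_sub_center_le (fun i => F (ω i)) c hr η t
      have e : Y ω - μ = (Y ω - c) + (c - μ) := by abel
      rw [e]
      exact (norm_add_le _ _).trans (by linarith)
    have hraw : Measurable fun p : Ω × E d => ENNReal.ofReal (‖p.2 + η • (F p.1 p.2 - p.2) - μ‖ ^ 2) := by
      have : Measurable fun p : Ω × E d => p.2 + η • (F p.1 p.2 - p.2) - μ :=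
        (measurable_snd.add ((hF.sub measurable_snd).const_smul η)).sub_const μ
      fun_prop
    -- After dropping the projection, the new term of the stream is independent of `Y`, which
    -- depends on the first `t` terms, so `H` applies for fixed `Y`. The bound is preserved because
    -- `b / l` is the fixed point of `x ↦ (1 - l) x + b`. The index `t + 0` displays the new term as
    -- the head of the tail.
    calc ∫⁻ ω, ENNReal.ofReal (‖descent (fun i => F (ω i)) c r η (t + 1) - μ‖ ^ 2) ∂streamLaw κ
        ≤ ∫⁻ ω, ENNReal.ofReal (‖Y ω + η • (F (ω (t + 0)) (Y ω) - Y ω) - μ‖ ^ 2) ∂streamLaw κ := by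
          refine lintegral_mono fun ω => ENNReal.ofReal_le_ofReal ?_
          have := norm_pull_sub_le hc (Y ω + η • (F (ω t) (Y ω) - Y ω))
          simp only [descent, add_zero]
          gcongr
      _ = ∫⁻ ω, ∫⁻ v, ENNReal.ofReal (‖Y ω + η • (F (v 0) (Y ω) - Y ω) - μ‖ ^ 2)
            ∂streamLaw κ ∂streamLaw κ := by
          refine lintegral_stream_split κ t
            (h := fun ω v => ENNReal.ofReal (‖Y ω + η • (F (v 0) (Y ω) - Y ω) - μ‖ ^ 2)) ?_ ?_
          · exact hraw.comp (f := fun p : (ℕ → Ω) × (ℕ → Ω) => (p.2 0, Y p.1)) (by fun_prop)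
          · intro ω ω' v h
            have : Y ω = Y ω' := descent_congr c r η t fun i hi => by rw [h i hi]
            rw [this]
      _ ≤ ∫⁻ ω, (ENNReal.ofReal (1 - l) * ENNReal.ofReal (‖Y ω - μ‖ ^ 2) + ENNReal.ofReal b)
            ∂streamLaw κ := by
          refine lintegral_mono fun ω => ?_
          rw [lintegral_stream_head κ
            (f := fun z => ENNReal.ofReal (‖Y ω + η • (F z (Y ω) - Y ω) - μ‖ ^ 2))
            (hraw.comp (f := fun z => (z, Y ω)) (by fun_prop)) 0, ← ENNReal.ofReal_mul hl',
            ← ENNReal.ofReal_add (by positivity) hb]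
          exact H _ (hYr ω)
      _ = ENNReal.ofReal (1 - l) * ∫⁻ ω, ENNReal.ofReal (‖Y ω - μ‖ ^ 2) ∂streamLaw κ +
            ENNReal.ofReal b := by
          rw [lintegral_add_right _ measurable_const, lintegral_const_mul _ (by fun_prop)]
          simp
      _ ≤ ENNReal.ofReal (1 - l) * ENNReal.ofReal ((1 - l) ^ t * r ^ 2 + b / l) +
            ENNReal.ofReal b := by gcongr
      _ = _ := by
          rw [← ENNReal.ofReal_mul hl', ← ENNReal.ofReal_add (by positivity) hb]
          congr 1
          field_simp
          ring

/-- Markov's inequality for the squared error, with `288 = 8 * 36`. -/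
theorem streamLaw_descent_bad_le (hF : Measurable fun p : Ω × E d => F p.1 p.2) {c μ : E d}
    {r η l b : ℝ} (hr : 0 < r) (hc : ‖c - μ‖ ≤ r) (hl0 : 0 < l) (hl1 : l ≤ 1) (hb : 0 ≤ b)
    (H : ∀ y, ‖y - μ‖ ≤ 2 * r → ∫⁻ z, ENNReal.ofReal (‖y + η • (F z y - y) - μ‖ ^ 2) ∂κ ≤
      ENNReal.ofReal ((1 - l) * ‖y - μ‖ ^ 2 + b)) {T : ℕ}
    (hT : (1 - l) ^ T * r ^ 2 + b / l ≤ r ^ 2 / 288) :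
    streamLaw κ {ω | r / 6 < ‖descent (fun i => F (ω i)) c r η T - μ‖} ≤ ENNReal.ofReal (1 / 8) := by
  have h1 := (lintegral_descent_le hF hc hl0 hl1 hb H T).trans (ENNReal.ofReal_le_ofReal hT)
  have hYm : Measurable fun ω : ℕ → Ω => descent (fun i => F (ω i)) c r η T :=
    measurable_descent hF measurable_id measurable_const r η T
  have h2 := mul_meas_ge_le_lintegral (μ := streamLaw κ)
    (f := fun ω => ENNReal.ofReal (‖descent (fun i => F (ω i)) c r η T - μ‖ ^ 2)) (by fun_prop)
    (ENNReal.ofReal (r ^ 2 / 36))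
  have h3 : streamLaw κ {ω | r / 6 < ‖descent (fun i => F (ω i)) c r η T - μ‖} ≤
      streamLaw κ {ω | ENNReal.ofReal (r ^ 2 / 36) ≤
        ENNReal.ofReal (‖descent (fun i => F (ω i)) c r η T - μ‖ ^ 2)} := by
    refine measure_mono fun ω hω => ENNReal.ofReal_le_ofReal ?_
    have hω' : r / 6 < ‖descent (fun i => F (ω i)) c r η T - μ‖ := hω
    calc r ^ 2 / 36 = (r / 6) ^ 2 := by ring
      _ ≤ _ := by gcongr
  refine h3.trans ?_
  have hpos : ENNReal.ofReal (r ^ 2 / 36) ≠ 0 := by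
    rw [Ne, ENNReal.ofReal_eq_zero, not_le]; positivity
  rw [← ENNReal.mul_le_mul_iff_right hpos ENNReal.ofReal_ne_top]
  refine (h2.trans h1).trans (le_of_eq ?_)
  rw [← ENNReal.ofReal_mul (by positivity)]
  congr 1; ring

open Classical in
/-- The number of failures in independent runs has a small exponential moment. -/
theorem lintegral_four_pow_bad_le (hF : Measurable fun p : Ω × E d => F p.1 p.2) {c μ : E d}
    {r η : ℝ} {T : ℕ} (hbad : streamLaw κ {ω | r / 6 < ‖descent (fun i => F (ω i)) c r η T - μ‖} ≤
      ENNReal.ofReal (1 / 8)) (J : ℕ) :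
    ∫⁻ ω, (4 : ℝ≥0∞) ^ (∑ j ∈ Finset.range J,
      if r / 6 < ‖run (fun i => F (ω i)) c r η T j - μ‖ then 1 else 0) ∂streamLaw κ ≤
      ENNReal.ofReal (11 / 8) ^ J := by
  have hrm : ∀ j, Measurable fun ω : ℕ → Ω => run (fun i => F (ω i)) c r η T j := fun j =>
    measurable_run hF measurable_id measurable_const r η T j
  have hNm : ∀ J, Measurable fun ω : ℕ → Ω => (4 : ℝ≥0∞) ^ (∑ j ∈ Finset.range J,
      if r / 6 < ‖run (fun i => F (ω i)) c r η T j - μ‖ then 1 else 0) := by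
    intro J
    refine (measurable_from_nat (f := fun n : ℕ => (4 : ℝ≥0∞) ^ n)).comp
      (Finset.measurable_sum _ fun j _ => Measurable.ite ?_ measurable_const measurable_const)
    have := hrm j
    exact measurableSet_lt (by fun_prop) (by fun_prop)
  set bad : Set (ℕ → Ω) := {ω | r / 6 < ‖descent (fun i => F (ω i)) c r η T - μ‖} with hbad_def
  have hbm : MeasurableSet bad := by
    have : Measurable fun ω : ℕ → Ω => descent (fun i => F (ω i)) c r η T :=
      measurable_descent hF measurable_id measurable_const r η T
    exact measurableSet_lt (by fun_prop) (by fun_prop)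
  induction J with
  | zero => simp
  | succ J ih =>
    set N : (ℕ → Ω) → ℝ≥0∞ := fun ω => (4 : ℝ≥0∞) ^ (∑ j ∈ Finset.range J,
      if r / 6 < ‖run (fun i => F (ω i)) c r η T j - μ‖ then 1 else 0) with hN
    -- The factor contributed by one run is 4 if it fails and 1 otherwise, so its mean is at most `1
    -- + 3 / 8`.
    set g : (ℕ → Ω) → ℝ≥0∞ := fun v => 1 + bad.indicator (fun _ => 3) v with hg
    have hgm : Measurable g := Measurable.const_add (measurable_const.indicator hbm) 1
    calc _ = ∫⁻ ω, N ω * g (fun i => ω (J * T + i)) ∂streamLaw κ := by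
          refine lintegral_congr fun ω => ?_
          rw [Finset.sum_range_succ, pow_add, hN]
          congr 1
          have e : r / 6 < ‖run (fun i => F (ω i)) c r η T J - μ‖ ↔
            (fun i => ω (J * T + i)) ∈ bad := Iff.rfl
          simp only [hg, e, Set.indicator]
          split_ifs <;> norm_num
      _ = ∫⁻ ω, ∫⁻ v, N ω * g v ∂streamLaw κ ∂streamLaw κ := by
          refine lintegral_stream_split κ (J * T) (h := fun ω v => N ω * g v) ?_ ?_
          · exact ((hNm J).comp measurable_fst).mul (hgm.comp measurable_snd)
          · intro ω ω' v h
            have : N ω = N ω' := by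
              simp only [hN]
              congr 1
              refine Finset.sum_congr rfl fun j hj => ?_
              rw [run_congr (a' := fun i => F (ω' i)) c r η T j fun i hi => by
                rw [h i (hi.trans_le (Nat.mul_le_mul_right T (Finset.mem_range.1 hj)))]]
            rw [this]
      _ = (∫⁻ ω, N ω ∂streamLaw κ) * ∫⁻ v, g v ∂streamLaw κ := by
          rw [← lintegral_mul_const _ (hNm J)]
          exact lintegral_congr fun ω => lintegral_const_mul _ hgm
      _ ≤ ENNReal.ofReal (11 / 8) ^ J * ENNReal.ofReal (11 / 8) := by
          gcongr
          rw [hg, lintegral_add_left measurable_const, lintegral_indicator_const hbm]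
          simp only [lintegral_const, measure_univ, mul_one]
          calc 1 + 3 * streamLaw κ bad ≤ 1 + 3 * ENNReal.ofReal (1 / 8) := by gcongr
            _ = ENNReal.ofReal 1 + ENNReal.ofReal 3 * ENNReal.ofReal (1 / 8) := by simp
            _ = ENNReal.ofReal (11 / 8) := by
              rw [← ENNReal.ofReal_mul (by norm_num), ← ENNReal.ofReal_add (by norm_num)
                (by norm_num)]
              norm_num
      _ = _ := (pow_succ _ _).symm

/-- The failure probability of one stage. -/
theorem streamLaw_stage_bad_le (hF : Measurable fun p : Ω × E d => F p.1 p.2) {c μ : E d}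
    {r η : ℝ} (hr : 0 ≤ r) {T : ℕ}
    (hbad : streamLaw κ {ω | r / 6 < ‖descent (fun i => F (ω i)) c r η T - μ‖} ≤
      ENNReal.ofReal (1 / 8)) (J : ℕ) :
    streamLaw κ {ω | r / 2 < ‖stage (fun i => F (ω i)) c r η T J - μ‖} ≤
      ENNReal.ofReal ((11 / 16) ^ J) := by
  classical
  have h1 := lintegral_four_pow_bad_le hF hbad J
  have hrm : ∀ j, Measurable fun ω : ℕ → Ω => run (fun i => F (ω i)) c r η T j := fun j =>
    measurable_run hF measurable_id measurable_const r η T j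
  have hNm : Measurable fun ω : ℕ → Ω => (4 : ℝ≥0∞) ^ (∑ j ∈ Finset.range J,
      if r / 6 < ‖run (fun i => F (ω i)) c r η T j - μ‖ then 1 else 0) := by
    refine (measurable_from_nat (f := fun n : ℕ => (4 : ℝ≥0∞) ^ n)).comp
      (Finset.measurable_sum _ fun j _ => Measurable.ite ?_ measurable_const measurable_const)
    have := hrm j
    exact measurableSet_lt (by fun_prop) (by fun_prop)
  -- If at least half of the runs fail, the moment variable is at least `4 ^ (J / 2) = 2 ^ J`.
  -- Markov's inequality gives `(11 / 8) ^ J / 2 ^ J`.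
  have h2 := mul_meas_ge_le_lintegral (μ := streamLaw κ) hNm (2 ^ J)
  have h3 : streamLaw κ {ω | r / 2 < ‖stage (fun i => F (ω i)) c r η T J - μ‖} ≤
      streamLaw κ {ω | (2 : ℝ≥0∞) ^ J ≤ (4 : ℝ≥0∞) ^ (∑ j ∈ Finset.range J,
        if r / 6 < ‖run (fun i => F (ω i)) c r η T j - μ‖ then 1 else 0)} := by
    refine measure_mono fun ω hω => ?_
    have hω' : r / 2 < ‖stage (fun i => F (ω i)) c r η T J - μ‖ := hω
    by_contra hcon
    refine absurd hω' (not_lt.2 (norm_select_sub_le hr ?_))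
    by_contra hJ
    refine hcon ?_
    change (2 : ℝ≥0∞) ^ J ≤ 4 ^ _
    rw [show (4 : ℝ≥0∞) = 2 ^ 2 by norm_num, ← pow_mul]
    refine pow_le_pow_right₀ (by norm_num) ?_
    convert! not_lt.1 hJ
  refine h3.trans ?_
  have hpos : (2 : ℝ≥0∞) ^ J ≠ 0 := by positivity
  rw [← ENNReal.mul_le_mul_iff_right hpos (ENNReal.pow_ne_top (by simp))]
  refine (h2.trans h1).trans (le_of_eq ?_)
  rw [← ENNReal.ofReal_pow (by norm_num), show (2 : ℝ≥0∞) = ENNReal.ofReal 2 by simp,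
    ← ENNReal.ofReal_pow (by norm_num), ← ENNReal.ofReal_mul (by positivity), ← mul_pow]
  norm_num

/-- The failure probability of the first stages. -/
theorem streamLaw_stages_bad_le (hF : Measurable fun p : Ω × E d => F p.1 p.2) {μ : E d}
    {D : ℝ} (hD : 0 ≤ D) {η : ℝ → ℝ} {T J : ℕ} (hμ : ‖μ‖ ≤ D) (K : ℕ)
    (hbad : ∀ k < K, ∀ c : E d, ‖c - μ‖ ≤ D * (1 / 2) ^ k →
      streamLaw κ {ω | D * (1 / 2) ^ k / 6 < ‖descent (fun i => F (ω i)) c (D * (1 / 2) ^ k)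
        (η (D * (1 / 2) ^ k)) T - μ‖} ≤ ENNReal.ofReal (1 / 8)) :
    streamLaw κ {ω | D * (1 / 2) ^ K < ‖stages (fun i => F (ω i)) D η T J K - μ‖} ≤
      ENNReal.ofReal (K * (11 / 16) ^ J) := by
  classical
  induction K with
  | zero =>
    have : {ω : ℕ → Ω | D * (1 / 2) ^ 0 < ‖stages (fun i => F (ω i)) D η T J 0 - μ‖} = ∅ := by
      ext ω
      simpa [stages] using hμ
    rw [this]; simp
  | succ K ih =>
    set r := D * (1 / 2) ^ K with hr
    have hr0 : 0 ≤ r := by positivity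
    set c : (ℕ → Ω) → E d := fun ω => stages (fun i => F (ω i)) D η T J K with hc
    have hcm : Measurable c := measurable_stages hF D η T J K
    -- The event that the new stage fails although its center is good. The center depends on earlier
    -- terms only, and for each fixed good center the bound for one stage applies.
    set B : Set ((ℕ → Ω) × (ℕ → Ω)) := {p | ‖c p.1 - μ‖ ≤ r ∧
      r / 2 < ‖stage (fun i => F (p.2 i)) (c p.1) r (η r) T J - μ‖} with hB
    have hsm : Measurable fun p : (ℕ → Ω) × (ℕ → Ω) =>
        stage (fun i => F (p.2 i)) (c p.1) r (η r) T J :=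
      measurable_stage hF (ψ := fun p : (ℕ → Ω) × (ℕ → Ω) => p.2) measurable_snd
        (hcm.comp measurable_fst) r (η r) T J
    have hBm : MeasurableSet B := by
      have h1 : Measurable fun p : (ℕ → Ω) × (ℕ → Ω) => c p.1 := hcm.comp measurable_fst
      exact (measurableSet_le (h1.sub_const μ).norm measurable_const).inter
        (measurableSet_lt measurable_const (hsm.sub_const μ).norm)
    have hsub : {ω : ℕ → Ω | D * (1 / 2) ^ (K + 1) <
        ‖stages (fun i => F (ω i)) D η T J (K + 1) - μ‖} ⊆
        {ω | r < ‖c ω - μ‖} ∪ {ω | (ω, fun i => ω (K * (J * T) + i)) ∈ B} := by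
      intro ω hω
      have hω' : D * (1 / 2) ^ (K + 1) <
        ‖stages (fun i => F (ω i)) D η T J (K + 1) - μ‖ := hω
      rcases lt_or_ge r ‖c ω - μ‖ with h | h
      · exact Or.inl h
      · refine Or.inr ⟨h, ?_⟩
        rw [pow_succ, ← mul_assoc, ← hr] at hω'
        simp only [stages] at hω'
        rw [show r / 2 = r * (1 / 2) by ring]
        exact hω'
    have hm2 : MeasurableSet {ω : ℕ → Ω | (ω, fun i => ω (K * (J * T) + i)) ∈ B} :=
      hBm.preimage (f := fun ω : ℕ → Ω => (ω, fun i => ω (K * (J * T) + i))) (by fun_prop)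
    have hstep : streamLaw κ {ω : ℕ → Ω | (ω, fun i => ω (K * (J * T) + i)) ∈ B} ≤
        ENNReal.ofReal ((11 / 16) ^ J) := by
      rw [← lintegral_indicator_one hm2]
      have hsplit := lintegral_stream_split κ (K * (J * T))
        (h := fun ω v => B.indicator (fun _ => (1 : ℝ≥0∞)) (ω, v))
        (measurable_const.indicator hBm) (by
          intro ω ω' v h
          have : c ω = c ω' := stages_congr D η T J K fun i hi => by rw [h i hi]
          simp only [Set.indicator, hB, Set.mem_ofPred_eq, this])
      have e : ∀ ω : ℕ → Ω, {ω : ℕ → Ω | (ω, fun i => ω (K * (J * T) + i)) ∈ B}.indicator 1 ω =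
          B.indicator (fun _ => (1 : ℝ≥0∞)) (ω, fun i => ω (K * (J * T) + i)) := fun ω => rfl
      simp only [e]
      rw [hsplit]
      calc _ ≤ ∫⁻ _ω : ℕ → Ω, ENNReal.ofReal ((11 / 16) ^ J) ∂streamLaw κ := by
            refine lintegral_mono fun ω => ?_
            have hm3 : MeasurableSet {v | (ω, v) ∈ B} :=
              hBm.preimage (f := fun v : ℕ → Ω => (ω, v)) (by fun_prop)
            have e3 : ∫⁻ v, B.indicator (fun _ => (1 : ℝ≥0∞)) (ω, v) ∂streamLaw κ =
                streamLaw κ {v | (ω, v) ∈ B} := by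
              rw [← lintegral_indicator_one hm3]; rfl
            simp only [e3]
            by_cases hω : ‖c ω - μ‖ ≤ r
            · refine le_trans (measure_mono fun v hv => ?_) (streamLaw_stage_bad_le hF hr0
                (hbad K (by omega) (c ω) hω) J)
              exact hv.2
            · have : {v | (ω, v) ∈ B} = ∅ := by
                ext v; simp [hB, hω]
              rw [this]; simp
        _ = _ := by simp
    calc _ ≤ _ := (measure_mono hsub).trans (measure_union_le _ _)
      _ ≤ ENNReal.ofReal (K * (11 / 16) ^ J) + ENNReal.ofReal ((11 / 16) ^ J) :=
          add_le_add (ih fun k hk => hbad k (by omega)) hstep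
      _ = _ := by
          rw [← ENNReal.ofReal_add (by positivity) (by positivity)]
          congr 1; push_cast; ring

end Algorithm

/-! ### Program logic -/

section Logic

variable {d : ℕ} {e : Env d}

/-- Started in the state `s`, the program `c` halts after time at most `B` in a state with the
property `Q`. -/
def Runs (e : Env d) (c : Cmd) (s : State) (B : ℕ) (Q : State → Prop) : Prop :=
  ∃ s' t, Exec e c s s' t ∧ t ≤ B ∧ Q s'

theorem Runs.mono {c : Cmd} {s : State} {B B' : ℕ} {Q Q' : State → Prop} (h : Runs e c s B Q)
    (hB : B ≤ B') (hQ : ∀ s, Q s → Q' s) : Runs e c s B' Q' := by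
  obtain ⟨s', t, h1, h2, h3⟩ := h
  exact ⟨s', t, h1, h2.trans hB, hQ _ h3⟩

theorem Runs.seq {c₁ c₂ : Cmd} {s : State} {B₁ B₂ : ℕ} {P Q : State → Prop}
    (h₁ : Runs e c₁ s B₁ P) (h₂ : ∀ s, P s → Runs e c₂ s B₂ Q) :
    Runs e (.seq c₁ c₂) s (B₁ + B₂) Q := by
  obtain ⟨s₁, t₁, h1, h2, h3⟩ := h₁
  obtain ⟨s₂, t₂, h4, h5, h6⟩ := h₂ s₁ h3
  exact ⟨s₂, t₁ + t₂, .seq h1 h4, add_le_add h2 h5, h6⟩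

theorem Runs.skip {s : State} {Q : State → Prop} (h : Q s) : Runs e .skip s 1 Q :=
  ⟨s, 1, .skip s, le_rfl, h⟩

theorem Runs.setNat {s : State} {i : ℕ} {a : NExp} {Q : State → Prop}
    (h : Q { s with nat := Function.update s.nat i (a.eval s) }) :
    Runs e (.setNat i a) s (a.cost + 1) Q :=
  ⟨_, _, .setNat s i a, le_rfl, h⟩

theorem Runs.setReal {s : State} {a : NExp} {r : RExp} {Q : State → Prop}
    (h : Q { s with mem := Function.update s.mem (a.eval s) (r.eval s) }) :
    Runs e (.setReal a r) s (a.cost + r.cost + 1) Q :=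
  ⟨_, _, .setReal s a r, le_rfl, h⟩

theorem Runs.setNat_seq {s : State} {i : ℕ} {a : NExp} {c : Cmd} {B : ℕ} {Q : State → Prop}
    (h : Runs e c { s with nat := Function.update s.nat i (a.eval s) } B Q) :
    Runs e (.seq (.setNat i a) c) s (a.cost + 1 + B) Q :=
  (Runs.setNat (Q := fun s' => s' = _) rfl).seq (by rintro _ rfl; exact h)

theorem Runs.setReal_seq {s : State} {a : NExp} {r : RExp} {c : Cmd} {B : ℕ} {Q : State → Prop}
    (h : Runs e c { s with mem := Function.update s.mem (a.eval s) (r.eval s) } B Q) :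
    Runs e (.seq (.setReal a r) c) s (a.cost + r.cost + 1 + B) Q :=
  (Runs.setReal (Q := fun s' => s' = _) rfl).seq (by rintro _ rfl; exact h)

theorem Runs.draw {s : State} {Q : State → Prop} (h : Q { s with drawn := s.drawn + 1 }) :
    Runs e .draw s 1 Q :=
  ⟨_, _, .draw s, le_rfl, h⟩

theorem Runs.oracle {s : State} {h a b : NExp} {Q : State → Prop} (hh : h.eval s < s.drawn)
    (hQ : Q { s with
      mem := s.store (b.eval s) (e.answer s.calls (e.sample (h.eval s)) (s.vec d (a.eval s)))
      calls := s.calls + 1 }) :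
    Runs e (.oracle h a b) s (h.cost + a.cost + b.cost + e.Ts + d + 1) Q :=
  ⟨_, _, .oracle s h a b hh, le_rfl, hQ⟩

theorem Runs.ite {s : State} {b : Test} {c₁ c₂ : Cmd} {B : ℕ} {Q : State → Prop}
    (h₁ : b.holds s → Runs e c₁ s B Q) (h₂ : ¬ b.holds s → Runs e c₂ s B Q) :
    Runs e (.ite b c₁ c₂) s (b.cost + B) Q := by
  by_cases hb : b.holds s
  · obtain ⟨s', t, h1, h2, h3⟩ := h₁ hb
    exact ⟨s', _, .iteTrue hb h1, by omega, h3⟩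
  · obtain ⟨s', t, h1, h2, h3⟩ := h₂ hb
    exact ⟨s', _, .iteFalse hb h1, by omega, h3⟩

/-- The invariant carries the iteration number, so the loop makes exactly `N` passes; this later
yields an exact count of samples. -/
theorem Runs.loop {b : Test} {c : Cmd} {B : ℕ} {Inv : ℕ → State → Prop} (N : ℕ)
    (hstep : ∀ k < N, ∀ s, Inv k s → b.holds s ∧ Runs e c s B (Inv (k + 1)))
    (hend : ∀ s, Inv N s → ¬ b.holds s) {s : State} (hs : Inv 0 s) :
    Runs e (.loop b c) s (N * (B + b.cost) + b.cost) (Inv N) := by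
  have key : ∀ n k, k + n = N → ∀ s, Inv k s →
      Runs e (.loop b c) s (n * (B + b.cost) + b.cost) (Inv N) := by
    intro n
    induction n with
    | zero =>
      rintro k rfl s hs
      exact ⟨s, _, .loopFalse (hend s hs), by omega, hs⟩
    | succ n ih =>
      intro k hk s hs
      obtain ⟨hb, s₁, t₁, h1, h2, h3⟩ := hstep k (by omega) s hs
      obtain ⟨s₂, t₂, h4, h5, h6⟩ := ih (k + 1) (by omega) s₁ h3
      refine ⟨s₂, _, .loopTrue hb h1 h4, ?_, h6⟩
      rw [add_mul]; omega
  exact key N 0 (by omega) s hs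

/-! ### Vector operations -/

/-- The memory after writing `w 0, …, w (n - 1)` at the addresses `A, …, A + n - 1`. -/
def blockWrite (m : ℕ → ℝ) (A n : ℕ) (w : ℕ → ℝ) : ℕ → ℝ := fun j =>
  if A ≤ j ∧ j < A + n then w (j - A) else m j

theorem blockWrite_add (m : ℕ → ℝ) (A : ℕ) {n i : ℕ} (w : ℕ → ℝ) (hi : i < n) :
    blockWrite m A n w (A + i) = w i := by
  simp [blockWrite, hi]

theorem blockWrite_of_not (m : ℕ → ℝ) {A n j : ℕ} (w : ℕ → ℝ) (h : ¬ (A ≤ j ∧ j < A + n)) :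
    blockWrite m A n w j = m j := if_neg h

theorem blockWrite_zero (m : ℕ → ℝ) (A : ℕ) (w : ℕ → ℝ) : blockWrite m A 0 w = m := by
  ext j; exact blockWrite_of_not m w (by omega)

theorem update_blockWrite (m : ℕ → ℝ) (A i : ℕ) (w : ℕ → ℝ) :
    Function.update (blockWrite m A i w) (A + i) (w i) = blockWrite m A (i + 1) w := by
  ext j
  rcases eq_or_ne j (A + i) with rfl | hj
  · simp [blockWrite]
  · rw [Function.update_of_ne hj]
    unfold blockWrite
    split_ifs <;> first | rfl | omega

/-- Repeats `c` for the values `0, …, d - 1` of the register `5`. -/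
def forCoord (c : Cmd) : Cmd :=
  .seq (.setNat 5 (.const 0)) (.loop (.natLt (.reg 5) (.reg 0))
    (.seq c (.setNat 5 (.add (.reg 5) (.const 1)))))

/-- Writes the values of `r` for the values `0, …, d - 1` of the register `5` to the addresses
`a, …, a + d - 1`. -/
def assignVec (a : NExp) (r : RExp) : Cmd := forCoord (.setReal (.add a (.reg 5)) r)

/-- Computes the sum of the squares of `r` for the values `0, …, d - 1` of the register `5`. -/
def sumSq (r : RExp) : Cmd :=
  .seq (.setReal (.const 8) (.ofNat (.const 0)))
    (forCoord (.setReal (.const 8) (.add (.mem (.const 8)) (.mul r r))))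

/-- The value of coordinate `i` is needed only in the memory where the coordinates below `i` are
already overwritten. This covers updates in place, where coordinate `i` of the new vector depends on
coordinate `i` of the old one. -/
theorem Runs.assignVec {a : NExp} {r : RExp} {s : State} {A : ℕ} {w : ℕ → ℝ} (hd : s.nat 0 = d)
    (ha : ∀ i < d, ∀ m, a.eval { s with nat := Function.update s.nat 5 i, mem := m } = A)
    (hr : ∀ i < d, r.eval { s with
      nat := Function.update s.nat 5 i, mem := blockWrite s.mem A i w } = w i)
    {Q : State → Prop} (hQ : Q { s with
      nat := Function.update s.nat 5 d, mem := blockWrite s.mem A d w }) :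
    Runs e (assignVec a r) s ((d + 1) * (a.cost + r.cost + 20)) Q := by
  have hloop := Runs.loop (e := e) (b := .natLt (.reg 5) (.reg 0))
    (c := .seq (.setReal (.add a (.reg 5)) r) (.setNat 5 (.add (.reg 5) (.const 1))))
    (B := ((NExp.add a (.reg 5)).cost + r.cost + 1) + 4)
    (Inv := fun i s' => s' = { s with
      nat := Function.update s.nat 5 i, mem := blockWrite s.mem A i w }) d
    (by
      rintro i hi _ rfl
      refine ⟨?_, ?_⟩
      · simp [Test.holds, NExp.eval, hd, hi]
      · refine Runs.seq (Runs.setReal (Q := fun s' => s' = { s with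
          nat := Function.update s.nat 5 i, mem := blockWrite s.mem A (i + 1) w }) ?_) ?_
        · simp only [NExp.eval, ha i hi, hr i hi, Function.update_self, update_blockWrite]
        · rintro _ rfl
          refine Runs.setNat ?_
          simp [NExp.eval])
    (by rintro _ rfl; simp [Test.holds, NExp.eval, hd])
    (s := { s with nat := Function.update s.nat 5 0 }) (by rw [blockWrite_zero])
  refine (Runs.setNat_seq hloop).mono ?_ ?_
  · simp only [NExp.cost, Test.cost]
    nlinarith
  · rintro _ rfl
    exact hQ

/-- Address 8 is the accumulator, so the summands must have the same value whatever `z` it contains.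
-/
theorem Runs.sumSq {r : RExp} {s : State} {w : ℕ → ℝ} (hd : s.nat 0 = d)
    (hr : ∀ i < d, ∀ z, r.eval { s with
      nat := Function.update s.nat 5 i, mem := Function.update s.mem 8 z } = w i)
    {Q : State → Prop} (hQ : Q { s with
      nat := Function.update s.nat 5 d,
      mem := Function.update s.mem 8 (∑ i ∈ Finset.range d, w i ^ 2) }) :
    Runs e (sumSq r) s ((d + 1) * (2 * r.cost + 30)) Q := by
  have hloop := Runs.loop (e := e) (b := .natLt (.reg 5) (.reg 0))
    (c := .seq (.setReal (.const 8) (.add (.mem (.const 8)) (.mul r r)))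
      (.setNat 5 (.add (.reg 5) (.const 1))))
    (B := (1 + (RExp.add (.mem (.const 8)) (.mul r r)).cost + 1) + 4)
    (Inv := fun i s' => s' = { s with
      nat := Function.update s.nat 5 i,
      mem := Function.update s.mem 8 (∑ i ∈ Finset.range i, w i ^ 2) }) d
    (by
      rintro i hi _ rfl
      refine ⟨?_, ?_⟩
      · simp [Test.holds, NExp.eval, hd, hi]
      · refine Runs.seq (Runs.setReal (Q := fun s' => s' = { s with
          nat := Function.update s.nat 5 i,
          mem := Function.update s.mem 8 (∑ i ∈ Finset.range (i + 1), w i ^ 2) }) ?_) ?_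
        · simp only [NExp.eval, RExp.eval, hr i hi, Function.update_self, Finset.sum_range_succ,
            Function.update_idem, sq]
        · rintro _ rfl
          refine Runs.setNat ?_
          simp [NExp.eval])
    (by rintro _ rfl; simp [Test.holds, NExp.eval, hd])
    (s := { s with nat := Function.update s.nat 5 0, mem := Function.update s.mem 8 ((0 : ℕ) : ℝ) })
    (by simp)
  refine (Runs.setReal_seq (Runs.setNat_seq hloop)).mono ?_ ?_
  · simp only [NExp.cost, RExp.cost, Test.cost]
    nlinarith
  · rintro _ rfl
    exact hQ

theorem State.vec_congr {s s' : State} {A : ℕ} (h : ∀ i < d, s.mem (A + i) = s'.mem (A + i)) :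
    s.vec d A = s'.vec d A := by
  ext i; exact h i i.2

theorem State.vec_eq_iff {s : State} {A : ℕ} {y : E d} :
    s.vec d A = y ↔ ∀ i : Fin d, s.mem (A + i) = y i := by
  constructor
  · rintro rfl i; rfl
  · intro h; ext i; exact h i

theorem sum_range_sq_eq_norm_sq (y : E d) {w : ℕ → ℝ} (h : ∀ i : Fin d, w i = y i) :
    ∑ i ∈ Finset.range d, w i ^ 2 = ‖y‖ ^ 2 := by
  rw [EuclideanSpace.real_norm_sq_eq, ← Fin.sum_univ_eq_sum_range (fun i => w i ^ 2)]
  exact Finset.sum_congr rfl fun i _ => by rw [h]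

theorem State.store_of_not {s : State} {b j : ℕ} (y : E d) (h : ¬ (b ≤ j ∧ j < b + d)) :
    s.store b y j = s.mem j := dif_neg h

theorem State.store_add (s : State) (b : ℕ) (y : E d) (i : Fin d) :
    s.store b y (b + i) = y i := by
  have h : b ≤ b + (i : ℕ) ∧ b + (i : ℕ) < b + d := ⟨by omega, by omega⟩
  rw [State.store, dif_pos h]
  exact congrArg (fun k => y k) (Fin.ext (by simp))

end Logic

/-! ### The program -/

section Program

/-- The address of the vector with number `k`. -/
def vbase (d k : ℕ) : ℕ := 16 + k * d

/-- The address of the vector with number `k`, as an expression. -/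
def vecAddr (k : NExp) : NExp := .add (.const 16) (.mul k (.reg 0))

/-- The coordinate with number in the register `5` of the vector with number `k`. -/
def coord (k : NExp) : RExp := .mem (.add (vecAddr k) (.reg 5))

/-- The scalar at the address `a`. -/
def scalar (a : ℕ) : RExp := .mem (.const a)

/-- The number of the vector of the run whose number is in the register `i`. -/
def runIndex (i : ℕ) : NExp := .add (.const 2) (.reg i)

/-- Increments the register `i`. -/
def incr (i : ℕ) : Cmd := .setNat i (.add (.reg i) (.const 1))

/-- One projected gradient step of the run in the register `3`, for the gradient sample in the
vector `1`. -/
def gradientCmd : Cmd :=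
  .seq (assignVec (vecAddr (runIndex 3)) (.sub (.add (coord (runIndex 3))
    (.mul (scalar 7) (.sub (coord (.const 1)) (coord (runIndex 3))))) (coord (.const 0))))
  (.seq (sumSq (coord (runIndex 3)))
  (.seq (.ite (.realLt (.mul (scalar 5) (scalar 5)) (scalar 8))
    (.setReal (.const 9) (.div (scalar 5) (.sqrt (scalar 8))))
    (.setReal (.const 9) (.ofNat (.const 1))))
  (assignVec (vecAddr (runIndex 3))
    (.add (coord (.const 0)) (.mul (scalar 9) (coord (runIndex 3)))))))

/-- One step of stochastic gradient descent. -/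
def stepCmd : Cmd :=
  .seq .draw (.seq (.oracle (.reg 1) (vecAddr (runIndex 3)) (vecAddr (.const 1)))
    (.seq (incr 1) (.seq gradientCmd (incr 4))))

/-- One run of stochastic gradient descent. -/
def runCmd : Cmd :=
  .seq (assignVec (vecAddr (runIndex 3)) (coord (.const 0)))
  (.seq (.setNat 4 (.const 0)) (.seq (.loop (.realLt (.ofNat (.reg 4)) (scalar 6)) stepCmd)
    (incr 3)))

/-- Counts the results of the runs that are close to the result of the run in the register `3`. -/
def countCmd : Cmd :=
  .seq (.setNat 6 (.const 0)) (.seq (.setNat 7 (.const 0)) (.loop (.natLt (.reg 6) (.reg 2))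
    (.seq (sumSq (.sub (coord (runIndex 6)) (coord (runIndex 3))))
      (.seq (.ite (.realLt (.div (.mul (scalar 5) (scalar 5)) (.ofNat (.const 9))) (scalar 8))
        .skip (incr 7)) (incr 6)))))

/-- Selects the result of the run in the register `3` if it is close to most others. -/
def selectCmd : Cmd :=
  .seq countCmd (.seq (.ite (.natLt (.reg 2) (.mul (.const 2) (.reg 7)))
    (assignVec (vecAddr (.const 0)) (coord (runIndex 3))) .skip) (incr 3))

/-- The step size. -/
def etaExp : RExp :=
  .div (.mul (.mul (scalar 2) (scalar 2)) (.mul (scalar 5) (scalar 5)))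
    (.mul (.mul (.ofNat (.const 1152000))
      (.add (.ofNat (.const 1)) (.mul (.ofNat (.const 2)) (scalar 5)))) (scalar 11))

/-- One stage. -/
def stageCmd : Cmd :=
  .seq (.setReal (.const 7) etaExp)
  (.seq (.setNat 3 (.const 0)) (.seq (.loop (.natLt (.reg 3) (.reg 2)) runCmd)
  (.seq (.setNat 3 (.const 0)) (.seq (.loop (.natLt (.reg 3) (.reg 2)) selectCmd)
    (.setReal (.const 5) (.mul (scalar 5) (.div (.ofNat (.const 1)) (.ofNat (.const 2)))))))))

/-- The parameter `d R² + D²`. -/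
def scaleExp : RExp :=
  .add (.mul (.ofNat (.reg 0)) (.mul (scalar 0) (scalar 0))) (.mul (scalar 1) (scalar 1))

/-- The number of steps of a run. -/
def stepsExp : RExp :=
  .div (.mul (.ofNat (.const 597196800000)) (scalar 11))
    (.mul (.mul (.mul (scalar 2) (scalar 2)) (.mul (scalar 2) (scalar 2)))
      (.mul (scalar 3) (scalar 3)))

/-- Computes the parameters. -/
def initCmd : Cmd :=
  .seq (.setReal (.const 11) scaleExp)
  (.seq (.setReal (.const 6) stepsExp)
  (.seq (.setReal (.const 10) (.div (.mul (.ofNat (.const 2)) (scalar 1))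
    (.mul (scalar 3) (scalar 4))))
  (.seq (.loop (.realLt (.ofNat (.const 1)) (scalar 10))
    (.seq (.setReal (.const 10) (.mul (scalar 10) (.div (.ofNat (.const 3)) (.ofNat (.const 4)))))
      (incr 2)))
    (.setReal (.const 5) (scalar 1)))))

/-- The algorithm. -/
def algorithm : Cmd :=
  .seq initCmd (.seq (.loop (.realLt (scalar 3) (scalar 5)) stageCmd)
    (assignVec (.const 0) (coord (.const 0))))

end Program

/-! ### Memory layout and the projected gradient step. -/

section Correctness

variable {d : ℕ} {e : Env d}

/-- The coordinates of a vector, extended by zero. -/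
def coords (y : E d) (i : ℕ) : ℝ := if h : i < d then y ⟨i, h⟩ else 0

theorem coords_val (y : E d) (i : Fin d) : coords y i = y i := by simp [coords]

theorem coords_add (y z : E d) (i : ℕ) : coords (y + z) i = coords y i + coords z i := by
  unfold coords; split_ifs <;> simp

theorem coords_sub (y z : E d) (i : ℕ) : coords (y - z) i = coords y i - coords z i := by
  unfold coords; split_ifs <;> simp

theorem coords_smul (a : ℝ) (y : E d) (i : ℕ) : coords (a • y) i = a * coords y i := by
  unfold coords; split_ifs <;> simp

theorem State.mem_of_vec_eq {s : State} {A : ℕ} {y : E d} (h : s.vec d A = y) {i : ℕ}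
    (hi : i < d) : s.mem (A + i) = coords y i := by
  subst h; simp [coords, hi, State.vec]

theorem State.vec_eq_of_mem {s : State} {A : ℕ} {y : E d}
    (h : ∀ i < d, s.mem (A + i) = coords y i) : s.vec d A = y := by
  rw [State.vec_eq_iff]
  intro i
  rw [h i i.2, coords_val]

/-- The vector 0 is the center, the vector 1 the last oracle answer, and `2 + j` the iterate of run
`j`. Their blocks are disjoint and lie above the scalars: 5 is the radius, 6 the step number, 7 the
step size, 8 to 10 are auxiliary, and 11 is `d R² + D²`. -/
theorem vbase_add_le {k k' : ℕ} (h : k < k') : vbase d k + d ≤ vbase d k' := by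
  unfold vbase
  have : (k + 1) * d ≤ k' * d := Nat.mul_le_mul_right d h
  rw [add_mul] at this
  omega

theorem not_mem_block {k k' i : ℕ} (h : k ≠ k') (hi : i < d) :
    ¬ (vbase d k' ≤ vbase d k + i ∧ vbase d k + i < vbase d k' + d) := by
  rcases lt_or_gt_of_ne h with h | h
  · have := vbase_add_le (d := d) h; omega
  · have := vbase_add_le (d := d) h; omega

theorem sixteen_le_vbase (k : ℕ) : 16 ≤ vbase d k := Nat.le_add_right _ _

/-- The block of the run first receives the displacement from the center, whose squared norm is
summed, and is then rescaled in place. The comparison of squared norms and the later square root are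
those in `pull`. -/
theorem Runs.gradientCmd {s : State} {c x y : E d} {r η : ℝ} {j : ℕ} (hd : s.nat 0 = d)
    (hj : s.nat 3 = j) (hc : s.vec d (vbase d 0) = c) (hx : s.vec d (vbase d 1) = x)
    (hy : s.vec d (vbase d (2 + j)) = y) (hr : s.mem 5 = r) (hη : s.mem 7 = η)
    {Q : State → Prop} (hQ : ∀ s' : State, s'.nat = Function.update s.nat 5 d →
      s'.drawn = s.drawn → s'.calls = s.calls →
      (∀ a, a ≠ 8 → a ≠ 9 → ¬ (vbase d (2 + j) ≤ a ∧ a < vbase d (2 + j) + d) →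
        s'.mem a = s.mem a) →
      s'.vec d (vbase d (2 + j)) = pull c r (y + η • (x - y)) → Q s') :
    Runs e gradientCmd s ((d + 1) * 400) Q := by
  set A := vbase d (2 + j) with hA
  have hA16 : 16 ≤ A := sixteen_le_vbase _
  set w : E d := y + η • (x - y) - c with hw
  have hw' : ∀ i, coords w i = coords y i + η * (coords x i - coords y i) - coords c i := by
    intro i; simp only [hw, coords_add, coords_sub, coords_smul]
  set sc : ℝ := if r ^ 2 < ‖w‖ ^ 2 then r / √(‖w‖ ^ 2) else 1 with hsc
  have hpull : ∀ i, coords (pull c r (y + η • (x - y))) i = coords c i + sc * coords w i := by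
    intro i; rw [pull, coords_add, coords_smul]
  have haddr : ∀ (s' : State), s'.nat 0 = d → s'.nat 3 = j →
      (vecAddr (runIndex 3)).eval s' = A := by
    intro s' h0 h3
    simp only [vecAddr, runIndex, NExp.eval, h0, h3, hA, vbase]
  have hcoord : ∀ (s' : State) (i : ℕ), s'.nat 0 = d → s'.nat 3 = j → s'.nat 5 = i →
      (coord (runIndex 3)).eval s' = s'.mem (A + i) := by
    intro s' i h0 h3 h5
    simp only [coord, RExp.eval, NExp.eval, haddr s' h0 h3, h5]
  have hcoordk : ∀ (s' : State) (i k : ℕ), s'.nat 0 = d → s'.nat 5 = i →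
      (coord (.const k)).eval s' = s'.mem (vbase d k + i) := by
    intro s' i k h0 h5
    simp only [coord, RExp.eval, NExp.eval, vecAddr, h0, h5, vbase]
  -- The state after the first loop.
  set s₁ : State := { s with nat := Function.update s.nat 5 d, mem := blockWrite s.mem A d (coords w) }
    with hs₁
  set s₂ : State := { s₁ with mem := Function.update s₁.mem 8 (‖w‖ ^ 2) } with hs₂
  set s₃ : State := { s₂ with mem := Function.update s₂.mem 9 sc } with hs₃
  have h₁ : Runs e _ s _ (fun s' => s' = s₁) := Runs.assignVec (e := e) (s := s)
    (a := vecAddr (runIndex 3)) (r := .sub (.add (coord (runIndex 3))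
      (.mul (scalar 7) (.sub (coord (.const 1)) (coord (runIndex 3))))) (coord (.const 0)))
    (A := A) (w := coords w) hd
    (fun i _ m => haddr _ (by simpa using hd) (by simpa using hj))
    (by
      intro i hi
      simp only [RExp.eval]
      rw [hcoord _ i (by simpa using hd) (by simpa using hj) (by simp),
        hcoordk _ i 0 (by simpa using hd) (by simp), hcoordk _ i 1 (by simpa using hd) (by simp)]
      simp only [scalar, RExp.eval, NExp.eval]
      rw [blockWrite_of_not _ _ (by omega), blockWrite_of_not _ _ (by omega),
        blockWrite_of_not, blockWrite_of_not]
      · rw [State.mem_of_vec_eq hy hi, State.mem_of_vec_eq hx hi, State.mem_of_vec_eq hc hi, hη, hw']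
      · have := not_mem_block (d := d) (k := 0) (k' := 2 + j) (by omega) hi
        omega
      · have := not_mem_block (d := d) (k := 1) (k' := 2 + j) (by omega) hi
        omega)
    rfl
  have hs₁d : s₁.nat 0 = d := by simpa [hs₁] using hd
  have hs₁j : s₁.nat 3 = j := by simpa [hs₁] using hj
  have hnat : Function.update s₁.nat 5 d = s₁.nat := by simp [hs₁]
  have h₂ : Runs e _ s₁ _ (fun s' => s' = s₂) := Runs.sumSq (e := e) (s := s₁)
    (r := coord (runIndex 3)) (w := coords w) hs₁d
    (by
      intro i hi z
      rw [hcoord _ i (by simpa using hs₁d) (by simpa using hs₁j) (by simp)]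
      simp only
      rw [Function.update_of_ne (by omega)]
      exact blockWrite_add _ _ _ hi)
    (by rw [sum_range_sq_eq_norm_sq w (coords_val w), hnat])
  have h₃ : Runs e (.ite (.realLt (.mul (scalar 5) (scalar 5)) (scalar 8))
      (.setReal (.const 9) (.div (scalar 5) (.sqrt (scalar 8))))
      (.setReal (.const 9) (.ofNat (.const 1)))) s₂ 20 (fun s' => s' = s₃) := by
    have h5 : s₂.mem 5 = r := by
      simp only [hs₂, hs₁]
      rw [Function.update_of_ne (by norm_num), blockWrite_of_not _ _ (by omega), hr]
    have h8 : s₂.mem 8 = ‖w‖ ^ 2 := by simp [hs₂]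
    refine (Runs.ite (B := 10) (fun hb => ?_) (fun hb => ?_)).mono
      (by simp [Test.cost, RExp.cost, NExp.cost, scalar]) (fun _ h => h)
    · simp only [Test.holds, scalar, RExp.eval, NExp.eval, h5, h8, ← sq] at hb
      refine (Runs.setReal ?_).mono (by simp [NExp.cost, RExp.cost, scalar]) (fun _ h => h)
      simp only [scalar, RExp.eval, NExp.eval, h5, h8, hs₃, hsc, if_pos hb]
    · simp only [Test.holds, scalar, RExp.eval, NExp.eval, h5, h8, ← sq] at hb
      refine (Runs.setReal ?_).mono (by simp [NExp.cost, RExp.cost]) (fun _ h => h)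
      simp only [RExp.eval, NExp.eval, hs₃, hsc, if_neg hb, Nat.cast_one]
  have hs₃d : s₃.nat 0 = d := hs₁d
  have hs₃j : s₃.nat 3 = j := hs₁j
  have hm₃ : ∀ a, a ≠ 8 → a ≠ 9 → s₃.mem a = s₁.mem a := by
    intro a h8 h9
    simp only [hs₃, hs₂]
    rw [Function.update_of_ne h9, Function.update_of_ne h8]
  have h₄ := Runs.assignVec (e := e) (s := s₃)
    (a := vecAddr (runIndex 3)) (r := .add (coord (.const 0)) (.mul (scalar 9) (coord (runIndex 3))))
    (A := A) (w := coords (pull c r (y + η • (x - y)))) hs₃d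
    (fun i _ m => haddr _ (by simpa using hs₃d) (by simpa using hs₃j))
    (by
      intro i hi
      have hn : ¬ (A ≤ vbase d 0 + i ∧ vbase d 0 + i < A + d) :=
        not_mem_block (by omega) hi
      have h0 := sixteen_le_vbase (d := d) 0
      have e0 : s₃.mem (vbase d 0 + i) = coords c i := by
        rw [hm₃ _ (by omega) (by omega), ← State.mem_of_vec_eq hc hi]
        exact blockWrite_of_not _ _ hn
      have e1 : s₃.mem (A + i) = coords w i := by
        rw [hm₃ _ (by omega) (by omega)]
        exact blockWrite_add _ _ _ hi
      have e9 : s₃.mem 9 = sc := by simp [hs₃]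
      simp only [RExp.eval]
      rw [hcoord _ i (by simpa using hs₃d) (by simpa using hs₃j) (by simp),
        hcoordk _ i 0 (by simpa using hs₃d) (by simp)]
      simp only [scalar, RExp.eval, NExp.eval]
      rw [blockWrite_of_not _ _ (by omega), blockWrite_of_not _ _ (by omega),
        blockWrite_of_not _ _ (by omega), e0, e1, e9, hpull])
    (Q := Q) (by
      refine hQ _ ?_ rfl rfl ?_ ?_
      · simp [hs₃, hs₂, hs₁]
      · intro a h8 h9 ha
        simp only
        rw [blockWrite_of_not _ _ ha, hm₃ a h8 h9]
        exact blockWrite_of_not _ _ ha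
      · exact State.vec_eq_of_mem fun i hi => blockWrite_add _ _ _ hi)
  refine (h₁.seq (by rintro _ rfl; exact h₂.seq (by rintro _ rfl; exact h₃.seq (by
    rintro _ rfl; exact h₄)))).mono ?_ fun _ h => h
  simp only [RExp.cost, NExp.cost, coord, vecAddr, runIndex, scalar]
  omega

end Correctness

/-! ### Correctness of the program -/

section Correctness

variable {d : ℕ} {e : Env d}

/-- The parameters in the memory during a stage. -/
structure Config (d : ℕ) where
  runs : ℕ
  alpha : ℝ
  eps : ℝ
  radius : ℝ
  steps : ℝ
  eta : ℝ
  scale : ℝ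
  center : E d

/-- The memory contains the parameters `p`, and `n` samples have been drawn and used. -/
structure Config.Valid (p : Config d) (n : ℕ) (s : State) : Prop where
  dim : s.nat 0 = d
  index : s.nat 1 = n
  runs : s.nat 2 = p.runs
  drawn : s.drawn = n
  calls : s.calls = n
  alpha : s.mem 2 = p.alpha
  eps : s.mem 3 = p.eps
  radius : s.mem 5 = p.radius
  steps : s.mem 6 = p.steps
  eta : s.mem 7 = p.eta
  scale : s.mem 11 = p.scale
  center : s.vec d (vbase d 0) = p.center

/-- Addresses 8 and 9 are scratch, and from the vector 1 on the memory is workspace, so none of this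
affects validity. -/
theorem Config.Valid.congr {p : Config d} {n n' : ℕ} {s s' : State} (h : p.Valid n s)
    (h0 : s'.nat 0 = s.nat 0) (h1 : s'.nat 1 = n') (h2 : s'.nat 2 = s.nat 2)
    (hd : s'.drawn = n') (hc : s'.calls = n')
    (hm : ∀ a, a ≠ 8 → a ≠ 9 → a < vbase d 1 → s'.mem a = s.mem a) : p.Valid n' s' := by
  have hv : vbase d 1 = 16 + d := by simp [vbase]
  have hv0 : vbase d 0 = 16 := by simp [vbase]
  refine ⟨h0.trans h.dim, h1, h2.trans h.runs, hd, hc, ?_, ?_, ?_, ?_, ?_, ?_, ?_⟩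
  · rw [hm _ (by omega) (by omega) (by omega), h.alpha]
  · rw [hm _ (by omega) (by omega) (by omega), h.eps]
  · rw [hm _ (by omega) (by omega) (by omega), h.radius]
  · rw [hm _ (by omega) (by omega) (by omega), h.steps]
  · rw [hm _ (by omega) (by omega) (by omega), h.eta]
  · rw [hm _ (by omega) (by omega) (by omega), h.scale]
  · rw [← h.center]
    exact State.vec_congr fun i hi => hm _ (by omega) (by omega) (by omega)

theorem eval_vecAddr_runIndex {s : State} (hd : s.nat 0 = d) (i : ℕ) :
    (vecAddr (runIndex i)).eval s = vbase d (2 + s.nat i) := by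
  simp only [vecAddr, runIndex, NExp.eval, hd, vbase]

theorem eval_vecAddr_const {s : State} (hd : s.nat 0 = d) (k : ℕ) :
    (vecAddr (.const k)).eval s = vbase d k := by
  simp only [vecAddr, NExp.eval, hd, vbase]

theorem eval_coord_runIndex {s : State} (hd : s.nat 0 = d) (i : ℕ) :
    (coord (runIndex i)).eval s = s.mem (vbase d (2 + s.nat i) + s.nat 5) := by
  simp only [coord, RExp.eval, NExp.eval, eval_vecAddr_runIndex hd]

theorem eval_coord_const {s : State} (hd : s.nat 0 = d) (k : ℕ) :
    (coord (.const k)).eval s = s.mem (vbase d k + s.nat 5) := by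
  simp only [coord, RExp.eval, NExp.eval, eval_vecAddr_const hd]

/-- The answer of the oracle to the query `y` for the sample with number `n`, in its call with the
same number. -/
def Env.reply (e : Env d) (n : ℕ) (y : E d) : E d := e.answer n (e.sample n) y

/-- Samples drawn, oracle calls and the register 1 advance together. Thus call `n` concerns sample
`n`, and every step meets a new point and a new seed. -/
theorem Runs.stepCmd {p : Config d} {n : ℕ} {s : State} (hp : p.Valid n s) {j t : ℕ} {y : E d}
    (hj : s.nat 3 = j) (ht : s.nat 4 = t) (hy : s.vec d (vbase d (2 + j)) = y)
    {Q : State → Prop} (hQ : ∀ s' : State, p.Valid (n + 1) s' → s'.nat 3 = j → s'.nat 4 = t + 1 →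
      (∀ k < j, s'.vec d (vbase d (2 + k)) = s.vec d (vbase d (2 + k))) →
      s'.vec d (vbase d (2 + j)) =
        pull p.center p.radius (y + p.eta • (e.reply n y - y)) → Q s') :
    Runs e stepCmd s ((d + 1) * (e.Ts + 500)) Q := by
  have h01 := vbase_add_le (d := d) (k := 0) (k' := 1) (by omega)
  have h12 := vbase_add_le (d := d) (k := 1) (k' := 2 + j) (by omega)
  have h0 := sixteen_le_vbase (d := d) 0
  set s₂ : State := { s with
    drawn := s.drawn + 1
    mem := s.store (vbase d 1) (e.reply n y)
    calls := s.calls + 1 } with hs₂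
  set s₃ : State := { s₂ with nat := Function.update s₂.nat 1 (n + 1) } with hs₃
  have h₁ : Runs e Cmd.draw s 1 (fun s' => s' = { s with drawn := s.drawn + 1 }) := Runs.draw rfl
  have h₂ : Runs e (.oracle (.reg 1) (vecAddr (runIndex 3)) (vecAddr (.const 1)))
      { s with drawn := s.drawn + 1 } ((NExp.reg 1).cost + (vecAddr (runIndex 3)).cost +
        (vecAddr (.const 1)).cost + e.Ts + d + 1) (fun s' => s' = s₂) := by
    refine Runs.oracle ?_ ?_
    · simp only [NExp.eval, hp.index, hp.drawn]; omega
    · have hd' : ({ s with drawn := s.drawn + 1 } : State).nat 0 = d := hp.dim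
      rw [eval_vecAddr_const hd', eval_vecAddr_runIndex hd']
      have : State.vec d { s with drawn := s.drawn + 1 } (vbase d (2 + s.nat 3)) = y := by
        rw [← hy, hj]; rfl
      rw [this]
      simp only [NExp.eval, hp.index, hp.calls, hs₂, Env.reply]
      rfl
  have h₃ : Runs e (incr 1) s₂ 4 (fun s' => s' = s₃) :=
    Runs.setNat (by simp only [NExp.eval, hs₃, hs₂, hp.index])
  have hm : ∀ a, a < vbase d 1 ∨ vbase d 1 + d ≤ a → s₃.mem a = s.mem a := by
    intro a ha
    exact State.store_of_not _ (by omega)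
  have hp₃ : p.Valid (n + 1) s₃ := by
    refine hp.congr ?_ ?_ ?_ ?_ ?_ fun a _ _ ha => hm a (.inl ha)
    · simp [hs₃, hs₂]
    · simp [hs₃]
    · simp [hs₃, hs₂]
    · simp [hs₃, hs₂, hp.drawn]
    · simp [hs₃, hs₂, hp.calls]
  have hv : ∀ k, s₃.vec d (vbase d (2 + k)) = s.vec d (vbase d (2 + k)) := by
    intro k
    have := vbase_add_le (d := d) (k := 1) (k' := 2 + k) (by omega)
    exact State.vec_congr fun i hi => hm _ (by omega)
  have hx : s₃.vec d (vbase d 1) = e.reply n y := by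
    rw [State.vec_eq_iff]
    exact fun i => State.store_add s _ _ i
  have h₄ : Runs e CoarseMean.gradientCmd s₃ ((d + 1) * 400) (fun s' => p.Valid (n + 1) s' ∧ s'.nat 3 = j ∧
      s'.nat 4 = t ∧ (∀ k < j, s'.vec d (vbase d (2 + k)) = s.vec d (vbase d (2 + k))) ∧
      s'.vec d (vbase d (2 + j)) =
        pull p.center p.radius (y + p.eta • (e.reply n y - y))) := by
    refine Runs.gradientCmd (j := j) hp₃.dim ?_ hp₃.center hx ((hv j).trans hy) hp₃.radius hp₃.eta ?_
    · simpa [hs₃, hs₂] using hj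
    · intro s' hn hdr hca hmem hvec
      refine ⟨hp₃.congr ?_ ?_ ?_ ?_ ?_ ?_, ?_, ?_, ?_, hvec⟩
      · simp [hn]
      · simp [hn, hp₃.index]
      · simp [hn]
      · rw [hdr, hp₃.drawn]
      · rw [hca, hp₃.calls]
      · intro a h8 h9 ha
        exact hmem a h8 h9 (by omega)
      · simpa [hn, hs₃, hs₂] using hj
      · simpa [hn, hs₃, hs₂] using ht
      · intro k hk
        rw [← hv k]
        have h2k := sixteen_le_vbase (d := d) (2 + k)
        refine State.vec_congr fun i hi => hmem _ (by omega) (by omega) ?_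
        exact not_mem_block (by omega) hi
  refine (h₁.seq (by rintro _ rfl; exact h₂.seq (by rintro _ rfl; exact h₃.seq (by
    rintro _ rfl; exact h₄.seq (B₂ := 4) (by
      rintro s' ⟨hp', hj', ht', hk', hy'⟩
      refine Runs.setNat (hQ _ ?_ ?_ ?_ ?_ ?_)
      · refine hp'.congr ?_ ?_ ?_ hp'.drawn hp'.calls fun _ _ _ _ => rfl
        · simp
        · simp [hp'.index]
        · simp
      · simpa using hj'
      · simp [NExp.eval, ht']
      · exact hk'
      · exact hy'))))).mono ?_ fun _ h => h
  simp only [NExp.cost, vecAddr, runIndex]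
  nlinarith

theorem Runs.runCmd {p : Config d} {n : ℕ} {s : State} (hp : p.Valid n s) {j : ℕ} {v : ℕ → E d}
    (hj : s.nat 3 = j) (hv : ∀ k < j, s.vec d (vbase d (2 + k)) = v k)
    (hvj : v j = descent (fun t => e.reply (n + t)) p.center p.radius p.eta ⌈p.steps⌉₊)
    {Q : State → Prop} (hQ : ∀ s' : State, p.Valid (n + ⌈p.steps⌉₊) s' → s'.nat 3 = j + 1 →
      (∀ k < j + 1, s'.vec d (vbase d (2 + k)) = v k) → Q s') :
    Runs e runCmd s ((⌈p.steps⌉₊ + 1) * ((d + 1) * (e.Ts + 600))) Q := by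
  have h01 := vbase_add_le (d := d) (k := 0) (k' := 1) (by omega)
  have h12 := vbase_add_le (d := d) (k := 1) (k' := 2 + j) (by omega)
  have h0 := sixteen_le_vbase (d := d) 0
  set Inv : ℕ → State → Prop := fun t s' => p.Valid (n + t) s' ∧ s'.nat 3 = j ∧ s'.nat 4 = t ∧
    (∀ k < j, s'.vec d (vbase d (2 + k)) = v k) ∧
    s'.vec d (vbase d (2 + j)) =
      descent (fun t => e.reply (n + t)) p.center p.radius p.eta t with hInv
  have h₁ : Runs e (CoarseMean.assignVec (vecAddr (runIndex 3)) (coord (.const 0))) s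
      ((d + 1) * ((vecAddr (runIndex 3)).cost + (coord (.const 0)).cost + 20))
      (fun s' => p.Valid n s' ∧ s'.nat 3 = j ∧ (∀ k < j, s'.vec d (vbase d (2 + k)) = v k) ∧
        s'.vec d (vbase d (2 + j)) = p.center) := by
    refine Runs.assignVec (A := vbase d (2 + j)) (w := coords p.center) hp.dim ?_ ?_ ?_
    · intro i hi m
      rw [eval_vecAddr_runIndex (by simpa using hp.dim)]
      simp [hj]
    · intro i hi
      rw [eval_coord_const (by simpa using hp.dim)]
      simp only [Function.update_self]
      rw [blockWrite_of_not _ _ (by omega), State.mem_of_vec_eq hp.center hi]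
    · refine ⟨hp.congr ?_ ?_ ?_ hp.drawn hp.calls ?_, ?_, ?_, ?_⟩
      · simp
      · simp [hp.index]
      · simp
      · intro a _ _ ha
        exact blockWrite_of_not _ _ (by omega)
      · simpa using hj
      · intro k hk
        rw [← hv k hk]
        exact State.vec_congr fun i hi => blockWrite_of_not _ _ (not_mem_block (by omega) hi)
      · exact State.vec_eq_of_mem fun i hi => blockWrite_add _ _ _ hi
  have h₂ : ∀ s', (p.Valid n s' ∧ s'.nat 3 = j ∧ (∀ k < j, s'.vec d (vbase d (2 + k)) = v k) ∧
        s'.vec d (vbase d (2 + j)) = p.center) →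
      Runs e (.setNat 4 (.const 0)) s' 2 (Inv 0) := by
    rintro s' ⟨hp', hj', hv', hc'⟩
    refine Runs.setNat ⟨hp'.congr ?_ ?_ ?_ hp'.drawn hp'.calls fun _ _ _ _ => rfl, ?_, ?_, hv', hc'⟩
    · simp
    · simp [hp'.index]
    · simp
    · simpa using hj'
    · simp [NExp.eval]
  have h₃ : ∀ s', Inv 0 s' → Runs e (.loop (.realLt (.ofNat (.reg 4)) (scalar 6)) CoarseMean.stepCmd) s'
      (⌈p.steps⌉₊ * ((d + 1) * (e.Ts + 500) + 5) + 5)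
      (Inv ⌈p.steps⌉₊) := fun s' hs' => by
    refine Runs.loop (B := (d + 1) * (e.Ts + 500)) ⌈p.steps⌉₊ ?_ ?_ hs'
    · rintro t ht s'' ⟨hp', hj', ht', hv', hy'⟩
      refine ⟨?_, Runs.stepCmd hp' hj' ht' hy' ?_⟩
      · simp only [Test.holds, RExp.eval, NExp.eval, scalar, ht', hp'.steps]
        -- The test compares the counter with a real number; the loop itself performs the rounding
        -- up.
        exact Nat.lt_ceil.mp ht
      · intro s₁ hp₁ hj₁ ht₁ hv₁ hy₁
        exact ⟨hp₁, hj₁, ht₁, fun k hk => (hv₁ k hk).trans (hv' k hk), hy₁⟩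
    · rintro s'' ⟨hp', hj', ht', hv', hy'⟩
      simp only [Test.holds, RExp.eval, NExp.eval, scalar, ht', hp'.steps, not_lt]
      exact Nat.le_ceil _
  refine (h₁.seq fun s₁ hs₁ => (h₂ s₁ hs₁).seq fun s₂ hs₂ => (h₃ s₂ hs₂).seq (B₂ := 4) ?_).mono
    ?_ fun _ h => h
  · rintro s' ⟨hp', hj', ht', hv', hy'⟩
    refine Runs.setNat (hQ _ ?_ ?_ ?_)
    · refine hp'.congr ?_ ?_ ?_ hp'.drawn hp'.calls fun _ _ _ _ => rfl
      · simp
      · simp [hp'.index]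
      · simp
    · simp [NExp.eval, hj']
    · intro k hk
      rcases Nat.lt_succ_iff_lt_or_eq.mp hk with hk | rfl
      · exact hv' k hk
      · rw [hvj]; exact hy'
  · simp only [NExp.cost, RExp.cost, vecAddr, runIndex, coord]
    generalize ⌈p.steps⌉₊ = T
    have : T * ((d + 1) * (e.Ts + 500) + 5) ≤ T * ((d + 1) * (e.Ts + 600)) :=
      Nat.mul_le_mul_left _ (by nlinarith)
    nlinarith

end Correctness

/-! ### Selection among the runs, and one stage. -/

section Correctness

variable {d : ℕ} {e : Env d}

theorem Runs.countCmd {p : Config d} {n : ℕ} {s : State} (hp : p.Valid n s) {j : ℕ} {v : ℕ → E d}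
    (hj : s.nat 3 = j) (hjJ : j < p.runs) (hv : ∀ k < p.runs, s.vec d (vbase d (2 + k)) = v k)
    {Q : State → Prop} (hQ : ∀ s' : State, p.Valid n s' → s'.nat 3 = j →
      (∀ k < p.runs, s'.vec d (vbase d (2 + k)) = v k) →
      s'.nat 7 = closeCount v p.radius j p.runs → Q s') :
    Runs e countCmd s ((p.runs + 1) * ((d + 1) * 200)) Q := by
  set Inv : ℕ → State → Prop := fun k s' => p.Valid n s' ∧ s'.nat 3 = j ∧
    (∀ k < p.runs, s'.vec d (vbase d (2 + k)) = v k) ∧ s'.nat 6 = k ∧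
    s'.nat 7 = closeCount v p.radius j k with hInv
  have hloop : ∀ s', Inv 0 s' → Runs e (.loop (.natLt (.reg 6) (.reg 2))
      (.seq (CoarseMean.sumSq (.sub (coord (runIndex 6)) (coord (runIndex 3))))
      (.seq (.ite (.realLt (.div (.mul (scalar 5) (scalar 5)) (.ofNat (.const 9))) (scalar 8))
        .skip (incr 7)) (incr 6)))) s'
      (p.runs * ((d + 1) * 100 + 22 + (Test.natLt (.reg 6) (.reg 2)).cost) +
        (Test.natLt (.reg 6) (.reg 2)).cost) (Inv p.runs) := fun s' hs' => by
    refine Runs.loop p.runs ?_ ?_ hs'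
    · rintro k hk s₁ ⟨hp₁, hj₁, hv₁, hk₁, hc₁⟩
      refine ⟨by simp [Test.holds, NExp.eval, hk₁, hp₁.runs, hk], ?_⟩
      set s₂ : State := { s₁ with
        nat := Function.update s₁.nat 5 d
        mem := Function.update s₁.mem 8 (‖v k - v j‖ ^ 2) } with hs₂
      have hsum : Runs e (CoarseMean.sumSq (.sub (coord (runIndex 6)) (coord (runIndex 3)))) s₁
          ((d + 1) * (2 * (RExp.sub (coord (runIndex 6)) (coord (runIndex 3))).cost + 30))
          (fun s' => s' = s₂) := by
        refine Runs.sumSq (w := coords (v k - v j)) hp₁.dim ?_ ?_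
        · intro i hi z
          simp only [RExp.eval]
          have h1 := sixteen_le_vbase (d := d) (2 + k)
          have h2 := sixteen_le_vbase (d := d) (2 + j)
          rw [eval_coord_runIndex (by simpa using hp₁.dim),
            eval_coord_runIndex (by simpa using hp₁.dim), coords_sub,
            ← State.mem_of_vec_eq (hv₁ k hk) hi, ← State.mem_of_vec_eq (hv₁ j hjJ) hi]
          simp only [Function.update_self, Function.update_of_ne (show 6 ≠ 5 by decide),
            Function.update_of_ne (show 3 ≠ 5 by decide), hk₁, hj₁]
          rw [Function.update_of_ne (by omega), Function.update_of_ne (by omega)]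
        · rw [sum_range_sq_eq_norm_sq _ (coords_val _)]
      have hp₂ : p.Valid n s₂ := by
        refine hp₁.congr ?_ ?_ ?_ hp₁.drawn hp₁.calls ?_
        · simp [hs₂]
        · simp [hs₂, hp₁.index]
        · simp [hs₂]
        · intro a h8 _ _
          simp [hs₂, h8]
      have hv₂ : ∀ k < p.runs, s₂.vec d (vbase d (2 + k)) = v k := by
        intro k hk
        rw [← hv₁ k hk]
        have h1 := sixteen_le_vbase (d := d) (2 + k)
        exact State.vec_congr fun i hi => Function.update_of_ne (by omega) _ _
      have hite : Runs e (.ite (.realLt (.div (.mul (scalar 5) (scalar 5)) (.ofNat (.const 9)))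
          (scalar 8)) .skip (incr 7)) s₂
          ((Test.realLt (.div (.mul (scalar 5) (scalar 5)) (.ofNat (.const 9))) (scalar 8)).cost + 4)
          (fun s' => s' = { s₂ with
            nat := Function.update s₂.nat 7 (closeCount v p.radius j (k + 1)) }) := by
        have h7 : s₂.nat 7 = closeCount v p.radius j k := by simpa [hs₂] using hc₁
        have h8 : s₂.mem 8 = ‖v k - v j‖ ^ 2 := by simp [hs₂]
        have hcc : closeCount v p.radius j (k + 1) = closeCount v p.radius j k +
            if p.radius ^ 2 / 9 < ‖v k - v j‖ ^ 2 then 0 else 1 := Finset.sum_range_succ _ _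
        refine Runs.ite (fun hb => ?_) (fun hb => ?_)
        · simp only [Test.holds, scalar, RExp.eval, NExp.eval, hp₂.radius, h8, ← sq,
            Nat.cast_ofNat] at hb
          refine (Runs.skip ?_).mono (by norm_num) fun _ h => h
          rw [hcc, if_pos hb, add_zero, ← h7, Function.update_eq_self]
        · simp only [Test.holds, scalar, RExp.eval, NExp.eval, hp₂.radius, h8, ← sq,
            Nat.cast_ofNat] at hb
          refine (Runs.setNat ?_).mono (by simp [NExp.cost]) fun _ h => h
          rw [hcc, if_neg hb]
          simp only [NExp.eval, h7]
      refine (hsum.seq (by rintro _ rfl; exact hite.seq (B₂ := 4) (by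
        rintro _ rfl
        refine Runs.setNat ⟨hp₂.congr ?_ ?_ ?_ hp₂.drawn hp₂.calls fun _ _ _ _ => rfl,
          ?_, hv₂, ?_, ?_⟩
        · simp
        · simp [hp₂.index]
        · simp
        · simpa [hs₂] using hj₁
        · simp [NExp.eval, hs₂, hk₁]
        · simp))).mono ?_ fun _ h => h
      simp only [NExp.cost, RExp.cost, Test.cost, vecAddr, runIndex, coord, scalar]
      omega
    · rintro s' ⟨hp', -, -, hk', -⟩
      simp [Test.holds, NExp.eval, hk', hp'.runs]
  refine (Runs.setNat_seq (Runs.setNat_seq (hloop _ ?_))).mono ?_ ?_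
  · refine ⟨hp.congr ?_ ?_ ?_ hp.drawn hp.calls fun _ _ _ _ => rfl, ?_, hv, ?_, ?_⟩
    · simp
    · simp [hp.index]
    · simp
    · simpa using hj
    · simp [NExp.eval]
    · simp [NExp.eval, closeCount]
  · simp only [NExp.cost, Test.cost]
    nlinarith
  · rintro s' ⟨hp', hj', hv', -, hc'⟩
    exact hQ s' hp' hj' hv' hc'

/-- The center is overwritten during the scan. This is harmless, since the counts only read the
vectors of the runs, and a later candidate replaces an earlier one exactly as in `select`. -/
theorem Runs.selectCmd {p : Config d} {n : ℕ} {s : State} (hp : p.Valid n s) {j : ℕ} {v : ℕ → E d}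
    (hj : s.nat 3 = j) (hjJ : j < p.runs) (hv : ∀ k < p.runs, s.vec d (vbase d (2 + k)) = v k)
    {Q : State → Prop} (hQ : ∀ s' : State,
      ({ p with center := if p.runs < 2 * closeCount v p.radius j p.runs then v j else p.center } :
        Config d).Valid n s' → s'.nat 3 = j + 1 →
      (∀ k < p.runs, s'.vec d (vbase d (2 + k)) = v k) → Q s') :
    Runs e selectCmd s ((p.runs + 1) * ((d + 1) * 300)) Q := by
  set c' := if p.runs < 2 * closeCount v p.radius j p.runs then v j else p.center with hc'
  have h₁ : Runs e CoarseMean.countCmd s ((p.runs + 1) * ((d + 1) * 200)) (fun s' => p.Valid n s' ∧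
      s'.nat 3 = j ∧ (∀ k < p.runs, s'.vec d (vbase d (2 + k)) = v k) ∧
      s'.nat 7 = closeCount v p.radius j p.runs) :=
    Runs.countCmd hp hj hjJ hv fun s' h1 h2 h3 h4 => ⟨h1, h2, h3, h4⟩
  have h₂ : ∀ s', (p.Valid n s' ∧ s'.nat 3 = j ∧
      (∀ k < p.runs, s'.vec d (vbase d (2 + k)) = v k) ∧
      s'.nat 7 = closeCount v p.radius j p.runs) →
      Runs e (.ite (.natLt (.reg 2) (.mul (.const 2) (.reg 7)))
        (CoarseMean.assignVec (vecAddr (.const 0)) (coord (runIndex 3))) .skip) s'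
        ((Test.natLt (.reg 2) (.mul (.const 2) (.reg 7))).cost + (d + 1) * 40)
        (fun s' => ({ p with center := c' } : Config d).Valid n s' ∧ s'.nat 3 = j ∧
          (∀ k < p.runs, s'.vec d (vbase d (2 + k)) = v k)) := by
    rintro s' ⟨hp', hj', hv', hcount⟩
    refine Runs.ite (fun hb => ?_) (fun hb => ?_)
    · simp only [Test.holds, NExp.eval, hp'.runs, hcount] at hb
      rw [if_pos hb] at hc'
      refine (Runs.assignVec (A := vbase d 0) (w := coords (v j)) hp'.dim ?_ ?_ ?_).mono ?_
        fun _ h => h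
      · intro i _ m
        rw [eval_vecAddr_const (by simpa using hp'.dim)]
      · intro i hi
        rw [eval_coord_runIndex (by simpa using hp'.dim)]
        simp only [Function.update_self, Function.update_of_ne (show 3 ≠ 5 by decide), hj']
        have := vbase_add_le (d := d) (k := 0) (k' := 2 + j) (by omega)
        rw [blockWrite_of_not _ _ (by omega), State.mem_of_vec_eq (hv' j hjJ) hi]
      · have hm : ∀ a < 16, blockWrite s'.mem (vbase d 0) d (coords (v j)) a = s'.mem a := by
          intro a ha
          have := sixteen_le_vbase (d := d) 0
          exact blockWrite_of_not _ _ (by omega)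
        refine ⟨⟨?_, ?_, ?_, hp'.drawn, hp'.calls, ?_, ?_, ?_, ?_, ?_, ?_, ?_⟩, ?_, ?_⟩
        · simpa using hp'.dim
        · simpa using hp'.index
        · simpa using hp'.runs
        · rw [← hp'.alpha]; exact hm _ (by norm_num)
        · rw [← hp'.eps]; exact hm _ (by norm_num)
        · rw [← hp'.radius]; exact hm _ (by norm_num)
        · rw [← hp'.steps]; exact hm _ (by norm_num)
        · rw [← hp'.eta]; exact hm _ (by norm_num)
        · rw [← hp'.scale]; exact hm _ (by norm_num)
        · rw [hc']
          exact State.vec_eq_of_mem fun i hi => blockWrite_add _ _ _ hi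
        · simpa using hj'
        · intro k hk
          rw [← hv' k hk]
          exact State.vec_congr fun i hi => blockWrite_of_not _ _ (not_mem_block (by omega) hi)
      · simp only [NExp.cost, RExp.cost, vecAddr, runIndex, coord]
        omega
    · simp only [Test.holds, NExp.eval, hp'.runs, hcount] at hb
      rw [if_neg hb] at hc'
      refine (Runs.skip ?_).mono (by omega) fun _ h => h
      rw [hc']
      exact ⟨hp', hj', hv'⟩
  refine (h₁.seq fun s₁ hs₁ => (h₂ s₁ hs₁).seq (B₂ := 4) ?_).mono ?_ fun _ h => h
  · rintro s' ⟨hp', hj', hv'⟩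
    refine Runs.setNat (hQ _ (hp'.congr ?_ ?_ ?_ hp'.drawn hp'.calls fun _ _ _ _ => rfl) ?_ hv')
    · simp
    · simp [hp'.index]
    · simp
    · simp [NExp.eval, hj']
  · simp only [NExp.cost, Test.cost]
    nlinarith

/-- The step size of a stage with radius `r`. -/
def stepSize (α X r : ℝ) : ℝ := α ^ 2 * r ^ 2 / (1152000 * (1 + 2 * r) * X)

theorem stage_cost_le (J T : ℕ) {u w U : ℕ} (hu : u + 400 ≤ U) (hw : w + 400 ≤ U) :
    J * ((T + 1) * u + 3) + J * ((J + 1) * w + 3) + 120 ≤ (J + 1) * ((J + T + 2) * U) := by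
  have h1 : J * ((T + 1) * u + 3) ≤ J * ((T + 1) * U) := by
    refine Nat.mul_le_mul_left _ ?_
    have := Nat.mul_le_mul_left (T + 1) hu
    nlinarith
  have h2 : J * ((J + 1) * w + 3) ≤ J * ((J + 1) * U) := by
    refine Nat.mul_le_mul_left _ ?_
    have := Nat.mul_le_mul_left (J + 1) hw
    nlinarith
  have h3 : 120 ≤ 2 * U := by omega
  nlinarith [Nat.zero_le (T * U), Nat.zero_le (J * U)]

theorem Runs.stageCmd {p : Config d} {n : ℕ} {s : State} (hp : p.Valid n s)
    {Q : State → Prop} (hQ : ∀ s' : State,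
      ({ p with
        radius := p.radius * (1 / 2)
        eta := stepSize p.alpha p.scale p.radius
        center := stage (fun t => e.reply (n + t)) p.center p.radius
          (stepSize p.alpha p.scale p.radius) ⌈p.steps⌉₊ p.runs } : Config d).Valid
        (n + p.runs * ⌈p.steps⌉₊) s' → Q s') :
    Runs e stageCmd s ((p.runs + 1) * ((p.runs + ⌈p.steps⌉₊ + 2) * ((d + 1) * (e.Ts + 1000)))) Q := by
  set η := stepSize p.alpha p.scale p.radius with hη
  set p' : Config d := { p with eta := η } with hp'
  set v : ℕ → E d := fun k => run (fun t => e.reply (n + t)) p.center p.radius η ⌈p.steps⌉₊ k with hv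
  have h16 := sixteen_le_vbase (d := d) 0
  set s₁ : State := { s with mem := Function.update s.mem 7 η } with hs₁
  have hp₁ : p'.Valid n s₁ := by
    refine ⟨hp.dim, hp.index, hp.runs, hp.drawn, hp.calls, ?_, ?_, ?_, ?_, ?_, ?_, ?_⟩
    · simpa [hs₁] using hp.alpha
    · simpa [hs₁] using hp.eps
    · simpa [hs₁] using hp.radius
    · simpa [hs₁] using hp.steps
    · simp [hs₁, hp']
    · simpa [hs₁] using hp.scale
    · rw [← show _ = p'.center from hp.center]
      exact State.vec_congr fun i hi => Function.update_of_ne (by omega) _ _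
  have h₁ : Runs e (.setReal (.const 7) etaExp) s ((NExp.const 7).cost + etaExp.cost + 1)
      (fun s' => s' = s₁) := by
    refine Runs.setReal ?_
    simp only [NExp.eval, etaExp, RExp.eval, scalar, hp.alpha, hp.radius, hp.scale, Nat.cast_ofNat,
      Nat.cast_one, hs₁, hη, stepSize, sq]
  have h₂ : ∀ (q : Config d) n' s', q.Valid n' s' →
      Runs e (.setNat 3 (.const 0)) s' 2 (fun s'' => q.Valid n' s'' ∧ s''.nat 3 = 0 ∧
        ∀ a, s''.vec d a = s'.vec d a) := by
    intro q n' s' hq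
    refine Runs.setNat ⟨hq.congr ?_ ?_ ?_ hq.drawn hq.calls fun _ _ _ _ => rfl, ?_, fun _ => rfl⟩
    · simp
    · simp [hq.index]
    · simp
    · simp [NExp.eval]
  have h₃ : ∀ s', p'.Valid n s' ∧ s'.nat 3 = 0 → Runs e (.loop (.natLt (.reg 3) (.reg 2)) CoarseMean.runCmd) s'
      (p.runs * ((⌈p.steps⌉₊ + 1) * ((d + 1) * (e.Ts + 600)) + (Test.natLt (.reg 3) (.reg 2)).cost) +
        (Test.natLt (.reg 3) (.reg 2)).cost)
      (fun s'' => p'.Valid (n + p.runs * ⌈p.steps⌉₊) s'' ∧ s''.nat 3 = p.runs ∧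
        ∀ k < p.runs, s''.vec d (vbase d (2 + k)) = v k) := by
    rintro s' ⟨hs', h3⟩
    refine Runs.loop (Inv := fun j s'' => p'.Valid (n + j * ⌈p.steps⌉₊) s'' ∧ s''.nat 3 = j ∧
        ∀ k < j, s''.vec d (vbase d (2 + k)) = v k) p.runs ?_ ?_ ⟨by simpa using hs', h3, by simp⟩
    · rintro j hj s'' ⟨h1, h2, h3⟩
      have hr : s''.nat 2 = p.runs := h1.runs
      refine ⟨by simp [Test.holds, NExp.eval, h2, hr, hj], ?_⟩
      refine Runs.runCmd h1 h2 h3 ?_ ?_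
      · simp only [hv, run, hp', add_assoc]
      · intro s₃ h4 h5 h6
        refine ⟨?_, h5, h6⟩
        rw [add_one_mul, ← add_assoc]
        exact h4
    · rintro s'' ⟨h1, h2, h3⟩
      have hr : s''.nat 2 = p.runs := h1.runs
      simp [Test.holds, NExp.eval, h2, hr]
  have h₄ : ∀ n' s', p'.Valid n' s' ∧ s'.nat 3 = 0 ∧
      (∀ k < p.runs, s'.vec d (vbase d (2 + k)) = v k) →
      Runs e (.loop (.natLt (.reg 3) (.reg 2)) CoarseMean.selectCmd) s'
      (p.runs * ((p.runs + 1) * ((d + 1) * 300) + (Test.natLt (.reg 3) (.reg 2)).cost) +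
        (Test.natLt (.reg 3) (.reg 2)).cost)
      (fun s'' => ({ p' with center := select v p.radius p.runs p.center p.runs } :
        Config d).Valid n' s'') := by
    rintro n' s' ⟨hs', h3, hv'⟩
    refine (Runs.loop (Inv := fun j s'' => ({ p' with
        center := select v p.radius p.runs p.center j } : Config d).Valid n' s'' ∧ s''.nat 3 = j ∧
        ∀ k < p.runs, s''.vec d (vbase d (2 + k)) = v k) p.runs ?_ ?_ ⟨hs', h3, hv'⟩).mono le_rfl
        fun _ h => h.1
    · rintro j hj s'' ⟨h1, h2, h3⟩
      have hr : s''.nat 2 = p.runs := h1.runs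
      refine ⟨by simp [Test.holds, NExp.eval, h2, hr, hj], ?_⟩
      refine Runs.selectCmd h1 h2 hj h3 ?_
      intro s₃ h4 h5 h6
      exact ⟨h4, h5, h6⟩
    · rintro s'' ⟨h1, h2, h3⟩
      have hr : s''.nat 2 = p.runs := h1.runs
      simp [Test.holds, NExp.eval, h2, hr]
  have h₅ : ∀ s', ({ p' with center := select v p.radius p.runs p.center p.runs } :
        Config d).Valid (n + p.runs * ⌈p.steps⌉₊) s' →
      Runs e (.setReal (.const 5) (.mul (scalar 5) (.div (.ofNat (.const 1)) (.ofNat (.const 2))))) s'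
        10 Q := by
    intro s₅ hs₅
    refine (Runs.setReal (hQ _ ?_)).mono ?_ fun _ h => h
    · have h5 : s₅.mem 5 = p.radius := hs₅.radius
      simp only [NExp.eval, RExp.eval, scalar, h5, Nat.cast_one, Nat.cast_ofNat]
      refine ⟨hs₅.dim, hs₅.index, hs₅.runs, hs₅.drawn, hs₅.calls, ?_, ?_, ?_, ?_, ?_, ?_, ?_⟩
      · simpa using hs₅.alpha
      · simpa using hs₅.eps
      · simp
      · simpa using hs₅.steps
      · simpa using hs₅.eta
      · simpa using hs₅.scale
      · refine Eq.trans ?_ hs₅.center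
        exact State.vec_congr fun i hi => Function.update_of_ne (by omega) _ _
    · simp [NExp.cost, RExp.cost, scalar]
  refine (h₁.seq (by
    rintro _ rfl
    exact (h₂ p' n s₁ hp₁).seq fun s₂ hs₂ => (h₃ s₂ ⟨hs₂.1, hs₂.2.1⟩).seq fun s₃ hs₃ =>
      (h₂ p' _ s₃ hs₃.1).seq fun s₄ hs₄ => (h₄ _ s₄ ⟨hs₄.1, hs₄.2.1, fun k hk =>
        (hs₄.2.2 _).trans (hs₃.2.2 k hk)⟩).seq h₅)).mono ?_ fun _ h => h
  refine le_trans ?_ (stage_cost_le p.runs ⌈p.steps⌉₊ (u := (d + 1) * (e.Ts + 600))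
    (w := (d + 1) * 300) (by nlinarith) (by nlinarith))
  simp only [NExp.cost, RExp.cost, Test.cost, scalar, etaExp, Nat.reduceAdd]
  omega

end Correctness

/-! ### Initialization and the whole program. -/

section Correctness

variable {d : ℕ} {e : Env d}

/-- The number of steps of a run, before rounding. -/
def stepNumber (α ε X : ℝ) : ℝ := 597196800000 * X / (α ^ 4 * ε ^ 2)

/-- The machine has no logarithm: it finds `J` by multiplying `2D / (εδ)` by 3/4 until the value is
at most 1. The two hypotheses say that `J` is the first such exponent. -/
theorem Runs.initCmd {R D α ε δ : ℝ} {J : ℕ} (hJ : 2 * D / (ε * δ) * (3 / 4) ^ J ≤ 1)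
    (hJ' : ∀ j < J, 1 < 2 * D / (ε * δ) * (3 / 4) ^ j) {Q : State → Prop}
    (hQ : ∀ s' : State, ({
        runs := J
        alpha := α
        eps := ε
        radius := D
        steps := stepNumber α ε (d * R ^ 2 + D ^ 2)
        eta := 0
        scale := d * R ^ 2 + D ^ 2
        center := 0 } : Config d).Valid 0 s' → Q s') :
    Runs e initCmd (State.init d R D α ε δ) ((J + 1) * 200) Q := by
  set s := State.init d R D α ε δ with hs
  set X : ℝ := d * R ^ 2 + D ^ 2 with hX
  set s₁ : State := { s with mem := Function.update s.mem 11 X } with hs₁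
  set s₂ : State := { s₁ with mem := Function.update s₁.mem 6 (stepNumber α ε X) } with hs₂
  have h0 : s.mem 0 = R := rfl
  have h1 : s.mem 1 = D := rfl
  have h2 : s.mem 2 = α := rfl
  have h3 : s.mem 3 = ε := rfl
  have h4 : s.mem 4 = δ := rfl
  set st : ℕ → State := fun j => { s₂ with
    nat := Function.update s₂.nat 2 j
    mem := Function.update s₂.mem 10 (2 * D / (ε * δ) * (3 / 4) ^ j) } with hst
  have hr₁ : Runs e (.setReal (.const 11) scaleExp) s ((NExp.const 11).cost + scaleExp.cost + 1)
      (fun s' => s' = s₁) := by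
    refine Runs.setReal ?_
    simp only [scaleExp, RExp.eval, NExp.eval, scalar, h0, h1, hs₁, hX, sq]
    rfl
  have hr₂ : Runs e (.setReal (.const 6) stepsExp) s₁ ((NExp.const 6).cost + stepsExp.cost + 1)
      (fun s' => s' = s₂) := by
    refine Runs.setReal ?_
    have e1 : s₁.mem 11 = X := by simp [hs₁]
    have e2 : s₁.mem 2 = α := by simp [hs₁, h2]
    have e3 : s₁.mem 3 = ε := by simp [hs₁, h3]
    simp only [stepsExp, RExp.eval, NExp.eval, scalar, e1, e2, e3, hs₂, stepNumber,
      show α ^ 4 = α * α * (α * α) by ring, sq, Nat.cast_ofNat]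
  have hr₃ : Runs e (.setReal (.const 10) (.div (.mul (.ofNat (.const 2)) (scalar 1))
      (.mul (scalar 3) (scalar 4)))) s₂ 20 (fun s' => s' = st 0) := by
    refine (Runs.setReal ?_).mono (by simp [NExp.cost, RExp.cost, scalar]) fun _ h => h
    have e1 : s₂.mem 1 = D := by simp [hs₂, hs₁, h1]
    have e3 : s₂.mem 3 = ε := by simp [hs₂, hs₁, h3]
    have e4 : s₂.mem 4 = δ := by simp [hs₂, hs₁, h4]
    have e5 : Function.update s₂.nat 2 0 = s₂.nat := by
      rw [Function.update_eq_self_iff]; rfl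
    simp only [RExp.eval, NExp.eval, scalar, e1, e3, e4, hst, pow_zero, mul_one, e5, Nat.cast_ofNat]
  have hr₄ : Runs e (.loop (.realLt (.ofNat (.const 1)) (scalar 10))
      (.seq (.setReal (.const 10) (.mul (scalar 10) (.div (.ofNat (.const 3)) (.ofNat (.const 4)))))
      (incr 2))) (st 0) (J * (20 + (Test.realLt (.ofNat (.const 1)) (scalar 10)).cost) +
      (Test.realLt (.ofNat (.const 1)) (scalar 10)).cost) (fun s' => s' = st J) := by
    have e10 : ∀ j, (st j).mem 10 = 2 * D / (ε * δ) * (3 / 4) ^ j := fun j => by simp [hst]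
    refine Runs.loop (Inv := fun j s' => s' = st j) J ?_ ?_ rfl
    · rintro j hj _ rfl
      refine ⟨?_, ?_⟩
      · simp only [Test.holds, RExp.eval, NExp.eval, scalar, e10, Nat.cast_one]
        exact hJ' j hj
      · refine (Runs.setReal_seq (Runs.setNat ?_)).mono
          (by simp [NExp.cost, RExp.cost, scalar]) fun _ h => h
        simp only [RExp.eval, NExp.eval, scalar, Nat.cast_ofNat, hst, Function.update_self,
          Function.update_idem, pow_succ, mul_assoc]
    · rintro _ rfl
      simp only [Test.holds, RExp.eval, NExp.eval, scalar, e10, Nat.cast_one, not_lt]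
      exact hJ
  have hr₅ : Runs e (.setReal (.const 5) (scalar 1)) (st J) 10 Q := by
    refine (Runs.setReal (hQ _ ?_)).mono (by simp [NExp.cost, RExp.cost, scalar]) fun _ h => h
    refine ⟨?_, ?_, ?_, rfl, rfl, ?_, ?_, ?_, ?_, ?_, ?_, ?_⟩
    · simp [hst, hs₂, hs₁, hs, State.init]
    · simp [hst, hs₂, hs₁, hs, State.init]
    · simp [hst, hs₂, hs₁, hs, State.init]
    · simp [NExp.eval, hst, hs₂, hs₁, h2]
    · simp [NExp.eval, hst, hs₂, hs₁, h3]
    · simp [NExp.eval, RExp.eval, scalar, hst, hs₂, hs₁, h1]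
    · simp [NExp.eval, hst, hs₂]
    · simp [NExp.eval, hst, hs₂, hs₁, hs, State.init]
    · simp [NExp.eval, hst, hs₂, hs₁]
    · refine State.vec_eq_of_mem fun i hi => ?_
      obtain ⟨a, ha⟩ : ∃ a, vbase d 0 + i = a := ⟨_, rfl⟩
      have ha16 : 16 ≤ a := ha ▸ (sixteen_le_vbase 0).trans (Nat.le_add_right _ _)
      rw [ha]
      simp only [NExp.eval, hst, hs₂, hs₁]
      rw [Function.update_of_ne (by omega), Function.update_of_ne (by omega),
        Function.update_of_ne (by omega), Function.update_of_ne (by omega)]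
      simp only [hs, State.init, coords]
      split_ifs <;> first | omega | rfl
  refine (hr₁.seq (by rintro _ rfl; exact hr₂.seq (by rintro _ rfl; exact hr₃.seq (by
    rintro _ rfl; exact hr₄.seq (by rintro _ rfl; exact hr₅))))).mono ?_ fun _ h => h
  simp only [NExp.cost, RExp.cost, Test.cost, scalar, scaleExp, stepsExp, Nat.reduceAdd]
  omega

/-- An identity for every environment, without probability: it reduces the theorem to a statement
about `stages`. -/
theorem runs_algorithm {R D α ε δ : ℝ} {J K : ℕ} (hJ : 2 * D / (ε * δ) * (3 / 4) ^ J ≤ 1)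
    (hJ' : ∀ j < J, 1 < 2 * D / (ε * δ) * (3 / 4) ^ j) (hK : D * (1 / 2) ^ K ≤ ε)
    (hK' : ∀ k < K, ε < D * (1 / 2) ^ k) {T : ℕ}
    (hT : T = ⌈stepNumber α ε (d * R ^ 2 + D ^ 2)⌉₊) :
    Runs e algorithm (State.init d R D α ε δ)
      ((K + 1) * (2 * ((J + 1) * ((J + T + 2) * ((d + 1) * (e.Ts + 1000))))))
      (fun s => s.drawn = K * (J * T) ∧ s.output d =
        stages e.reply D (stepSize α (d * R ^ 2 + D ^ 2)) T J K) := by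
  set X : ℝ := d * R ^ 2 + D ^ 2 with hX
  -- Between stages the stored step size is stale (0 at the start) and is recomputed at the next
  -- stage, so the invariant leaves it arbitrary.
  set Inv : ℕ → State → Prop := fun k s => ∃ η', ({
        runs := J
        alpha := α
        eps := ε
        radius := D * (1 / 2) ^ k
        steps := stepNumber α ε X
        eta := η'
        scale := X
        center := stages e.reply D (stepSize α X) T J k } : Config d).Valid (k * (J * T)) s with hInv
  set B := (J + 1) * ((J + T + 2) * ((d + 1) * (e.Ts + 1000))) with hB
  have h₁ : Runs e initCmd (State.init d R D α ε δ) ((J + 1) * 200) (Inv 0) := by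
    refine Runs.initCmd hJ hJ' fun s' hs' => ⟨0, ?_⟩
    rw [pow_zero, mul_one, zero_mul]
    exact hs'
  have h₂ : ∀ s, Inv 0 s → Runs e (.loop (.realLt (scalar 3) (scalar 5)) stageCmd) s
      (K * (B + (Test.realLt (scalar 3) (scalar 5)).cost) +
        (Test.realLt (scalar 3) (scalar 5)).cost) (Inv K) := fun s hs => by
    refine Runs.loop K ?_ ?_ hs
    · rintro k hk s' ⟨η', hs'⟩
      refine ⟨?_, ?_⟩
      · simp only [Test.holds, RExp.eval, NExp.eval, scalar, hs'.eps, hs'.radius]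
        exact hK' k hk
      · refine (Runs.stageCmd (Q := Inv (k + 1)) hs' fun s₁ hs₁ =>
          ⟨stepSize α X (D * (1 / 2) ^ k), ?_⟩).mono ?_ fun _ h => h
        · rw [← hT] at hs₁
          rw [pow_succ, ← mul_assoc D, add_one_mul]
          exact hs₁
        · rw [← hT]
    · rintro s' ⟨η', hs'⟩
      simp only [Test.holds, RExp.eval, NExp.eval, scalar, hs'.eps, hs'.radius, not_lt]
      exact hK
  have h₃ : ∀ s, Inv K s → Runs e (assignVec (.const 0) (coord (.const 0))) s
      ((d + 1) * ((NExp.const 0).cost + (coord (.const 0)).cost + 20))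
      (fun s => s.drawn = K * (J * T) ∧ s.output d =
        stages e.reply D (stepSize α X) T J K) := by
    rintro s ⟨η', hs⟩
    refine Runs.assignVec (A := 0) (w := coords (stages e.reply D (stepSize α X) T J K)) hs.dim
      (fun _ _ _ => rfl) ?_ ⟨hs.drawn, State.vec_eq_of_mem fun i hi => blockWrite_add _ _ _ hi⟩
    intro i hi
    have := sixteen_le_vbase (d := d) 0
    rw [eval_coord_const (by simpa using hs.dim)]
    simp only [Function.update_self]
    rw [blockWrite_of_not _ _ (by omega), State.mem_of_vec_eq hs.center hi]
  refine (h₁.seq fun s₁ hs₁ => (h₂ s₁ hs₁).seq h₃).mono ?_ fun _ h => h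
  have hB₁ : (J + 1) * (d + 1) * 2000 ≤ B := by
    have h1 : 2 * ((d + 1) * 1000) ≤ (J + T + 2) * ((d + 1) * (e.Ts + 1000)) := by gcongr <;> omega
    have h2 := Nat.mul_le_mul_left (J + 1) h1
    rw [hB]
    refine le_trans (le_of_eq (by ring)) h2
  clear_value B
  have h3 : (J + 1) * 2000 ≤ B := by nlinarith [Nat.zero_le (J * d)]
  have h4 : (d + 1) * 2000 ≤ B := by nlinarith [Nat.zero_le (J * d)]
  simp only [NExp.cost, RExp.cost, Test.cost, scalar, coord, vecAddr, Nat.reduceAdd]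
  have h5 : K * 5 ≤ K * B := Nat.mul_le_mul_left _ (by omega)
  nlinarith

end Correctness

/-! ### The choice of the parameters -/

section Parameters

variable {d : ℕ} {𝒬 : Set (Set (E d))} {Seed : Type} {S : Set (E d) → E d → Seed → E d}
  [MeasurableSpace Seed] {ρ : Measure Seed} [IsProbabilityMeasure ρ] {R D α ε : ℝ} {μ : E d}

/-- The rate of contraction of a step of gradient descent. -/
def contraction (α X r : ℝ) : ℝ := α ^ 4 * r ^ 2 / (115200000 * (1 + 2 * r) ^ 2 * X)

/-- For `‖y - μ‖ ≤ 2r`, the minimum of the distance and its square is at least the square divided by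
`1 + 2r`, which gives a linear contraction. As `‖y‖ ≤ 3D`, the noise is at most `2 * 9D² + 4dR² +
2D² ≤ 20X`. -/
theorem lintegral_norm_sq_step_le (hα : 0 < α) (hd : 1 ≤ d) (hR1 : 1 ≤ R)
    (h𝒬 : IsObservablePartition 𝒬) (hconv : IsConvexPartition 𝒬) (hR : IsLocalPartition R 𝒬)
    (hS : IsSamplingOracle R 𝒬 ρ S) (hinf : IsInformationPreserving α 𝒬 μ) (hμ : ‖μ‖ ≤ D)
    {r : ℝ} (hr : 0 < r) (hrD : r ≤ D) {y : E d} (hy : ‖y - μ‖ ≤ 2 * r) {X : ℝ}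
    (hX : X = d * R ^ 2 + D ^ 2) :
    ∫⁻ z, ENNReal.ofReal (‖y + stepSize α X r • (response 𝒬 S z y - y) - μ‖ ^ 2)
      ∂(gaussian μ).prod ρ ≤
      ENNReal.ofReal ((1 - contraction α X r) * ‖y - μ‖ ^ 2 + 20 * X * stepSize α X r ^ 2) := by
  have hD : 0 < D := hr.trans_le hrD
  have hX0 : 0 < X := by rw [hX]; positivity
  have hη : 0 ≤ stepSize α X r := by unfold stepSize; positivity
  have hL := memLp_response hd h𝒬 hR hS (ρ := ρ) μ y
  have hL1 : MemLp (fun z => response 𝒬 S z y - y) 2 ((gaussian μ).prod ρ) := hL.sub (memLp_const y)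
  have hL2 : MemLp (fun z => stepSize α X r • (response 𝒬 S z y - y)) 2 ((gaussian μ).prod ρ) :=
    hL1.const_smul (stepSize α X r)
  have hL3 : MemLp (fun z => y + stepSize α X r • (response 𝒬 S z y - y)) 2
      ((gaussian μ).prod ρ) := (memLp_const y).add hL2
  have hL4 : MemLp (fun z => y + stepSize α X r • (response 𝒬 S z y - y) - μ) 2
      ((gaussian μ).prod ρ) := hL3.sub (memLp_const μ)
  have hint : Integrable (fun z => ‖y + stepSize α X r • (response 𝒬 S z y - y) - μ‖ ^ 2)
      ((gaussian μ).prod ρ) := hL4.integrable_norm_pow two_ne_zero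
  rw [← ofReal_integral_eq_lintegral_ofReal hint (.of_forall fun _ => sq_nonneg _)]
  refine ENNReal.ofReal_le_ofReal ?_
  refine (integral_norm_sq_step_le hα hd hR1 h𝒬 hconv hR hS hinf y hη).trans ?_
  have hy3 : ‖y‖ ≤ 3 * D := by
    calc ‖y‖ = ‖(y - μ) + μ‖ := by rw [sub_add_cancel]
      _ ≤ ‖y - μ‖ + ‖μ‖ := norm_add_le _ _
      _ ≤ _ := by linarith
  have hG : 2 * ‖y‖ ^ 2 + 2 * (2 * (d * R ^ 2) + ‖μ‖ ^ 2) ≤ 20 * X := by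
    have h1 : ‖y‖ ^ 2 ≤ (3 * D) ^ 2 := by gcongr
    have h2 : ‖μ‖ ^ 2 ≤ D ^ 2 := by gcongr
    have h3 : 0 ≤ d * R ^ 2 := by positivity
    rw [hX]; nlinarith
  have hmin : ‖y - μ‖ ^ 2 / (1 + 2 * r) ≤ min ‖y - μ‖ (‖y - μ‖ ^ 2) := by
    have h0 := norm_nonneg (y - μ)
    have h1 : ‖y - μ‖ ^ 2 / (1 + 2 * r) ≤ ‖y - μ‖ := by
      rw [div_le_iff₀ (by linarith)]
      nlinarith
    have h2 : ‖y - μ‖ ^ 2 / (1 + 2 * r) ≤ ‖y - μ‖ ^ 2 :=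
      div_le_self (sq_nonneg _) (by linarith)
    exact le_min h1 h2
  have hl : contraction α X r * ‖y - μ‖ ^ 2 =
      2 * stepSize α X r * (α ^ 2 / 200 * (‖y - μ‖ ^ 2 / (1 + 2 * r))) := by
    unfold contraction stepSize
    field_simp
    ring
  have h1 : 2 * stepSize α X r * (α ^ 2 / 200 * (‖y - μ‖ ^ 2 / (1 + 2 * r))) ≤
      2 * stepSize α X r * (α ^ 2 / 200 * min ‖y - μ‖ (‖y - μ‖ ^ 2)) := by gcongr
  have h2 : stepSize α X r ^ 2 * (2 * ‖y‖ ^ 2 + 2 * (2 * (d * R ^ 2) + ‖μ‖ ^ 2)) ≤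
      stepSize α X r ^ 2 * (20 * X) := by gcongr
  linarith

/-- Bernoulli's inequality for `(1 + l) ^ T`, combined with `(1 - l)(1 + l) ≤ 1`. -/
theorem pow_contraction_le {l : ℝ} (hl0 : 0 < l) (hl1 : l ≤ 1) {T : ℕ} {M : ℝ} (hM : 0 < M)
    (hT : M ≤ l * T) : (1 - l) ^ T ≤ 1 / M := by
  have h1 : 1 + T * l ≤ (1 + l) ^ T := one_add_mul_le_pow (by linarith) T
  have h2 : (1 - l) ^ T * (1 + l) ^ T ≤ 1 := by
    rw [← mul_pow]
    exact pow_le_one₀ (by nlinarith) (by nlinarith)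
  have h3 : 0 ≤ (1 - l) ^ T := pow_nonneg (by linarith) T
  rw [le_div_iff₀ hM]
  nlinarith

/-- The error budget `r² / 288` is shared equally. The step size is made such that the noise part `b
/ l` equals `r² / 576`. The initial error is reduced by 576 once the contraction rate times `T` is
at least 576. Since `(1 + 2r) ε ≤ 3r` for `ε < r` and `ε < 1`, one `T` serves all radii; its
constant is `115200000 * 576 * 9`. -/
theorem streamLaw_descent_stepSize_bad_le (hα : 0 < α) (hα1 : α ≤ 1) (hd : 1 ≤ d) (hR1 : 1 ≤ R)
    (hε : 0 < ε) (hε1 : ε < 1)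
    (h𝒬 : IsObservablePartition 𝒬) (hconv : IsConvexPartition 𝒬) (hR : IsLocalPartition R 𝒬)
    (hS : IsSamplingOracle R 𝒬 ρ S) (hinf : IsInformationPreserving α 𝒬 μ) (hμ : ‖μ‖ ≤ D)
    {r : ℝ} (hr : ε < r) (hrD : r ≤ D) {c : E d} (hc : ‖c - μ‖ ≤ r) {X : ℝ}
    (hX : X = d * R ^ 2 + D ^ 2) {T : ℕ} (hT : stepNumber α ε X ≤ T) :
    streamLaw ((gaussian μ).prod ρ) {ω | r / 6 <
      ‖descent (fun i => response 𝒬 S (ω i)) c r (stepSize α X r) T - μ‖} ≤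
        ENNReal.ofReal (1 / 8) := by
  have hr0 : 0 < r := hε.trans hr
  have hD : 0 < D := hr0.trans_le hrD
  have hX0 : 0 < X := by rw [hX]; positivity
  have hXr : r ^ 2 ≤ X := by
    have : r ^ 2 ≤ D ^ 2 := by gcongr
    have : 0 ≤ d * R ^ 2 := by positivity
    linarith
  have hl0 : 0 < contraction α X r := by unfold contraction; positivity
  have hl1 : contraction α X r ≤ 1 := by
    unfold contraction
    rw [div_le_one (by positivity)]
    have h1 : α ^ 4 ≤ 1 := pow_le_one₀ hα.le hα1
    have h2 : 1 ≤ (1 + 2 * r) ^ 2 := one_le_pow₀ (by linarith)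
    calc α ^ 4 * r ^ 2 ≤ 1 * X := by gcongr
      _ ≤ 115200000 * (1 + 2 * r) ^ 2 * X := by gcongr; linarith
  refine streamLaw_descent_bad_le (measurable_response h𝒬 hS) hr0 hc hl0 hl1
    (b := 20 * X * stepSize α X r ^ 2) (by positivity)
    (fun y hy => lintegral_norm_sq_step_le hα hd hR1 h𝒬 hconv hR hS hinf hμ hr0 hrD hy hX) ?_
  have h1 : 20 * X * stepSize α X r ^ 2 / contraction α X r = r ^ 2 / 576 := by
    unfold contraction stepSize
    field_simp
    norm_num
  have h2 : 576 ≤ contraction α X r * T := by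
    have h3 : contraction α X r * stepNumber α ε X = 5184 * r ^ 2 / ((1 + 2 * r) ^ 2 * ε ^ 2) := by
      unfold contraction stepNumber
      field_simp
      norm_num
    have h4 : 576 ≤ 5184 * r ^ 2 / ((1 + 2 * r) ^ 2 * ε ^ 2) := by
      rw [le_div_iff₀ (by positivity), ← mul_pow]
      have h5 : (1 + 2 * r) * ε ≤ 3 * r := by nlinarith
      have h6 : ((1 + 2 * r) * ε) ^ 2 ≤ (3 * r) ^ 2 := by gcongr
      linarith
    calc _ ≤ _ := h4
      _ = _ := h3.symm
      _ ≤ _ := by gcongr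
  have h3 := pow_contraction_le hl0 hl1 (by norm_num) h2
  rw [h1]
  have h4 : (1 - contraction α X r) ^ T * r ^ 2 ≤ 1 / 576 * r ^ 2 := by gcongr
  linarith

/-- A union bound over the stages. The crude bound `K ≤ 2 ^ (K - 1) ≤ D / ε` for `K ≥ 1` is
affordable because `J` is logarithmic in `D / (εδ)`; moreover `11 / 16 ≤ 3 / 4`. -/
theorem mul_pow_le_of_halvings {δ : ℝ} (hε : 0 < ε) (hδ : 0 < δ) {J K : ℕ}
    (hJ : 2 * D / (ε * δ) * (3 / 4) ^ J ≤ 1) (hK : ∀ k < K, ε < D * (1 / 2) ^ k) :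
    K * (11 / 16 : ℝ) ^ J ≤ δ := by
  rcases K with _ | K
  · simpa using hδ.le
  have h1 := hK K (Nat.lt_succ_self K)
  have hD : 0 < D := by
    have := hε.trans h1
    exact pos_of_mul_pos_left this (by positivity)
  have h2 : ((K + 1 : ℕ) : ℝ) ≤ 2 ^ K := by exact_mod_cast Nat.lt_two_pow_self
  have h3 : ε * 2 ^ K ≤ D := by
    have : ε * 2 ^ K ≤ D * (1 / 2) ^ K * 2 ^ K := by gcongr
    rwa [mul_assoc, ← mul_pow, one_div, inv_mul_cancel₀ two_ne_zero, one_pow, mul_one] at this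
  have h4 : 2 * D * (3 / 4) ^ J ≤ ε * δ := by
    rwa [div_mul_eq_mul_div, div_le_one (by positivity)] at hJ
  have h5 : ((K + 1 : ℕ) : ℝ) * (11 / 16 : ℝ) ^ J ≤ 2 ^ K * (3 / 4) ^ J := by
    exact mul_le_mul h2 (pow_le_pow_left₀ (by norm_num) (by norm_num) J) (by positivity)
      (by positivity)
  refine h5.trans ?_
  have h6 : (0 : ℝ) < (3 / 4) ^ J := by positivity
  have h7 : ε * (2 ^ K * (3 / 4) ^ J) ≤ ε * δ := by
    calc ε * (2 ^ K * (3 / 4) ^ J) = ε * 2 ^ K * (3 / 4) ^ J := by ring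
      _ ≤ D * (3 / 4) ^ J := by gcongr
      _ ≤ 2 * D * (3 / 4) ^ J := by nlinarith
      _ ≤ _ := h4
  exact le_of_mul_le_mul_left h7 hε

/-- The estimate is proved for the measurable `response` on the stream of pairs. It passes to the
true oracle answers because the two differ only for a null set of points, and there are countably
many draws. -/
theorem randomness_stages_bad_le {δ : ℝ} (hα : 0 < α) (hα1 : α ≤ 1) (hd : 1 ≤ d) (hR1 : 1 ≤ R)
    (hε : 0 < ε) (hε1 : ε < 1) (hδ : 0 < δ)
    (h𝒬 : IsObservablePartition 𝒬) (hconv : IsConvexPartition 𝒬) (hR : IsLocalPartition R 𝒬)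
    (hS : IsSamplingOracle R 𝒬 ρ S) (hinf : IsInformationPreserving α 𝒬 μ) (hμ : ‖μ‖ ≤ D)
    {X : ℝ} (hX : X = d * R ^ 2 + D ^ 2) {T J K : ℕ} (hT : stepNumber α ε X ≤ T)
    (hJ : 2 * D / (ε * δ) * (3 / 4) ^ J ≤ 1) (hK : D * (1 / 2) ^ K ≤ ε)
    (hK' : ∀ k < K, ε < D * (1 / 2) ^ k) (Ts : ℕ) :
    randomness μ ρ {ω | ε <
      ‖stages (env 𝒬 S Ts ω.1 ω.2).reply D (stepSize α X) T J K - μ‖} ≤ ENNReal.ofReal δ := by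
  have hD : 0 ≤ D := (norm_nonneg _).trans hμ
  have hbad : streamLaw ((gaussian μ).prod ρ) {ω | ε <
      ‖stages (fun i => response 𝒬 S (ω i)) D (stepSize α X) T J K - μ‖} ≤ ENNReal.ofReal δ := by
    refine (measure_mono fun ω hω => ?_).trans ((streamLaw_stages_bad_le
      (measurable_response h𝒬 hS) hD hμ K (η := stepSize α X) (T := T) (J := J)
      fun k hk c hc => ?_).trans
      (ENNReal.ofReal_le_ofReal (mul_pow_le_of_halvings hε hδ hJ hK')))
    · exact hK.trans_lt hω
    · exact streamLaw_descent_stepSize_bad_le hα hα1 hd hR1 hε hε1 h𝒬 hconv hR hS hinf hμ (hK' k hk)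
        (mul_le_of_le_one_right hD (pow_le_one₀ (by norm_num) (by norm_num))) hc hX hT
  set F : (ℕ → E d) × (ℕ → Seed) → E d := fun ω =>
    stages (fun i => response 𝒬 S (ω.1 i, ω.2 i)) D (stepSize α X) T J K with hF
  have hFm : Measurable F := (measurable_stages (measurable_response h𝒬 hS) D (stepSize α X) T J K).comp
    (f := fun ω : (ℕ → E d) × (ℕ → Seed) => fun i => (ω.1 i, ω.2 i)) (by fun_prop)
  have hrand : randomness μ ρ = (streamLaw ((gaussian μ).prod ρ)).map
      (fun ω => (fun i => (ω i).1, fun i => (ω i).2)) := (map_unzip_streamLaw (gaussian μ) ρ).symm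
  have hmain : randomness μ ρ {ω | ε < ‖F ω - μ‖} ≤ ENNReal.ofReal δ := by
    rw [hrand, Measure.map_apply (by fun_prop)
      (measurableSet_lt measurable_const (hFm.sub_const μ).norm)]
    exact hbad
  have hae : ∀ᵐ ω ∂randomness μ ρ, ∀ i s y, S (cell 𝒬 (ω.1 i)) y s = response 𝒬 S (ω.1 i, s) y := by
    have h1 : ∀ᵐ x ∂Measure.infinitePi (fun _ : ℕ => gaussian μ),
        ∀ i s y, S (cell 𝒬 (x i)) y s = response 𝒬 S (x i, s) y := by
      rw [ae_all_iff]
      intro i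
      exact (measurePreserving_eval_infinitePi (fun _ : ℕ => gaussian μ) i).quasiMeasurePreserving.ae
        ((gaussian_absolutelyContinuous μ).ae_le (ae_response_eq h𝒬 hS))
    exact Measure.quasiMeasurePreserving_fst.ae h1
  refine le_trans (measure_mono_ae ?_) hmain
  filter_upwards [hae] with ω hω hlt
  have : (env 𝒬 S Ts ω.1 ω.2).reply = fun i => response 𝒬 S (ω.1 i, ω.2 i) := by
    ext1 i; ext1 y; exact hω i _ y
  change ε < ‖stages (env 𝒬 S Ts ω.1 ω.2).reply D (stepSize α X) T J K - μ‖ at hlt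
  rw [this] at hlt
  exact hlt

end Parameters

/-! ### The size of the parameters -/

section Size

theorem exists_first_pow_le (q : ℝ) {b c : ℝ} (hb0 : 0 ≤ b) (hb : b < 1) (hc : 0 < c) :
    ∃ n : ℕ, q * b ^ n ≤ c ∧ ∀ k < n, c < q * b ^ k := by
  classical
  have h : ∃ n : ℕ, q * b ^ n ≤ c := by
    have h1 := (tendsto_pow_atTop_nhds_zero_of_lt_one hb0 hb).const_mul q
    rw [mul_zero] at h1
    exact (h1.eventually_le_const hc).exists
  exact ⟨Nat.find h, Nat.find_spec h, fun k hk => not_le.1 (Nat.find_min h hk)⟩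

/-- Taking logarithms and using `log b ≤ b - 1` bounds every exponent before the threshold is
reached. Hence `J` and `K` are logarithmic. -/
theorem mul_le_log_of_lt_mul_pow {q b c : ℝ} (hb : 0 < b) (hc : 0 < c) {n : ℕ}
    (h : c < q * b ^ n) : n * (1 - b) ≤ Real.log (q / c) := by
  have hbn : 0 < b ^ n := pow_pos hb n
  have hq : 0 < q := pos_of_mul_pos_left (hc.trans h) hbn.le
  have h1 : 1 < q / c * b ^ n := by
    rw [div_mul_eq_mul_div, one_lt_div hc]; exact h
  have h2 := Real.log_pos h1
  rw [Real.log_mul (by positivity) hbn.ne', Real.log_pow] at h2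
  have h3 := Real.log_le_sub_one_of_pos hb
  have h4 : n * Real.log b ≤ n * (b - 1) := by gcongr
  linarith

/-- With `L` the maximum, `J ≤ 1 + 4 * 2L ≤ 9L` and `K ≤ 1 + 2L ≤ 3L`, whence the constant 27;
rounding up `T` adds 1 to its constant. The product uses only `L ^ 2`. The witness `m` is the
integer part of the whole bound, large enough to dominate `d`, `J`, `K` and `T` as the time bound
requires. -/
theorem exists_parameters {d : ℕ} {R α ε δ : ℝ} (D : ℝ) (hd : 1 ≤ d) (hR : 1 ≤ R) (hα : 0 < α)
    (hα1 : α ≤ 1) (hε : 0 < ε) (hε1 : ε < 1) (hδ : 0 < δ) (hδ1 : δ < 1) :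
    ∃ m J K T : ℕ, (m : ℝ) ≤ 27 * 597196800001 * ((d * R ^ 2 + D ^ 2) / (α ^ 4 * ε ^ 2) *
        (max 1 (Real.log (d * R * D / (ε * δ)))) ^ 3) ∧
      2 * D / (ε * δ) * (3 / 4) ^ J ≤ 1 ∧ (∀ j < J, 1 < 2 * D / (ε * δ) * (3 / 4) ^ j) ∧
      D * (1 / 2) ^ K ≤ ε ∧ (∀ k < K, ε < D * (1 / 2) ^ k) ∧
      T = ⌈stepNumber α ε (d * R ^ 2 + D ^ 2)⌉₊ ∧
      K * (J * T) ≤ m ∧ J ≤ m ∧ K ≤ m ∧ T ≤ m ∧ d ≤ m := by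
  obtain ⟨J, hJ, hJ'⟩ := exists_first_pow_le (2 * D / (ε * δ)) (b := 3 / 4) (c := 1) (by norm_num)
    (by norm_num) one_pos
  obtain ⟨K, hK, hK'⟩ := exists_first_pow_le D (b := 1 / 2) (c := ε) (by norm_num) (by norm_num) hε
  set L := max 1 (Real.log (d * R * D / (ε * δ))) with hL
  set X : ℝ := d * R ^ 2 + D ^ 2 with hX
  set Y : ℝ := X / (α ^ 4 * ε ^ 2) with hY
  set T := ⌈stepNumber α ε X⌉₊ with hT
  have hL1 : 1 ≤ L := le_max_left _ _
  have hd1 : (1 : ℝ) ≤ d := by exact_mod_cast hd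
  have hdR : 1 ≤ d * R := one_le_mul_of_one_le_of_one_le hd1 hR
  have hεδ : 0 < ε * δ := by positivity
  have hdX : (d : ℝ) ≤ X := by
    have h1 : (1 : ℝ) ≤ R ^ 2 := one_le_pow₀ hR
    nlinarith [sq_nonneg D]
  have hXY : X ≤ Y := by
    rw [hY, le_div_iff₀ (by positivity)]
    have h1 : α ^ 4 * ε ^ 2 ≤ 1 :=
      mul_le_one₀ (pow_le_one₀ hα.le hα1) (by positivity) (pow_le_one₀ hε.le hε1.le)
    exact mul_le_of_le_one_right (by linarith) h1
  have hJL : (J : ℝ) ≤ 9 * L := by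
    rcases J with _ | J
    · push_cast; linarith
    have h1 := hJ' J (Nat.lt_succ_self J)
    have h2 := mul_le_log_of_lt_mul_pow (by norm_num) one_pos h1
    have hq : 0 < 2 * D / (ε * δ) := pos_of_mul_pos_left (one_pos.trans h1) (by positivity)
    have hD : 0 < D := by
      have := (div_pos_iff_of_pos_right hεδ).1 hq
      linarith
    have h3 : Real.log (2 * D / (ε * δ) / 1) ≤ 2 * L := by
      have h4 : 2 * D / (ε * δ) / 1 ≤ 2 * (d * R * D / (ε * δ)) := by
        rw [div_one, mul_div_assoc]
        gcongr
        exact le_mul_of_one_le_left hD.le hdR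
      refine (Real.log_le_log (by positivity) h4).trans ?_
      rw [Real.log_mul two_ne_zero (by positivity)]
      have h5 := Real.log_le_sub_one_of_pos (x := 2) two_pos
      have h6 : Real.log (d * R * D / (ε * δ)) ≤ L := le_max_right _ _
      linarith
    push_cast
    linarith
  have hKL : (K : ℝ) ≤ 3 * L := by
    rcases K with _ | K
    · push_cast; linarith
    have h1 := hK' K (Nat.lt_succ_self K)
    have h2 := mul_le_log_of_lt_mul_pow (by norm_num) hε h1
    have hD : 0 < D := pos_of_mul_pos_left (hε.trans h1) (by positivity)
    have h3 : Real.log (D / ε) ≤ L := by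
      refine (Real.log_le_log (by positivity) ?_).trans (le_max_right _ _)
      have : ε * δ ≤ ε := mul_le_of_le_one_right hε.le hδ1.le
      gcongr
      exact le_mul_of_one_le_left hD.le hdR
    push_cast
    linarith
  have hTY : (T : ℝ) ≤ 597196800001 * Y := by
    have h1 : stepNumber α ε X = 597196800000 * Y := mul_div_assoc _ _ _
    have h2 := (Nat.ceil_lt_add_one (a := stepNumber α ε X) (by rw [h1]; linarith)).le
    rw [← hT, h1] at h2
    linarith
  have hY1 : 1 ≤ Y := by linarith
  have hL2 : L ^ 2 ≤ L ^ 3 := pow_le_pow_right₀ hL1 (by norm_num)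
  have hL3 : L ≤ L ^ 3 := le_self_pow₀ hL1 (by norm_num)
  have hYL : Y ≤ Y * L ^ 3 := le_mul_of_one_le_right (by linarith) (by linarith)
  have hLY : L ≤ Y * L ^ 3 := hL3.trans (le_mul_of_one_le_left (by linarith) hY1)
  have hprod : (K : ℝ) * (J * T) ≤ 27 * 597196800001 * (Y * L ^ 3) := by
    calc (K : ℝ) * (J * T) ≤ 3 * L * (9 * L * (597196800001 * Y)) := by gcongr
      _ = 27 * 597196800001 * (Y * L ^ 2) := by ring
      _ ≤ _ := by gcongr
  refine ⟨⌊27 * 597196800001 * (Y * L ^ 3)⌋₊, J, K, T, Nat.floor_le (by positivity), hJ, hJ', hK,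
    hK', rfl, Nat.le_floor ?_, Nat.le_floor ?_, Nat.le_floor ?_, Nat.le_floor ?_, Nat.le_floor ?_⟩
  · push_cast; exact hprod
  · linarith
  · linarith
  · linarith
  · linarith

theorem time_le {m J K T d Ts A : ℕ} (hJ : J ≤ m) (hK : K ≤ m) (hT : T ≤ m) (hd : d ≤ m)
    (hA : 4000 ≤ A) :
    (K + 1) * (2 * ((J + 1) * ((J + T + 2) * ((d + 1) * (Ts + 1000))))) ≤
      A * (m + Ts + 1) ^ A := by
  set M := m + Ts + 1 with hM
  calc (K + 1) * (2 * ((J + 1) * ((J + T + 2) * ((d + 1) * (Ts + 1000)))))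
      ≤ M * (2 * (M * ((2 * M) * (M * (1000 * M))))) := by gcongr <;> omega
    _ = 4000 * M ^ 5 := by ring
    _ ≤ A * M ^ A := Nat.mul_le_mul hA (Nat.pow_le_pow_right (by omega) (by omega))

end Size

end CoarseMean

end

/-! ### The main theorem. -/

open CoarseMean in
theorem mainTheorem4 :
    ∃ (prog : Cmd) (C : ℝ) (A : ℕ),
      ∀ (d : ℕ) (R D α ε δ : ℝ), 1 ≤ d → 1 ≤ R → 0 < α → α ≤ 1 → 0 < ε → ε < 1 → 0 < δ → δ < 1 →
        ∃ m : ℕ,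
          (m : ℝ) ≤ C * ((d * R ^ 2 + D ^ 2) / (α ^ 4 * ε ^ 2) *
            (max 1 (Real.log (d * R * D / (ε * δ)))) ^ 3) ∧
          ∀ (𝒬 : Set (Set (E d))) (μstar : E d), IsObservablePartition 𝒬 → IsConvexPartition 𝒬 →
            IsLocalPartition R 𝒬 → IsInformationPreserving α 𝒬 μstar → ‖μstar‖ ≤ D →
            ∀ (Seed : Type) [MeasurableSpace Seed] (ρ : MeasureTheory.Measure Seed)
              [MeasureTheory.IsProbabilityMeasure ρ] (S : Set (E d) → E d → Seed → E d) (Ts : ℕ),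
              IsSamplingOracle R 𝒬 ρ S →
              (∀ (x : ℕ → E d) (r : ℕ → Seed), ∃ (s : State) (t : ℕ),
                Exec (env 𝒬 S Ts x r) prog (State.init d R D α ε δ) s t ∧
                  s.drawn ≤ m ∧ t ≤ A * (m + Ts + 1) ^ A) ∧
              randomness μstar ρ {ω | ¬ ∃ (s : State) (t : ℕ),
                Exec (env 𝒬 S Ts ω.1 ω.2) prog (State.init d R D α ε δ) s t ∧
                  ‖s.output d - μstar‖ ≤ ε} ≤ ENNReal.ofReal δ := by
  -- The time is at most `4000 * (m + Ts + 1) ^ 5`, so one number `A ≥ 4000` serves both as factor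
  -- and as exponent.
  obtain ⟨A, hA⟩ : ∃ A : ℕ, 4000 ≤ A := ⟨4000, le_rfl⟩
  refine ⟨algorithm, 27 * 597196800001, A, ?_⟩
  intro d R D α ε δ hd hR hα hα1 hε hε1 hδ hδ1
  obtain ⟨m, J, K, T, hm, hJ, hJ', hK, hK', hT, hKJT, hJm, hKm, hTm, hdm⟩ :=
    exists_parameters D hd hR hα hα1 hε hε1 hδ hδ1
  refine ⟨m, hm, fun 𝒬 μstar h𝒬 hconv hloc hinf hμ Seed _ ρ _ S Ts hS => ⟨fun x r => ?_, ?_⟩⟩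
  · obtain ⟨s, t, h1, h2, h3, -⟩ := runs_algorithm (e := env 𝒬 S Ts x r) hJ hJ' hK hK' hT
    exact ⟨s, t, h1, h3.trans_le hKJT, h2.trans (time_le hJm hKm hTm hdm hA)⟩
  -- Measurability of the failure event is not needed: it is contained in the event that `stages`
  -- misses `μstar` by more than `ε`.
  · refine le_trans (MeasureTheory.measure_mono fun ω hω => ?_) (randomness_stages_bad_le hα hα1 hd
      hR hε hε1 hδ h𝒬 hconv hloc hS hinf hμ rfl (hT ▸ Nat.le_ceil _) hJ hK hK' Ts)
    obtain ⟨s, t, h1, -, -, h4⟩ := runs_algorithm (e := env 𝒬 S Ts ω.1 ω.2) hJ hJ' hK hK' hT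
    by_contra hlt
    refine hω ⟨s, t, h1, ?_⟩
    rw [h4]
    exact not_lt.1 hlt
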